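/- Let $d\in\{2,3\}$, let $\Omega\subset\mathbb R^d$ be a bounded domain with Lipschitz boundary, let $a=(a_{ij})$ be a measurable, symmetric matrix function on $\Omega$ with $\alpha|\xi|^2\le \xi^Ta(x)\xi\le\beta|\xi|^2$ for all $\xi\in\mathbb R^d$ and almost every $x\in\Omega$, where $0<\alpha,\beta<\infty$ are constants, and let $f\in L^2(\Omega)$. Assume that the problem $$\sum_{i,j=1}^d a_{ij}\partial^2_{ij}u=f\ \text{ in }\Omega,\qquad u=0\ \text{ on }\partial\Omega, \tag{1.1}$$ has a unique strong solution $u\in H^2(\Omega)\cap H^1_0(\Omega)$ (the equation holding almost everywhere). Let $\mathcal T_h$ be a finite partition of $\Omega$ into open polygons ($d=2$) or polyhedra ($d=3$), convex or not, with set of edges or flat faces $\mathcal E_h$: the faces $e\in\mathcal E_h$ are relatively open, pairwise disjoint polygons or segments in hyperplanes; the boundary of each cell $T$ is the union of the closures of the faces contained in it; every face lies in the boundary of some cell; and each $T$ lies locally on one side of each of its faces, with outward unit normal $\mathbf n=(n_1,\dots,n_d)$. Let $h_T$ be the diameter of $T$. (No shape regularity is needed.) Let $k\ge2$ and $r\ge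 k-2$ be integers, and let $P_m(D)$ denote the polynomials of total degree at most $m$ on $D$. Let $W_h$ be the space of triples $v=\{v_0,v_b,\mathbf v_g\}$ with $v_0|_T\in P_k(T)$ for each $T\in\mathcal T_h$, and with $v_b|_e\in P_k(e)$ and $\mathbf v_g|_e\in[P_{k-1}(e)]^d$, both single-valued, on each $e\in\mathcal E_h$. Let $W_h^0$ be the subspace of those $v\in W_h$ with $v_b|_e=0$ for all $e\subset\partial\Omega$. For $v\in W_h$, the discrete weak derivative $\partial^2_{ij,w}v$ is given on each $T$ as the polynomial in $P_r(T)$ with $$(\partial^2_{ij,w}v,\varphi)_T=(v_0,\partial^2_{ji}\varphi)_T-\langle v_bn_i,\partial_j\varphi\rangle_{\partial T}+\langle v_{gi},\varphi n_j\rangle_{\partial T}\qquad\text{for all }\varphi\in P_r(T).$$ Let $$a(u,v)=\sum_{T\in\mathcal T_h}\Big(\sum_{i,j}a_{ij}\partial^2_{ij,w}u,\ \sum_{i,j}a_{ij}\partial^2_{ij,w}v\Big)_T,$$ $$s(u,v)=\sum_{T\in\mathcal T_h}\Big(h_T^{-3}\langle u_0-u_b,v_0-v_b\rangle_{\partial T}+h_T^{-1}\langle\nabla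 u_0-\mathbf u_g,\nabla v_0-\mathbf v_g\rangle_{\partial T}\Big).$$ Then $W_h^0$ is finite-dimensional, and there is exactly one $u_h\in W_h^0$ with $$a(u_h,v)+s(u_h,v)=\sum_{T\in\mathcal T_h}\Big(f,\sum_{i,j}a_{ij}\partial^2_{ij,w}v\Big)_T\qquad\text{for all }v\in W_h^0. \tag{3.1}$$ Moreover, for every basis $b_1,\dots,b_n$ of $W_h^0$, the matrix $A$ with entries $A_{lm}=a(b_m,b_l)+s(b_m,b_l)$ is symmetric positive definite, and $u_h\in W_h^0$ solves (3.1) if and only if its coordinate vector $x$ satisfies $Ax=F$, where $F_l=\sum_T(f,\sum_{i,j}a_{ij}\partial^2_{ij,w}b_l)_T$. -/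

import Mathlib

open MeasureTheory Set Filter Topology
open scoped ContDiff

noncomputable section

namespace LSWG

/-- `ℝᵈ` with its Euclidean norm. -/
abbrev Space (d : ℕ) : Type := EuclideanSpace ℝ (Fin d)

/-! ### Domains -/

/-- The boundary of `Ω` is locally the graph of a Lipschitz function, with `Ω` on one side of it.
The graph variable `y - ⟪ν, y⟫ ν` is the orthogonal projection of `y` onto the hyperplane `νᗮ`. -/
def HasLipschitzBoundary {d : ℕ} (Ω : Set (Space d)) : Prop :=
  ∀ x ∈ frontier Ω, ∃ (ν : Space d) (K : NNReal) (g : Space d → ℝ),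
    ‖ν‖ = 1 ∧ LipschitzWith K g ∧
      ∀ᶠ y in 𝓝 x, (y ∈ Ω ↔ g (y - inner ℝ ν y • ν) < inner ℝ ν y)

/-- A bounded domain with Lipschitz boundary. -/
structure IsLipschitzDomain {d : ℕ} (Ω : Set (Space d)) : Prop where
  isOpen : IsOpen Ω
  isConnected : IsConnected Ω
  isBounded : Bornology.IsBounded Ω
  lipschitz : HasLipschitzBoundary Ω

/-! ### The continuous problem -/

/-- The coefficients are essentially bounded measurable functions on `Ω`, symmetric and uniformly
elliptic. (Essential boundedness follows from the upper bound.) -/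
structure IsEllipticCoefficient {d : ℕ} (Ω : Set (Space d))
    (a : Space d → Matrix (Fin d) (Fin d) ℝ) : Prop where
  measurable : ∀ i j, AEStronglyMeasurable (fun x => a x i j) (volume.restrict Ω)
  symm : ∀ᵐ x ∂volume.restrict Ω, (a x).IsSymm
  elliptic : ∃ α β : ℝ, 0 < α ∧ 0 < β ∧ ∀ᵐ x ∂volume.restrict Ω, ∀ ξ : Fin d → ℝ,
    α * (ξ ⬝ᵥ ξ) ≤ ξ ⬝ᵥ (a x).mulVec ξ ∧ ξ ⬝ᵥ (a x).mulVec ξ ≤ β * (ξ ⬝ᵥ ξ)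

/-- Smooth functions with compact support in `Ω`. -/
structure IsTestFunction {d : ℕ} (Ω : Set (Space d)) (φ : Space d → ℝ) : Prop where
  smooth : ContDiff ℝ ∞ φ
  compact : HasCompactSupport φ
  subset : tsupport φ ⊆ Ω

/-- The classical partial derivative `∂ᵢφ`. -/
def partialDeriv {d : ℕ} (i : Fin d) (φ : Space d → ℝ) (x : Space d) : ℝ :=
  fderiv ℝ φ x (EuclideanSpace.single i 1)

/-- `g` is the weak partial derivative `∂ᵢu` in `Ω`. It is used for `u` and `g` in `L²(Ω)` only. -/
def IsWeakPartial {d : ℕ} (Ω : Set (Space d)) (i : Fin d) (u g : Space d → ℝ) : Prop :=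
  ∀ φ : Space d → ℝ, IsTestFunction Ω φ →
    ∫ x in Ω, u x * partialDeriv i φ x = -∫ x in Ω, g x * φ x

/-- `u` is a strong solution of `∑ aᵢⱼ ∂²ᵢⱼ u = f` in `Ω`, `u = 0` on `∂Ω`: it lies in
`H²(Ω) ∩ H¹₀(Ω)` and the equation holds almost everywhere. Here `G` is the weak gradient and `H` the
weak Hessian of `u`, and `H¹₀(Ω)` is the closure of the test functions in the norm of `H¹(Ω)`. -/
def IsStrongSolution {d : ℕ} (Ω : Set (Space d)) (a : Space d → Matrix (Fin d) (Fin d) ℝ)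
    (f u : Space d → ℝ) : Prop :=
  ∃ (G : Fin d → Space d → ℝ) (H : Fin d → Fin d → Space d → ℝ),
    MemLp u 2 (volume.restrict Ω) ∧
    (∀ i, MemLp (G i) 2 (volume.restrict Ω) ∧ IsWeakPartial Ω i u (G i)) ∧
    (∀ i j, MemLp (H i j) 2 (volume.restrict Ω) ∧ IsWeakPartial Ω j (G i) (H i j)) ∧
    (∃ φ : ℕ → Space d → ℝ, (∀ n, IsTestFunction Ω (φ n)) ∧
      Tendsto (fun n => eLpNorm (u - φ n) 2 (volume.restrict Ω)) atTop (𝓝 0) ∧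
      ∀ i, Tendsto (fun n => eLpNorm (G i - partialDeriv i (φ n)) 2 (volume.restrict Ω))
        atTop (𝓝 0)) ∧
    ∀ᵐ x ∂volume.restrict Ω, ∑ i, ∑ j, a x i j * H i j x = f x

/-! ### Polygonal and polyhedral meshes -/

/-- `S` is a (not necessarily convex) polytope, without its relative boundary, in the affine
subspace `H`: a non-empty bounded connected set that is relatively open in `H`, equal to the relative
interior of its closure, and whose relative boundary is flat, i.e. contained in finitely many proper
affine subspaces of `H`. For `H` a line these are the open segments, for `H` a plane the polygons,
and for `H` a three-dimensional space the polyhedra. -/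
structure IsPolytopeIn {d : ℕ} (H : AffineSubspace ℝ (Space d)) (S : Set (Space d)) : Prop where
  isConnected : IsConnected S
  isBounded : Bornology.IsBounded S
  relOpen : ∃ U : Set (Space d), IsOpen U ∧ S = U ∩ H
  regular : ∀ U : Set (Space d), IsOpen U → U ∩ H ⊆ closure S → U ∩ H ⊆ S
  flat : ∃ 𝓕 : Finset (AffineSubspace ℝ (Space d)),
    (∀ F ∈ 𝓕, F < H) ∧ closure S \ S ⊆ ⋃ F ∈ 𝓕, (F : Set (Space d))

/-- A finite partition of `Ω` into polygons (`d = 2`) or polyhedra (`d = 3`), with its edges or flat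
faces. Cells may be non-convex. The (relatively open) faces are pairwise disjoint, so with hanging
nodes the sides of a cell are subdivided into several faces. -/
structure PolyMesh {d : ℕ} (Ω : Set (Space d)) where
  /-- the index set of the cells -/
  Cell : Type
  /-- the index set of the faces -/
  Face : Type
  [fintypeCell : Fintype Cell]
  [fintypeFace : Fintype Face]
  /-- the (open) cells -/
  cell : Cell → Set (Space d)
  /-- the (relatively open) edges, for `d = 2`, or flat faces, for `d = 3` -/
  face : Face → Set (Space d)
  /-- `normal T e` is the unit normal vector on the face `e`, outward with respect to the cell `T`;
  it has no meaning if `e` is not contained in the boundary of `T` -/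
  normal : Cell → Face → Space d
  cell_polytope : ∀ T, IsPolytopeIn ⊤ (cell T)
  cell_disjoint : Pairwise fun T T' => Disjoint (cell T) (cell T')
  cell_subset : ∀ T, cell T ⊆ Ω
  cover : closure Ω = ⋃ T, closure (cell T)
  face_polytope : ∀ e, ∃ H : AffineSubspace ℝ (Space d),
    Module.finrank ℝ H.direction + 1 = d ∧ IsPolytopeIn H (face e)
  face_disjoint : Pairwise fun e e' => Disjoint (face e) (face e')
  /-- every face is a face of some cell -/
  face_used : ∀ e, ∃ T, face e ⊆ frontier (cell T)
  /-- the boundary of a cell consists of (closed) faces -/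
  frontier_cell : ∀ T, frontier (cell T) =
    ⋃ e ∈ {e | face e ⊆ frontier (cell T)}, closure (face e)
  normal_unit : ∀ T e, face e ⊆ frontier (cell T) → ‖normal T e‖ = 1
  /-- a cell lies locally on one side of each of its faces, and the normal points away from it -/
  normal_outward : ∀ T e, face e ⊆ frontier (cell T) → ∀ x ∈ face e,
    ∀ᶠ y in 𝓝 x, (y ∈ cell T ↔ inner ℝ (normal T e) (y - x) < 0)

attribute [instance] PolyMesh.fintypeCell PolyMesh.fintypeFace

/-! ### Polynomials and weak finite element functions -/

/-- The value of a polynomial at a point of `ℝᵈ`. -/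
def polyEval {d : ℕ} (p : MvPolynomial (Fin d) ℝ) (x : Space d) : ℝ :=
  MvPolynomial.eval (fun i => x i) p

/-- `P_r(e)`: the functions on the set `e` that are restrictions of polynomials of total degree at
most `r`. -/
def polyOn {d : ℕ} (r : ℕ) (e : Set (Space d)) : Submodule ℝ (e → ℝ) where
  carrier := {g | ∃ p ∈ MvPolynomial.restrictTotalDegree (Fin d) ℝ r, ∀ x : e, g x = polyEval p x}
  add_mem' := by
    rintro g g' ⟨p, hp, h⟩ ⟨p', hp', h'⟩
    exact ⟨p + p', Submodule.add_mem _ hp hp', fun x => by simp [h x, h' x, polyEval]⟩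
  zero_mem' := ⟨0, Submodule.zero_mem _, fun x => by simp [polyEval]⟩
  smul_mem' := by
    rintro c g ⟨p, hp, h⟩
    exact ⟨c • p, Submodule.smul_mem _ c hp, fun x => by simp [h x, polyEval, MvPolynomial.smul_eval]⟩

variable {d : ℕ} {Ω : Set (Space d)}

namespace PolyMesh

/-- Triples `v = (v₀, v_b, v_g)`: a polynomial `v₀` on each cell, a function `v_b` on each face and a
vector-valued function `v_g` on each face. (A cell is open and non-empty, so polynomial functions on
it and polynomials are the same.) The components `v_b` and `v_g` are single-valued: the two cells on
both sides of an interior face share them. -/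
abbrev Triple (M : PolyMesh Ω) : Type :=
  (M.Cell → MvPolynomial (Fin d) ℝ) × ((e : M.Face) → M.face e → ℝ) ×
    ((e : M.Face) → Fin d → M.face e → ℝ)

/-- The weak finite element space `W_h`: `v₀ ∈ P_k(T)` on each cell, `v_b ∈ P_k(e)` and
`v_g ∈ [P_{k-1}(e)]ᵈ` on each face. -/
def weakSpace (M : PolyMesh Ω) (k : ℕ) : Submodule ℝ M.Triple where
  carrier := {v | (∀ T, v.1 T ∈ MvPolynomial.restrictTotalDegree (Fin d) ℝ k) ∧
    (∀ e, v.2.1 e ∈ polyOn k (M.face e)) ∧ ∀ e i, v.2.2 e i ∈ polyOn (k - 1) (M.face e)}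
  add_mem' := fun hv hw => ⟨fun T => add_mem (hv.1 T) (hw.1 T),
    fun e => add_mem (hv.2.1 e) (hw.2.1 e), fun e i => add_mem (hv.2.2 e i) (hw.2.2 e i)⟩
  zero_mem' := ⟨fun _ => zero_mem _, fun _ => zero_mem _, fun _ _ => zero_mem _⟩
  smul_mem' := fun c _ hv => ⟨fun T => Submodule.smul_mem _ c (hv.1 T),
    fun e => Submodule.smul_mem _ c (hv.2.1 e), fun e i => Submodule.smul_mem _ c (hv.2.2 e i)⟩

/-- The space `W_h⁰`: the elements of `W_h` with `v_b = 0` on the faces contained in `∂Ω`. -/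
def weakSpaceZero (M : PolyMesh Ω) (k : ℕ) : Submodule ℝ M.Triple where
  carrier := {v | v ∈ M.weakSpace k ∧ ∀ e, M.face e ⊆ frontier Ω → v.2.1 e = 0}
  add_mem' := fun hv hw => ⟨add_mem hv.1 hw.1, fun e he => by simp [hv.2 e he, hw.2 e he]⟩
  zero_mem' := ⟨zero_mem _, fun _ _ => rfl⟩
  smul_mem' := fun c _ hv => ⟨Submodule.smul_mem _ c hv.1, fun e he => by simp [hv.2 e he]⟩

/-- The integral of `g` over the face `e` with respect to arc length (`d = 2`) or surface area
(`d = 3`). -/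
def faceIntegral (M : PolyMesh Ω) (e : M.Face) (g : M.face e → ℝ) : ℝ :=
  ∫ x, g x ∂(Measure.comap ((↑) : M.face e → Space d) (Measure.euclideanHausdorffMeasure (d - 1)))

open Classical in
/-- The integral over the boundary of the cell `T` of a function given on the faces. -/
def boundaryIntegral (M : PolyMesh Ω) (T : M.Cell) (g : (e : M.Face) → M.face e → ℝ) : ℝ :=
  ∑ e with M.face e ⊆ frontier (M.cell T), M.faceIntegral e (g e)

/-- `p` is the discrete weak second order derivative `∂²_{ij,w,r,T} v`: it belongs to `P_r(T)` and
`(p, φ)_T = (v₀, ∂²_{ji} φ)_T - ⟨v_b nᵢ, ∂ⱼ φ⟩_{∂T} + ⟨v_{gi}, φ nⱼ⟩_{∂T}` for all `φ ∈ P_r(T)`. -/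
def IsDiscreteWeakDeriv (M : PolyMesh Ω) (r : ℕ) (T : M.Cell) (i j : Fin d) (v : M.Triple)
    (p : MvPolynomial (Fin d) ℝ) : Prop :=
  p ∈ MvPolynomial.restrictTotalDegree (Fin d) ℝ r ∧
  ∀ φ ∈ MvPolynomial.restrictTotalDegree (Fin d) ℝ r,
    ∫ x in M.cell T, polyEval p x * polyEval φ x =
      (∫ x in M.cell T,
        polyEval (v.1 T) x * polyEval (MvPolynomial.pderiv j (MvPolynomial.pderiv i φ)) x) -
      M.boundaryIntegral T
        (fun e x => v.2.1 e x * M.normal T e i * polyEval (MvPolynomial.pderiv j φ) x) +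
      M.boundaryIntegral T (fun e x => v.2.2 e i x * (polyEval φ x * M.normal T e j))

/-- The discrete weak second order derivative `∂²_{ij,w,r,T} v`: the polynomial that is determined by
the property `IsDiscreteWeakDeriv`. -/
def discreteWeakDeriv (M : PolyMesh Ω) (r : ℕ) (T : M.Cell) (i j : Fin d) (v : M.Triple) :
    MvPolynomial (Fin d) ℝ :=
  Classical.epsilon (M.IsDiscreteWeakDeriv r T i j v)

/-- The function `∑ aᵢⱼ ∂²_{ij,w} v` on the cell `T`. -/
def discreteOperator (M : PolyMesh Ω) (a : Space d → Matrix (Fin d) (Fin d) ℝ) (r : ℕ) (T : M.Cell)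
    (v : M.Triple) (x : Space d) : ℝ :=
  ∑ i, ∑ j, a x i j * polyEval (M.discreteWeakDeriv r T i j v) x

/-- The bilinear form `a(u, v)`. -/
def formA (M : PolyMesh Ω) (a : Space d → Matrix (Fin d) (Fin d) ℝ) (r : ℕ) (u v : M.Triple) : ℝ :=
  ∑ T, ∫ x in M.cell T, M.discreteOperator a r T u x * M.discreteOperator a r T v x

/-- The stabilizer `s(u, v)`; the diameter of the cell `T` is `h_T`. -/
def stabilizer (M : PolyMesh Ω) (u v : M.Triple) : ℝ :=
  ∑ T,
    ((Metric.diam (M.cell T) ^ 3)⁻¹ * M.boundaryIntegral T (fun e x =>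
        (polyEval (u.1 T) x - u.2.1 e x) * (polyEval (v.1 T) x - v.2.1 e x)) +
      (Metric.diam (M.cell T))⁻¹ * M.boundaryIntegral T (fun e x =>
        ∑ i, (polyEval (MvPolynomial.pderiv i (u.1 T)) x - u.2.2 e i x) *
          (polyEval (MvPolynomial.pderiv i (v.1 T)) x - v.2.2 e i x)))

/-- The load functional `∑_T (f, ∑ aᵢⱼ ∂²_{ij,w} v)_T`. -/
def load (M : PolyMesh Ω) (a : Space d → Matrix (Fin d) (Fin d) ℝ) (f : Space d → ℝ) (r : ℕ)
    (v : M.Triple) : ℝ :=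
  ∑ T, ∫ x in M.cell T, f x * M.discreteOperator a r T v x

/-- `u ∈ W_h⁰` solves the least-squares weak Galerkin scheme. -/
def IsSchemeSolution (M : PolyMesh Ω) (a : Space d → Matrix (Fin d) (Fin d) ℝ) (f : Space d → ℝ)
    (k r : ℕ) (u : M.weakSpaceZero k) : Prop :=
  ∀ v : M.weakSpaceZero k,
    M.formA a r (u : M.Triple) (v : M.Triple) + M.stabilizer (u : M.Triple) (v : M.Triple) =
      M.load a f r (v : M.Triple)

/-- The matrix of the linear system of the scheme with respect to the basis `b` of `W_h⁰`. -/
def systemMatrix (M : PolyMesh Ω) (a : Space d → Matrix (Fin d) (Fin d) ℝ) {k : ℕ} (r : ℕ) {n : ℕ}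
    (b : Module.Basis (Fin n) ℝ (M.weakSpaceZero k)) : Matrix (Fin n) (Fin n) ℝ :=
  Matrix.of fun l m =>
    M.formA a r (b m : M.Triple) (b l : M.Triple) + M.stabilizer (b m : M.Triple) (b l : M.Triple)

/-- The right-hand side of the linear system of the scheme with respect to the basis `b` of `W_h⁰`. -/
def systemVector (M : PolyMesh Ω) (a : Space d → Matrix (Fin d) (Fin d) ℝ) (f : Space d → ℝ)
    {k : ℕ} (r : ℕ) {n : ℕ} (b : Module.Basis (Fin n) ℝ (M.weakSpaceZero k)) : Fin n → ℝ :=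
  fun l => M.load a f r (b l : M.Triple)

end PolyMesh

end LSWG

end

/-!
The bilinear form `B(u, v) = a(u, v) + s(u, v)` is symmetric and positive semidefinite, and `W_h⁰` is
finite-dimensional, so everything reduces to one fact: `B(v, v) = 0` forces `v = 0`
(`PolyMesh.eq_zero_of_form_self_eq_zero`). The linear system is then `B(u, ·) = ℓ` in coordinates.

Let `B(v, v) = 0`. The stabilizer vanishes, so on every face of every cell `v_b` and `v_g` are the
traces of `v₀` and `∇v₀`. Since `v_b` and `v_g` are single-valued, the piecewise polynomial `v₀` and
its gradient agree from both sides of each interior face, and `v₀` vanishes on the faces in `∂Ω`.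
Three consequences follow.

* With these traces, two integrations by parts on a cell turn the definition of `∂²_{ij,w} v` into
  `(∂²_{ij,w} v, φ)_T = (∂²_{ij} v₀, φ)_T` for all `φ ∈ P_r(T)`, and `∂²_{ij} v₀ ∈ P_{k-2} ⊆ P_r`.
  Hence the discrete weak derivatives are the classical ones, and `a(v, v) = 0` says that
  `∑ a_{ij} ∂²_{ij} v₀ = 0` almost everywhere.
* Summing the divergence theorem over the cells, the contributions of an interior face cancel,
  because the two cells sharing it have opposite normals. So the piecewise derivatives of `v₀` of
  orders one and two are its weak derivatives, and `v₀ ∈ H²(Ω)`.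
* `v₀` has zero trace, so its extension by zero has a bounded weak gradient on the whole space, and
  hence a Lipschitz representative. This representative vanishes outside `Ω`; mollifying it and
  cutting off the values near zero gives test functions converging to it in `H¹`. So
  `v₀ ∈ H¹₀(Ω)`. The Lipschitz boundary enters through the fact that `Ω` does not lie on both sides
  of it: each boundary point is a limit of exterior points, where the representative vanishes.

Thus `v₀` is a strong solution with right-hand side zero. Adding it to the strong solution with
right-hand side `f` and using uniqueness gives `v₀ = 0` almost everywhere, hence `v₀ = 0` as a
polynomial on each cell, and then `v_b` and `v_g` vanish as traces.

The divergence theorem on a polytopal cell (`PolyMesh.integral_cell_fderiv`) is obtained from the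
half-space: away from the relative boundaries of the faces, a cell coincides locally with the whole
space, the empty set or a half-space, so a partition of unity proves the formula for integrands
vanishing near those relative boundaries. The latter lie in finitely many affine subspaces of
codimension two, and cutoff functions around them with `∫ |∇χ_ε| → 0` remove this restriction.
-/

noncomputable section

namespace LSWG

/-! ### Orthonormal coordinates and the divergence theorem for a half-space -/

/-- The affine coordinates `y ↦ x₀ + ∑ yᵢ bᵢ` of an orthonormal basis `b` with origin `x₀`. The
domain is `Fin n → ℝ`, on which the divergence theorem for boxes is available. -/
def frameChart {n : ℕ} (b : OrthonormalBasis (Fin n) ℝ (Space n)) (x₀ : Space n) :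
    (Fin n → ℝ) ≃ᵐ Space n :=
  ((MeasurableEquiv.toLp 2 (Fin n → ℝ)).trans b.repr.symm.toHomeomorph.toMeasurableEquiv).trans
    (Homeomorph.addLeft x₀).toMeasurableEquiv

section frameChart

variable {n : ℕ} (b : OrthonormalBasis (Fin n) ℝ (Space n)) (x₀ : Space n)

lemma frameChart_apply (y : Fin n → ℝ) :
    frameChart b x₀ y = x₀ + b.repr.symm (WithLp.toLp 2 y) := rfl

lemma measurePreserving_frameChart : MeasurePreserving (frameChart b x₀) volume volume :=
  (measurePreserving_add_left volume x₀).comp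
    (b.repr.symm.measurePreserving.comp (PiLp.volume_preserving_toLp (Fin n)))

lemma inner_frameChart_sub (y : Fin n → ℝ) (i : Fin n) :
    inner ℝ (b i) (frameChart b x₀ y - x₀) = y i := by
  rw [frameChart_apply, add_sub_cancel_left, ← b.repr_apply_apply]
  simp

lemma abs_coord_le_norm_frameChart_sub (y : Fin n → ℝ) (i : Fin n) :
    |y i| ≤ ‖frameChart b x₀ y - x₀‖ := by
  rw [← inner_frameChart_sub b x₀ y i]
  refine (abs_real_inner_le_norm _ _).trans ?_
  simp [b.orthonormal.1 i]

/-- The linear part of `frameChart`. -/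
def frameLinear : (Fin n → ℝ) →L[ℝ] Space n :=
  (b.repr.symm.toContinuousLinearEquiv : Space n →L[ℝ] Space n).comp
    ((PiLp.continuousLinearEquiv 2 ℝ (fun _ : Fin n => ℝ)).symm : (Fin n → ℝ) →L[ℝ] Space n)

lemma frameLinear_single (i : Fin n) : frameLinear b (Pi.single i 1) = b i := by
  have : frameLinear b (Pi.single i 1) = b.repr.symm (WithLp.toLp 2 (Pi.single i 1)) := rfl
  rw [this]
  exact b.repr_symm_single i

lemma hasFDerivAt_frameChart (y : Fin n → ℝ) :
    HasFDerivAt (frameChart b x₀) (frameLinear b) y := by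
  have h : ⇑(frameChart b x₀) = fun y => x₀ + frameLinear b y := rfl
  rw [h]
  exact (frameLinear b).hasFDerivAt.const_add x₀

lemma continuous_frameChart : Continuous (frameChart b x₀) :=
  continuous_iff_continuousAt.2 fun y => (hasFDerivAt_frameChart b x₀ y).continuousAt

end frameChart

/-- The hyperplane through `x₀` with normal `ν`. -/
def plane {n : ℕ} (ν x₀ : Space n) : Set (Space n) := {y | inner ℝ ν (y - x₀) = 0}

lemma isClosed_plane {n : ℕ} (ν x₀ : Space n) : IsClosed (plane ν x₀) :=
  isClosed_eq (by fun_prop) continuous_const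

lemma measurableSet_plane {n : ℕ} (ν x₀ : Space n) : MeasurableSet (plane ν x₀) :=
  (isClosed_plane ν x₀).measurableSet

/-- A unit vector is the first vector of an orthonormal basis. -/
lemma exists_orthonormalBasis_zero_eq {m : ℕ} {ν : Space (m + 1)} (hν : ‖ν‖ = 1) :
    ∃ b : OrthonormalBasis (Fin (m + 1)) ℝ (Space (m + 1)), b 0 = ν := by
  obtain ⟨b, hb⟩ := Orthonormal.exists_orthonormalBasis_extension_of_card_eq (𝕜 := ℝ)
    (E := Space (m + 1)) (ι := Fin (m + 1)) (by simp) (v := fun _ => ν) (s := {0})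
    (by
      constructor
      · rintro ⟨i, hi⟩
        simpa using hν
      · rintro ⟨i, hi⟩ ⟨j, hj⟩ hij
        simp only [mem_singleton_iff] at hi hj
        exact absurd (by simp [hi, hj]) hij)
  exact ⟨b, hb 0 rfl⟩

/-- The parametrization of the hyperplane `plane (b 0) x₀` by the remaining coordinates. -/
def planeChart {m : ℕ} (b : OrthonormalBasis (Fin (m + 1)) ℝ (Space (m + 1))) (x₀ : Space (m + 1))
    (z : Fin m → ℝ) : Space (m + 1) :=
  frameChart b x₀ (Fin.insertNth 0 (0 : ℝ) z)

section planeChart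

variable {m : ℕ} (b : OrthonormalBasis (Fin (m + 1)) ℝ (Space (m + 1))) (x₀ : Space (m + 1))

lemma isometry_planeChart_ofLp :
    Isometry fun z : Space m => planeChart b x₀ (WithLp.ofLp z) := by
  refine Isometry.of_dist_eq fun z w => ?_
  simp only [planeChart, frameChart_apply]
  rw [dist_add_left, LinearIsometryEquiv.dist_map, EuclideanSpace.dist_eq, EuclideanSpace.dist_eq,
    Fin.sum_univ_succ]
  simp

lemma range_planeChart : range (planeChart b x₀) = plane (b 0) x₀ := by
  ext y
  constructor
  · rintro ⟨z, rfl⟩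
    simp [plane, planeChart, inner_frameChart_sub]
  · intro hy
    refine ⟨fun i => (frameChart b x₀).symm y i.succ, ?_⟩
    have h0 : (frameChart b x₀).symm y 0 = 0 := by
      rw [← inner_frameChart_sub b x₀ ((frameChart b x₀).symm y) 0, MeasurableEquiv.apply_symm_apply]
      exact hy
    have : Fin.insertNth 0 (0 : ℝ) (fun i => (frameChart b x₀).symm y i.succ)
        = (frameChart b x₀).symm y := by
      funext i
      refine Fin.cases ?_ (fun i => ?_) i
      · simp [h0]
      · simp
    rw [planeChart, this, MeasurableEquiv.apply_symm_apply]

lemma continuous_planeChart : Continuous (planeChart b x₀) := by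
  refine (continuous_frameChart b x₀).comp ?_
  refine continuous_pi fun i => ?_
  refine Fin.cases ?_ (fun i => ?_) i
  · simpa using continuous_const
  · simpa using continuous_apply i

lemma measurableEmbedding_planeChart : MeasurableEmbedding (planeChart b x₀) := by
  have h : planeChart b x₀ = (fun z : Space m => planeChart b x₀ (WithLp.ofLp z)) ∘
      (MeasurableEquiv.toLp 2 (Fin m → ℝ)) := rfl
  rw [h]
  exact (isometry_planeChart_ofLp b x₀).isClosedEmbedding.measurableEmbedding.comp
    (MeasurableEquiv.measurableEmbedding _)

/-- The parametrization of a hyperplane carries Lebesgue measure to the surface measure. -/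
lemma map_planeChart : Measure.map (planeChart b x₀) volume =
    (Measure.euclideanHausdorffMeasure m).restrict (plane (b 0) x₀) := by
  have hi := isometry_planeChart_ofLp b x₀
  have h : planeChart b x₀ = (fun z : Space m => planeChart b x₀ (WithLp.ofLp z)) ∘
      (WithLp.toLp 2) := rfl
  rw [h, ← Measure.map_map hi.continuous.measurable (PiLp.volume_preserving_toLp (Fin m)).measurable,
    (PiLp.volume_preserving_toLp (Fin m)).map_eq, ← EuclideanSpace.euclideanHausdorffMeasure_eq_volume,
    hi.map_euclideanHausdorffMeasure, ← range_planeChart b x₀]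
  congr 1
  ext y
  constructor
  · rintro ⟨z, rfl⟩
    exact ⟨_, rfl⟩
  · rintro ⟨z, rfl⟩
    exact ⟨WithLp.toLp 2 z, rfl⟩

lemma integral_plane_eq (F : Space (m + 1) → ℝ) :
    ∫ y in plane (b 0) x₀, F y ∂Measure.euclideanHausdorffMeasure m =
      ∫ z, F (planeChart b x₀ z) := by
  rw [← map_planeChart, (measurableEmbedding_planeChart b x₀).integral_map]

end planeChart

/-- The divergence theorem on a half-space, for the vector field `F • v`. -/
theorem integral_halfSpace_fderiv {m : ℕ} {F : Space (m + 1) → ℝ} (hF : ContDiff ℝ 1 F)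
    (hc : HasCompactSupport F) {ν : Space (m + 1)} (hν : ‖ν‖ = 1) (x₀ v : Space (m + 1)) :
    ∫ y in {y | inner ℝ ν (y - x₀) < 0}, fderiv ℝ F y v =
      inner ℝ ν v * ∫ y in plane ν x₀, F y ∂Measure.euclideanHausdorffMeasure m := by
  obtain ⟨b, rfl⟩ := exists_orthonormalBasis_zero_eq hν
  obtain ⟨R, hR0, hR⟩ : ∃ R : ℝ, 0 < R ∧ tsupport F ⊆ Metric.ball x₀ R := by
    obtain ⟨R, hR⟩ := hc.isCompact.isBounded.subset_ball x₀
    exact ⟨max R 1, by positivity, hR.trans (Metric.ball_subset_ball (le_max_left _ _))⟩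
  have hout : ∀ y : Fin (m + 1) → ℝ, ∀ i, R ≤ |y i| → frameChart b x₀ y ∉ tsupport F := by
    intro y i hi hy
    have := hR hy
    rw [Metric.mem_ball, dist_eq_norm] at this
    linarith [abs_coord_le_norm_frameChart_sub b x₀ y i]
  have hF0 : ∀ y : Fin (m + 1) → ℝ, ∀ i, R ≤ |y i| → F (frameChart b x₀ y) = 0 :=
    fun y i hi => image_eq_zero_of_notMem_tsupport (hout y i hi)
  have hD0 : ∀ y : Fin (m + 1) → ℝ, ∀ i, R ≤ |y i| → fderiv ℝ F (frameChart b x₀ y) = 0 :=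
    fun y i hi => by
      by_contra h
      exact hout y i hi (support_fderiv_subset ℝ h)
  have hFd : Differentiable ℝ F := hF.differentiable one_ne_zero
  have hDc : Continuous (fderiv ℝ F) := hF.continuous_fderiv one_ne_zero
  -- the half-box with `-R ≤ yᵢ ≤ R` and `y₀ ≤ 0`
  let lo : Fin (m + 1) → ℝ := fun _ => -R
  let hi : Fin (m + 1) → ℝ := Fin.cons 0 fun _ => R
  have hle : lo ≤ hi := by
    intro i
    refine Fin.cases ?_ (fun i => ?_) i
    · simp [lo, hi, hR0.le]
    · simp only [lo, hi, Fin.cons_succ]; linarith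
  have hsum : ∀ w : Space (m + 1), ∀ y, ∑ i, (inner ℝ (b i) w • (fderiv ℝ F (frameChart b x₀ y)).comp
      (frameLinear b)) (Pi.single i 1) = fderiv ℝ F (frameChart b x₀ y) w := by
    intro w y
    conv_rhs => rw [← b.sum_repr' w]
    simp [frameLinear_single, map_sum]
  have hdiv := integral_divergence_of_hasFDerivAt_off_countable' lo hi hle
    (fun i y => inner ℝ (b i) v * F (frameChart b x₀ y))
    (fun i y => inner ℝ (b i) v • (fderiv ℝ F (frameChart b x₀ y)).comp (frameLinear b)) ∅
    countable_empty
    (fun i => (continuous_const.mul (hF.continuous.comp (continuous_frameChart b x₀))).continuousOn)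
    (fun y _ i => (((hFd _).hasFDerivAt.comp y (hasFDerivAt_frameChart b x₀ y)).const_mul _))
    (by
      simp only [hsum]
      refine Continuous.integrableOn_Icc ?_
      exact (hDc.comp (continuous_frameChart b x₀)).clm_apply continuous_const)
  simp only [hsum] at hdiv
  have hbox : (univ.pi fun i => Ioo (lo i) (hi i)) =ᵐ[volume] Icc lo hi :=
    Measure.univ_pi_Ioo_ae_eq_Icc
  have hL : ∫ y in {y | inner ℝ (b 0) (y - x₀) < 0}, fderiv ℝ F y v =
      ∫ y in Icc lo hi, fderiv ℝ F (frameChart b x₀ y) v := by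
    rw [← (measurePreserving_frameChart b x₀).setIntegral_preimage_emb
      (frameChart b x₀).measurableEmbedding, ← setIntegral_congr_set hbox]
    refine setIntegral_eq_of_subset_of_forall_sdiff_eq_zero ?_ ?_ ?_
    · refine measurableSet_preimage (frameChart b x₀).measurable ?_
      exact (isOpen_lt (by fun_prop) continuous_const).measurableSet
    · intro y hy
      have := (hy 0 (mem_univ _)).2
      simpa [inner_frameChart_sub, hi] using this
    · rintro y ⟨hy1, hy2⟩
      have hy1 : y 0 < 0 := by simpa [inner_frameChart_sub] using hy1
      have : ∃ i, R ≤ |y i| := by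
        by_contra! h
        refine hy2 fun i _ => ?_
        have h' := abs_lt.1 (h i)
        refine ⟨h'.1, ?_⟩
        revert h'
        refine Fin.cases ?_ (fun i => ?_) i
        · intro _; simpa [hi] using hy1
        · intro h'; simpa [hi] using h'.2
      obtain ⟨i, hi'⟩ := this
      rw [hD0 y i hi']
      rfl
  have hlow : ∀ i, ∫ z in Icc (lo ∘ Fin.succAbove i) (hi ∘ Fin.succAbove i),
      inner ℝ (b i) v * F (frameChart b x₀ (Fin.insertNth i (lo i) z)) = 0 := by
    intro i
    refine setIntegral_eq_zero_of_forall_eq_zero fun z _ => ?_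
    rw [hF0 _ i (by simp [lo, abs_of_pos hR0]), mul_zero]
  have hup : ∀ i : Fin m, ∫ z in Icc (lo ∘ Fin.succAbove i.succ) (hi ∘ Fin.succAbove i.succ),
      inner ℝ (b i.succ) v * F (frameChart b x₀ (Fin.insertNth i.succ (hi i.succ) z)) = 0 := by
    intro i
    refine setIntegral_eq_zero_of_forall_eq_zero fun z _ => ?_
    rw [hF0 _ i.succ (by simp [hi, abs_of_pos hR0]), mul_zero]
  rw [hL, hdiv, Fin.sum_univ_succ]
  simp only [hlow, hup, sub_zero, Finset.sum_const_zero, add_zero]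
  rw [integral_plane_eq, integral_const_mul]
  congr 1
  have h0 : hi 0 = 0 := rfl
  rw [h0]
  refine setIntegral_eq_integral_of_forall_compl_eq_zero fun z hz => ?_
  have : ∃ i, R ≤ |z i| := by
    by_contra! h
    refine hz ⟨fun i => ?_, fun i => ?_⟩
    · exact (abs_lt.1 (h i)).1.le
    · simpa [hi] using (abs_lt.1 (h i)).2.le
  obtain ⟨i, hi'⟩ := this
  exact hF0 _ i.succ (by simpa using hi')

/-! ### Surface measure on hyperplanes -/

section surface

variable {m : ℕ}

/-- `planeChart` as an affine map. -/
def planeAffine (b : OrthonormalBasis (Fin (m + 1)) ℝ (Space (m + 1))) (x₀ : Space (m + 1)) :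
    (Fin m → ℝ) →ᵃ[ℝ] Space (m + 1) :=
  AffineMap.const ℝ _ x₀ + ((frameLinear b : (Fin (m + 1) → ℝ) →ₗ[ℝ] Space (m + 1)).comp
    (LinearMap.pi (Fin.cons 0 fun i => LinearMap.proj i))).toAffineMap

lemma planeAffine_apply (b : OrthonormalBasis (Fin (m + 1)) ℝ (Space (m + 1)))
    (x₀ : Space (m + 1)) (z : Fin m → ℝ) : planeAffine b x₀ z = planeChart b x₀ z := by
  have h : (LinearMap.pi (Fin.cons 0 fun i => LinearMap.proj i) :
      (Fin m → ℝ) →ₗ[ℝ] (Fin (m + 1) → ℝ)) z = Fin.insertNth 0 (0 : ℝ) z := by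
    funext i
    refine Fin.cases ?_ (fun i => ?_) i <;> simp
  change x₀ + frameLinear b ((LinearMap.pi (Fin.cons 0 fun i => LinearMap.proj i) :
      (Fin m → ℝ) →ₗ[ℝ] (Fin (m + 1) → ℝ)) z) = _
  rw [h]
  rfl

lemma surface_plane_inter (b : OrthonormalBasis (Fin (m + 1)) ℝ (Space (m + 1)))
    (x₀ : Space (m + 1)) {S : Set (Space (m + 1))} (hS : MeasurableSet S) :
    Measure.euclideanHausdorffMeasure m (plane (b 0) x₀ ∩ S) = volume (planeChart b x₀ ⁻¹' S) := by
  rw [inter_comm, ← Measure.restrict_apply hS, ← map_planeChart,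
    Measure.map_apply (measurableEmbedding_planeChart b x₀).measurable hS]

/-- An affine subspace that does not contain a hyperplane meets it in a set of surface measure
zero. -/
lemma surface_plane_inter_affineSubspace {ν : Space (m + 1)} (hν : ‖ν‖ = 1) (x₀ : Space (m + 1))
    {A : AffineSubspace ℝ (Space (m + 1))} (hA : ¬ plane ν x₀ ⊆ A) :
    Measure.euclideanHausdorffMeasure m (plane ν x₀ ∩ A) = 0 := by
  obtain ⟨b, rfl⟩ := exists_orthonormalBasis_zero_eq hν
  rw [surface_plane_inter b x₀ A.closed_of_finiteDimensional.measurableSet]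
  have h : planeChart b x₀ ⁻¹' A = (A.comap (planeAffine b x₀) : Set (Fin m → ℝ)) := by
    ext z
    simp [planeAffine_apply]
  rw [h]
  refine Measure.addHaar_affineSubspace _ _ fun htop => hA ?_
  rw [← range_planeChart]
  rintro _ ⟨z, rfl⟩
  have hz : z ∈ A.comap (planeAffine b x₀) := htop ▸ AffineSubspace.mem_top ℝ _ z
  simpa [planeAffine_apply] using hz

lemma surface_plane_inter_lt_top {ν : Space (m + 1)} (hν : ‖ν‖ = 1) (x₀ : Space (m + 1))
    {S : Set (Space (m + 1))} (hS : Bornology.IsBounded S) :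
    Measure.euclideanHausdorffMeasure m (plane ν x₀ ∩ S) < ⊤ := by
  obtain ⟨b, rfl⟩ := exists_orthonormalBasis_zero_eq hν
  obtain ⟨R, hR⟩ := hS.subset_closedBall x₀
  refine (measure_mono (inter_subset_inter_right _ hR)).trans_lt ?_
  rw [surface_plane_inter b x₀ Metric.isClosed_closedBall.measurableSet]
  refine (measure_mono (t := Icc (fun _ => -R) fun _ => R) fun z hz => ?_).trans_lt
    (isCompact_Icc.measure_lt_top)
  have : ∀ i, |z i| ≤ R := fun i => by
    have h := abs_coord_le_norm_frameChart_sub b x₀ (Fin.insertNth 0 (0 : ℝ) z) i.succ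
    rw [mem_preimage, Metric.mem_closedBall, dist_eq_norm, planeChart] at hz
    exact (by simpa using h : |z i| ≤ _).trans hz
  exact ⟨fun i => (abs_le.1 (this i)).1, fun i => (abs_le.1 (this i)).2⟩

lemma surface_plane_inter_pos {ν : Space (m + 1)} (hν : ‖ν‖ = 1) (x₀ : Space (m + 1))
    {U : Set (Space (m + 1))} (hU : IsOpen U) (hne : (plane ν x₀ ∩ U).Nonempty) :
    0 < Measure.euclideanHausdorffMeasure m (plane ν x₀ ∩ U) := by
  obtain ⟨b, rfl⟩ := exists_orthonormalBasis_zero_eq hν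
  rw [surface_plane_inter b x₀ hU.measurableSet]
  refine (hU.preimage (continuous_planeChart b x₀)).measure_pos _ ?_
  obtain ⟨y, hy, hyU⟩ := hne
  rw [← range_planeChart] at hy
  obtain ⟨z, rfl⟩ := hy
  exact ⟨z, hyU⟩

end surface

/-! ### Hyperplanes as affine subspaces -/

lemma coe_eq_plane {n : ℕ} {H : AffineSubspace ℝ (Space n)}
    (hH : Module.finrank ℝ H.direction + 1 = n) {x ν : Space n} (hx : x ∈ H) (hν : ‖ν‖ = 1)
    (hperp : ∀ w ∈ H.direction, inner ℝ ν w = 0) : (H : Set (Space n)) = plane ν x := by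
  have hν0 : ν ≠ 0 := fun h => by simp [h] at hν
  have hle : H.direction ≤ (ℝ ∙ ν)ᗮ := fun w hw => by
    rw [Submodule.mem_orthogonal_singleton_iff_inner_right]
    exact hperp w hw
  have hfin : Module.finrank ℝ (ℝ ∙ ν)ᗮ + 1 = n := by
    have := Submodule.finrank_add_finrank_orthogonal (ℝ ∙ ν)
    rw [finrank_span_singleton hν0] at this
    simp only [finrank_euclideanSpace_fin] at this
    omega
  have heq := Submodule.eq_of_le_of_finrank_eq hle (by omega)
  ext y
  rw [SetLike.mem_coe, ← AffineSubspace.vsub_right_mem_direction_iff_mem hx, heq,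
    Submodule.mem_orthogonal_singleton_iff_inner_right]
  rfl

/-- A hyperplane that lies in `plane ν x` near `x` is that plane. -/
lemma coe_eq_plane_of_eventually {n : ℕ} {H : AffineSubspace ℝ (Space n)}
    (hH : Module.finrank ℝ H.direction + 1 = n) {x ν : Space n} (hx : x ∈ H) (hν : ‖ν‖ = 1)
    (hloc : ∀ᶠ y in 𝓝 x, y ∈ H → inner ℝ ν (y - x) = 0) :
    (H : Set (Space n)) = plane ν x := by
  refine coe_eq_plane hH hx hν fun w hw => ?_
  have ht : Tendsto (fun t : ℝ => x + t • w) (𝓝[≠] 0) (𝓝 x) := by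
    have : ContinuousAt (fun t : ℝ => x + t • w) 0 := by fun_prop
    have h := this.tendsto
    simp only [zero_smul, add_zero] at h
    exact h.mono_left nhdsWithin_le_nhds
  obtain ⟨t, h1, h2⟩ := ((ht.eventually hloc).and self_mem_nhdsWithin).exists
  have hmem : x + t • w ∈ H := by
    have := AffineSubspace.vadd_mem_of_mem_direction (H.direction.smul_mem t hw) hx
    rwa [vadd_eq_add, add_comm] at this
  have := h1 hmem
  rw [add_sub_cancel_left, inner_smul_right] at this
  exact (mul_eq_zero.1 this).resolve_left h2

/-! ### Local structure of a mesh -/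

lemma IsPolytopeIn.isOpen_of_top {n : ℕ} {S : Set (Space n)} (h : IsPolytopeIn ⊤ S) : IsOpen S := by
  obtain ⟨U, hU, rfl⟩ := h.relOpen
  simpa using hU

lemma IsPolytopeIn.subset {n : ℕ} {H : AffineSubspace ℝ (Space n)} {S : Set (Space n)}
    (h : IsPolytopeIn H S) : S ⊆ H := by
  obtain ⟨U, -, hU⟩ := h.relOpen
  rw [hU]
  exact inter_subset_right

lemma IsPolytopeIn.eventually_mem_iff {n : ℕ} {H : AffineSubspace ℝ (Space n)} {S : Set (Space n)}
    (h : IsPolytopeIn H S) {x : Space n} (hx : x ∈ S) : ∀ᶠ y in 𝓝 x, (y ∈ S ↔ y ∈ H) := by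
  obtain ⟨U, hU, rfl⟩ := h.relOpen
  filter_upwards [hU.mem_nhds hx.1] with y hy
  exact ⟨fun h => h.2, fun h => ⟨hy, h⟩⟩

lemma mem_closure_halfSpace {n : ℕ} {ν x y : Space n} (hν : ‖ν‖ = 1)
    (hy : inner ℝ ν (y - x) = 0) : y ∈ closure {z | inner ℝ ν (z - x) < 0} := by
  have ht : Tendsto (fun t : ℝ => y - t • ν) (𝓝[>] 0) (𝓝 y) := by
    have : ContinuousAt (fun t : ℝ => y - t • ν) 0 := by fun_prop
    have h := this.tendsto
    simp only [zero_smul, sub_zero] at h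
    exact h.mono_left nhdsWithin_le_nhds
  refine mem_closure_of_tendsto ht ?_
  filter_upwards [self_mem_nhdsWithin] with t ht
  have h : y - t • ν - x = (y - x) - t • ν := by abel
  simp only [h, inner_sub_right, hy, inner_smul_right, real_inner_self_eq_norm_sq, hν]
  simpa using ht

namespace PolyMesh

section

variable {n : ℕ} {Ω : Set (Space n)} (M : PolyMesh Ω)

lemma isOpen_cell (T : M.Cell) : IsOpen (M.cell T) := (M.cell_polytope T).isOpen_of_top

lemma isBounded_cell (T : M.Cell) : Bornology.IsBounded (M.cell T) := (M.cell_polytope T).isBounded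

lemma face_nonempty (e : M.Face) : (M.face e).Nonempty := by
  obtain ⟨H, -, hH⟩ := M.face_polytope e
  exact hH.isConnected.nonempty

lemma isBounded_face (e : M.Face) : Bornology.IsBounded (M.face e) := by
  obtain ⟨H, -, hH⟩ := M.face_polytope e
  exact hH.isBounded

lemma measurableSet_face (e : M.Face) : MeasurableSet (M.face e) := by
  obtain ⟨H, -, hH⟩ := M.face_polytope e
  obtain ⟨U, hU, hUe⟩ := hH.relOpen
  rw [hUe]
  exact hU.measurableSet.inter H.closed_of_finiteDimensional.measurableSet

lemma eventually_mem_frontier_iff {T : M.Cell} {e : M.Face} (he : M.face e ⊆ frontier (M.cell T))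
    {x : Space n} (hx : x ∈ M.face e) :
    ∀ᶠ y in 𝓝 x, (y ∈ frontier (M.cell T) ↔ inner ℝ (M.normal T e) (y - x) = 0) := by
  have hν := M.normal_unit T e he
  filter_upwards [eventually_eventually_nhds.2 (M.normal_outward T e he x hx)] with y hy
  rw [(M.isOpen_cell T).frontier_eq, Set.mem_sdiff]
  have h0 : y ∈ closure (M.cell T) ↔ y ∈ closure {z | inner ℝ (M.normal T e) (z - x) < 0} := by
    simp only [mem_closure_iff_frequently]
    exact frequently_congr hy
  have h1 : y ∈ M.cell T ↔ inner ℝ (M.normal T e) (y - x) < 0 := hy.self_of_nhds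
  rw [h0, h1, not_lt]
  constructor
  · rintro ⟨h2, h3⟩
    refine le_antisymm ?_ h3
    have hcl : IsClosed {z | inner ℝ (M.normal T e) (z - x) ≤ 0} :=
      isClosed_le (by fun_prop) continuous_const
    have hsub : {z | inner ℝ (M.normal T e) (z - x) < 0} ⊆
        {z | inner ℝ (M.normal T e) (z - x) ≤ 0} := fun z hz => le_of_lt (mem_ofPred.1 hz)
    exact closure_minimal hsub hcl h2
  · intro h
    exact ⟨mem_closure_halfSpace hν h, h.ge⟩

/-- The plane of a face of a cell is orthogonal to the normal of the cell. -/
lemma coe_eq_plane_normal {T : M.Cell} {e : M.Face} (he : M.face e ⊆ frontier (M.cell T))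
    {x : Space n} (hx : x ∈ M.face e) {H : AffineSubspace ℝ (Space n)}
    (hH : Module.finrank ℝ H.direction + 1 = n) (hp : IsPolytopeIn H (M.face e)) :
    (H : Set (Space n)) = plane (M.normal T e) x := by
  refine coe_eq_plane_of_eventually hH (hp.subset hx) (M.normal_unit T e he) ?_
  filter_upwards [M.eventually_mem_frontier_iff he hx, hp.eventually_mem_iff hx] with y h1 h2 hy
  exact h1.1 (he (h2.2 hy))

lemma eventually_mem_face_iff {T : M.Cell} {e : M.Face} (he : M.face e ⊆ frontier (M.cell T))
    {x : Space n} (hx : x ∈ M.face e) :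
    ∀ᶠ y in 𝓝 x, (y ∈ M.face e ↔ inner ℝ (M.normal T e) (y - x) = 0) := by
  obtain ⟨H, hH, hp⟩ := M.face_polytope e
  filter_upwards [hp.eventually_mem_iff hx] with y hy
  rw [hy, ← SetLike.mem_coe, M.coe_eq_plane_normal he hx hH hp]
  rfl

/-- Near a point of a face of a cell there are no other faces of that cell. -/
lemma eventually_notMem_face {T : M.Cell} {e : M.Face} (he : M.face e ⊆ frontier (M.cell T))
    {x : Space n} (hx : x ∈ M.face e) :
    ∀ᶠ y in 𝓝 x, ∀ e', M.face e' ⊆ frontier (M.cell T) → e' ≠ e → y ∉ M.face e' := by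
  filter_upwards [M.eventually_mem_frontier_iff he hx, M.eventually_mem_face_iff he hx]
    with y h1 h2 e' he' hne hy
  exact (M.face_disjoint hne).le_bot ⟨hy, h2.2 (h1.1 (he' hy))⟩

/-- Each face lies in a hyperplane and is relatively open there. -/
lemma exists_face_plane (e : M.Face) : ∃ (ν x : Space n) (U : Set (Space n)), ‖ν‖ = 1 ∧
    x ∈ M.face e ∧ IsOpen U ∧ M.face e = plane ν x ∩ U := by
  obtain ⟨T, hT⟩ := M.face_used e
  obtain ⟨H, hH, hp⟩ := M.face_polytope e
  obtain ⟨x, hx⟩ := M.face_nonempty e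
  obtain ⟨U, hU, hUe⟩ := hp.relOpen
  refine ⟨M.normal T e, x, U, M.normal_unit T e hT, hx, hU, ?_⟩
  rw [← M.coe_eq_plane_normal hT hx hH hp, inter_comm]
  exact hUe

/-- The relative boundaries of the faces lie in finitely many affine subspaces of codimension at
least two. -/
lemma exists_ridges : ∃ 𝓐 : Finset (AffineSubspace ℝ (Space n)),
    (∀ A ∈ 𝓐, (A : Set (Space n)).Nonempty ∧ Module.finrank ℝ A.direction + 2 ≤ n) ∧
    ∀ e, closure (M.face e) \ M.face e ⊆ ⋃ A ∈ 𝓐, (A : Set (Space n)) := by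
  classical
  choose H hH hp using M.face_polytope
  choose 𝓕 h𝓕 hcov using fun e => (hp e).flat
  refine ⟨(Finset.univ.biUnion 𝓕).filter fun A => (A : Set (Space n)).Nonempty, ?_, ?_⟩
  · intro A hA
    obtain ⟨hA, hne⟩ := Finset.mem_filter.1 hA
    obtain ⟨e, -, hA⟩ := Finset.mem_biUnion.1 hA
    refine ⟨hne, ?_⟩
    have h1 := AffineSubspace.direction_lt_of_nonempty (h𝓕 e A hA) hne
    have h2 := Submodule.finrank_lt_finrank_of_lt h1
    have h3 := hH e
    omega
  · intro e x hx
    obtain ⟨A, hA, hxA⟩ := mem_iUnion₂.1 (hcov e hx)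
    refine mem_iUnion₂.2 ⟨A, ?_, hxA⟩
    exact Finset.mem_filter.2 ⟨Finset.mem_biUnion.2 ⟨e, Finset.mem_univ _, hA⟩, ⟨x, hxA⟩⟩

lemma volume_frontier_cell (T : M.Cell) : volume (frontier (M.cell T)) = 0 := by
  rw [M.frontier_cell T]
  refine (measure_biUnion_null_iff (to_countable _)).2 fun e _ => ?_
  obtain ⟨H, hH, hp⟩ := M.face_polytope e
  refine measure_mono_null (closure_minimal hp.subset H.closed_of_finiteDimensional)
    (Measure.addHaar_affineSubspace _ _ ?_)
  rintro rfl
  rw [AffineSubspace.direction_top, finrank_top, finrank_euclideanSpace_fin] at hH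
  omega

end

section

variable {m : ℕ} {Ω : Set (Space (m + 1))} (M : PolyMesh Ω)

lemma surface_face_lt_top (e : M.Face) :
    Measure.euclideanHausdorffMeasure m (M.face e) < ⊤ := by
  obtain ⟨ν, x, U, hν, -, -, hU⟩ := M.exists_face_plane e
  have h := surface_plane_inter_lt_top hν x (M.isBounded_face e)
  rwa [inter_eq_right.2 (by rw [hU]; exact inter_subset_left)] at h

/-- Affine subspaces of codimension two do not charge the faces. -/
lemma surface_face_inter_affineSubspace (e : M.Face) {A : AffineSubspace ℝ (Space (m + 1))}
    (hA : Module.finrank ℝ A.direction + 2 ≤ m + 1) :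
    Measure.euclideanHausdorffMeasure m (M.face e ∩ A) = 0 := by
  obtain ⟨T, hT⟩ := M.face_used e
  obtain ⟨H, hH, hp⟩ := M.face_polytope e
  obtain ⟨x, hx⟩ := M.face_nonempty e
  have hpl := M.coe_eq_plane_normal hT hx hH hp
  refine measure_mono_null (inter_subset_inter_left _ (hpl ▸ hp.subset))
    (surface_plane_inter_affineSubspace (M.normal_unit T e hT) x fun hle => ?_)
  rw [← hpl, SetLike.coe_subset_coe] at hle
  have := Submodule.finrank_mono (AffineSubspace.direction_le hle)
  omega

/-- A relatively open part of a face has positive surface measure. -/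
lemma surface_face_inter_pos (e : M.Face) {V : Set (Space (m + 1))} (hV : IsOpen V)
    (hne : (M.face e ∩ V).Nonempty) :
    0 < Measure.euclideanHausdorffMeasure m (M.face e ∩ V) := by
  obtain ⟨ν, x, U, hν, -, hUo, hU⟩ := M.exists_face_plane e
  rw [hU, inter_assoc] at hne ⊢
  exact surface_plane_inter_pos hν x (hUo.inter hV) hne

end

end PolyMesh

/-! ### Cutoff functions around subspaces of codimension two -/

lemma exists_orthonormalBasis_of_two_le {n : ℕ} (W : Submodule ℝ (Space (n + 2)))
    (hW : 2 ≤ Module.finrank ℝ W) :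
    ∃ b : OrthonormalBasis (Fin (n + 2)) ℝ (Space (n + 2)), b 0 ∈ W ∧ b 1 ∈ W := by
  let c := stdOrthonormalBasis ℝ W
  let i₀ : Fin (Module.finrank ℝ W) := ⟨0, by omega⟩
  let i₁ : Fin (Module.finrank ℝ W) := ⟨1, by omega⟩
  have hne : i₀ ≠ i₁ := by simp [i₀, i₁]
  have hn : ∀ i, ‖(c i : Space (n + 2))‖ = 1 := fun i => by
    rw [← Submodule.coe_norm]
    exact c.orthonormal.1 i
  let v : Fin (n + 2) → Space (n + 2) := fun i => if i = 0 then c i₀ else c i₁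
  have h01 : inner ℝ (c i₀ : Space (n + 2)) (c i₁) = 0 := by
    simpa using c.orthonormal.2 hne
  obtain ⟨b, hb⟩ := Orthonormal.exists_orthonormalBasis_extension_of_card_eq (𝕜 := ℝ)
    (E := Space (n + 2)) (ι := Fin (n + 2)) (by simp) (v := v) (s := {0, 1})
    (by
      constructor
      · rintro ⟨i, hi⟩
        rcases hi with rfl | hi
        · simpa only [domRestrict_apply, v, if_true] using hn i₀
        · obtain rfl : i = 1 := hi
          simpa [v, -OrthonormalBasis.norm_eq_one] using hn i₁
      · rintro ⟨i, hi⟩ ⟨j, hj⟩ hij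
        rcases hi with rfl | hi <;> rcases hj with rfl | hj
        · exact absurd rfl hij
        · obtain rfl : j = 1 := hj
          simpa [v] using h01
        · obtain rfl : i = 1 := hi
          simpa [v, real_inner_comm] using h01
        · obtain rfl : i = 1 := hi
          obtain rfl : j = 1 := hj
          exact absurd rfl hij)
  refine ⟨b, ?_, ?_⟩
  · rw [hb 0 (by simp)]; simp [v]
  · rw [hb 1 (by simp)]; simp [v]

/-- The part of a ball in the `δ`-neighbourhood of a subspace of codimension two has measure
`O(δ²)`. -/
lemma exists_volume_tube_le {n : ℕ} (a : Space (n + 2)) (W : Submodule ℝ (Space (n + 2)))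
    (hW : 2 ≤ Module.finrank ℝ W) (R : ℝ) : ∃ C : ℝ, 0 ≤ C ∧ ∀ δ : ℝ, 0 ≤ δ →
      volume.real (Metric.closedBall a R ∩ {x | ‖W.starProjection (x - a)‖ ≤ δ}) ≤ C * δ ^ 2 := by
  obtain ⟨b, hb0, hb1⟩ := exists_orthonormalBasis_of_two_le W hW
  rcases lt_or_ge R 0 with hR | hR
  · exact ⟨0, le_rfl, fun δ _ => by simp [Metric.closedBall_eq_empty.2 hR]⟩
  refine ⟨4 * (2 * R) ^ n, by positivity, fun δ hδ => ?_⟩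
  let w : Fin (n + 2) → ℝ := Fin.cons δ (Fin.cons δ fun _ => R)
  have hw : ∀ i, 0 ≤ w i := by
    intro i
    refine Fin.cases hδ (fun i => ?_) i
    refine Fin.cases hδ (fun i => hR) i
  have hin : ∀ i, b i ∈ W → ∀ x, ‖W.starProjection (x - a)‖ ≤ δ → |inner ℝ (b i) (x - a)| ≤ δ := by
    intro i hi x hx
    have h1 : inner ℝ (b i) (x - a) = inner ℝ (b i) (W.starProjection (x - a)) := by
      rw [← W.inner_starProjection_left_eq_right, Submodule.starProjection_eq_self_iff.2 hi]
    rw [h1]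
    refine (abs_real_inner_le_norm _ _).trans ?_
    rw [b.orthonormal.1 i, one_mul]
    exact hx
  have hsub : frameChart b a ⁻¹' (Metric.closedBall a R ∩ {x | ‖W.starProjection (x - a)‖ ≤ δ}) ⊆
      Icc (-w) w := by
    rintro y ⟨hy1, hy2⟩
    have key : ∀ i, |y i| ≤ w i := by
      intro i
      refine Fin.cases ?_ (fun i => ?_) i
      · have := hin 0 hb0 _ hy2
        rwa [inner_frameChart_sub] at this
      · refine Fin.cases ?_ (fun i => ?_) i
        · have := hin 1 hb1 _ hy2
          rwa [inner_frameChart_sub] at this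
        · refine (abs_coord_le_norm_frameChart_sub b a y _).trans ?_
          have : ‖frameChart b a y - a‖ ≤ R := by simpa [dist_eq_norm] using hy1
          exact this
    exact ⟨fun i => (abs_le.1 (key i)).1, fun i => (abs_le.1 (key i)).2⟩
  have hcl : IsClosed {x : Space (n + 2) | ‖W.starProjection (x - a)‖ ≤ δ} :=
    isClosed_le (by fun_prop) continuous_const
  rw [measureReal_def, ← (measurePreserving_frameChart b a).measure_preimage
    ((Metric.isClosed_closedBall.inter hcl).measurableSet.nullMeasurableSet), ← measureReal_def]
  refine (measureReal_mono hsub isCompact_Icc.measure_lt_top.ne).trans ?_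
  rw [measureReal_def, Real.volume_Icc_pi_toReal (fun i => by simpa using hw i),
    Fin.prod_univ_succ, Fin.prod_univ_succ]
  simp only [Pi.neg_apply, w, Fin.cons_zero, Fin.cons_succ, Finset.prod_const, Finset.card_univ,
    Fintype.card_fin]
  apply le_of_eq
  ring

lemma deriv_smoothTransition_eq_zero {t : ℝ} (ht : t < 0 ∨ 1 < t) :
    deriv Real.smoothTransition t = 0 := by
  rcases ht with ht | ht
  · have : Real.smoothTransition =ᶠ[𝓝 t] fun _ => 0 := by
      filter_upwards [Iio_mem_nhds ht] with s hs
      exact Real.smoothTransition.zero_of_nonpos hs.le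
    rw [this.deriv_eq, deriv_const]
  · have : Real.smoothTransition =ᶠ[𝓝 t] fun _ => 1 := by
      filter_upwards [Ioi_mem_nhds ht] with s hs
      exact Real.smoothTransition.one_of_one_le hs.le
    rw [this.deriv_eq, deriv_const]

lemma exists_bound_deriv_smoothTransition :
    ∃ C : ℝ, 0 ≤ C ∧ ∀ t, |deriv Real.smoothTransition t| ≤ C := by
  have hcont : Continuous (deriv Real.smoothTransition) :=
    (Real.smoothTransition.contDiff (n := 1)).continuous_deriv le_rfl
  have hsupp : HasCompactSupport (deriv Real.smoothTransition) := by
    refine HasCompactSupport.intro (K := Icc 0 1) isCompact_Icc fun t ht => ?_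
    rw [mem_Icc, not_and_or, not_le, not_le] at ht
    exact deriv_smoothTransition_eq_zero ht
  obtain ⟨C, hC⟩ := hsupp.exists_bound_of_continuous hcont
  exact ⟨C, (norm_nonneg _).trans (hC 0), hC⟩

/-- Sets of codimension two have zero capacity: there are cutoff functions that vanish near the
affine subspace `A`, tend to one off `A`, and whose derivatives tend to zero in `L¹`. -/
lemma exists_cutoff {n : ℕ} {A : AffineSubspace ℝ (Space n)} (hne : (A : Set (Space n)).Nonempty)
    (hA : Module.finrank ℝ A.direction + 2 ≤ n) (v : Space n) :
    ∃ η : ℕ → Space n → ℝ, (∀ k, ContDiff ℝ 1 (η k)) ∧ (∀ k x, |η k x| ≤ 1) ∧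
      (∀ k, ∀ x ∈ A, ∀ᶠ y in 𝓝 x, η k y = 0) ∧
      (∀ x ∉ A, Tendsto (fun k => η k x) atTop (𝓝 1)) ∧
      ∀ S : Set (Space n), MeasurableSet S → Bornology.IsBounded S →
        Tendsto (fun k => ∫ x in S, |fderiv ℝ (η k) x v|) atTop (𝓝 0) := by
  obtain ⟨n, rfl⟩ : ∃ l, n = l + 2 := ⟨n - 2, by omega⟩
  obtain ⟨a, ha⟩ := hne
  have hW : 2 ≤ Module.finrank ℝ A.directionᗮ := by
    have := Submodule.finrank_add_finrank_orthogonal A.direction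
    rw [finrank_euclideanSpace_fin] at this
    omega
  set P := A.directionᗮ.starProjection with hP
  have hP0 : ∀ x, ‖P (x - a)‖ = 0 ↔ x ∈ A := by
    intro x
    rw [norm_eq_zero, hP, Submodule.starProjection_apply_eq_zero_iff,
      Submodule.orthogonal_orthogonal]
    exact AffineSubspace.vsub_right_mem_direction_iff_mem ha x
  let ε : ℕ → ℝ := fun k => 1 / ((k : ℝ) + 1)
  have hε : ∀ k, 0 < ε k := fun k => Nat.one_div_pos_of_nat
  have hεlim : Tendsto ε atTop (𝓝 0) := tendsto_one_div_add_atTop_nhds_zero_nat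
  let q : Space (n + 2) → ℝ := fun x => ‖P (x - a)‖ ^ 2
  have hqd : ∀ x, HasFDerivAt q (2 • (innerSL ℝ (P (x - a))).comp P) x := by
    intro x
    have h : HasFDerivAt (fun x => P (x - a)) P x :=
      P.hasFDerivAt.comp x ((hasFDerivAt_id x).sub_const a)
    exact h.norm_sq
  have hqc : ContDiff ℝ 1 q := (P.contDiff.comp (contDiff_id.sub contDiff_const)).norm_sq ℝ
  let g : ℕ → Space (n + 2) → ℝ := fun k x => q x / ε k ^ 2 - 1
  have hgc : ∀ k, ContDiff ℝ 1 (g k) := fun k => (hqc.div_const _).sub contDiff_const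
  refine ⟨fun k x => Real.smoothTransition (g k x),
    fun k => Real.smoothTransition.contDiff.comp (hgc k), fun k x => ?_, fun k x hx => ?_,
    fun x hx => ?_, fun S hS hSb => ?_⟩
  · rw [abs_of_nonneg (Real.smoothTransition.nonneg _)]
    exact Real.smoothTransition.le_one _
  · have h0 : g k x < 0 := by
      simp only [g, q, (hP0 x).2 hx]
      simp
    filter_upwards [(hgc k).continuous.continuousAt.eventually_lt continuousAt_const h0] with y hy
    exact Real.smoothTransition.zero_of_nonpos hy.le
  · have hpos : 0 < q x := by
      have : ‖P (x - a)‖ ≠ 0 := fun h => hx ((hP0 x).1 h)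
      positivity
    have hlim : Tendsto (fun k => 2 * ε k ^ 2) atTop (𝓝 0) := by
      simpa using (hεlim.pow 2).const_mul 2
    refine tendsto_const_nhds.congr' ?_
    filter_upwards [hlim.eventually (Iio_mem_nhds hpos)] with k hk
    refine (Real.smoothTransition.one_of_one_le ?_).symm
    have : 2 ≤ q x / ε k ^ 2 := by
      rw [le_div_iff₀ (pow_pos (hε k) 2)]
      exact (mem_Iio.1 hk).le
    simp only [g]
    linarith
  · obtain ⟨R, hR⟩ := hSb.subset_closedBall a
    obtain ⟨C, hC0, hC⟩ := exists_volume_tube_le a A.directionᗮ hW R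
    obtain ⟨K, hK0, hK⟩ := exists_bound_deriv_smoothTransition
    have hder : ∀ k x, fderiv ℝ (fun x => Real.smoothTransition (g k x)) x v =
        deriv Real.smoothTransition (g k x) * (2 * inner ℝ (P (x - a)) (P v) / ε k ^ 2) := by
      intro k x
      have h1 : HasDerivAt Real.smoothTransition (deriv Real.smoothTransition (g k x)) (g k x) :=
        ((Real.smoothTransition.contDiff (n := 1)).differentiable one_ne_zero _).hasDerivAt
      have h2 : HasFDerivAt (g k) ((ε k ^ 2)⁻¹ • (2 • (innerSL ℝ (P (x - a))).comp P)) x := by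
        have := ((hqd x).mul_const (ε k ^ 2)⁻¹).sub_const 1
        simpa only [g, div_eq_mul_inv] using this
      have h3 : HasFDerivAt (fun x => Real.smoothTransition (g k x)) _ x :=
        h1.comp_hasFDerivAt x h2
      rw [h3.fderiv]
      simp only [smul_apply, ContinuousLinearMap.comp_apply,
        innerSL_apply_apply, smul_eq_mul, nsmul_eq_mul, Nat.cast_ofNat]
      ring
    have hzero : ∀ k x, ¬ ‖P (x - a)‖ ≤ 2 * ε k →
        fderiv ℝ (fun x => Real.smoothTransition (g k x)) x v = 0 := by
      intro k x hx
      rw [hder, deriv_smoothTransition_eq_zero, zero_mul]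
      right
      have : 4 < q x / ε k ^ 2 := by
        rw [lt_div_iff₀ (pow_pos (hε k) 2)]
        have := pow_lt_pow_left₀ (not_le.1 hx) (by have := hε k; positivity) two_ne_zero
        simp only [q]
        linarith [this]
      simp only [g]
      linarith
    have hbound : ∀ k x, ‖P (x - a)‖ ≤ 2 * ε k →
        |fderiv ℝ (fun x => Real.smoothTransition (g k x)) x v| ≤ K * (4 * ‖P v‖) / ε k := by
      intro k x hx
      rw [hder, abs_mul, abs_div, abs_mul, abs_two, abs_of_pos (pow_pos (hε k) 2)]
      have h1 : |inner ℝ (P (x - a)) (P v)| ≤ 2 * ε k * ‖P v‖ :=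
        (abs_real_inner_le_norm _ _).trans (by gcongr)
      calc _ ≤ K * (2 * (2 * ε k * ‖P v‖) / ε k ^ 2) := by
            gcongr
            exact hK _
        _ = K * (4 * ‖P v‖) / ε k := by
            have := (hε k).ne'
            field_simp
            ring
    have hmain : ∀ k, ∫ x in S, |fderiv ℝ (fun x => Real.smoothTransition (g k x)) x v| ≤
        K * (4 * ‖P v‖) * C * 4 * ε k := by
      intro k
      have hcl : IsClosed {x | ‖P (x - a)‖ ≤ 2 * ε k} := isClosed_le (by fun_prop) continuous_const
      have htube : volume.real (S ∩ {x | ‖P (x - a)‖ ≤ 2 * ε k}) ≤ C * (2 * ε k) ^ 2 :=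
        (measureReal_mono (inter_subset_inter_left _ hR)
          ((measure_mono inter_subset_left).trans_lt
            (measure_closedBall_lt_top (x := a) (r := R))).ne).trans
          (hC _ (by have := hε k; positivity))
      have hfin : volume (S ∩ {x | ‖P (x - a)‖ ≤ 2 * ε k}) < ⊤ :=
        (measure_mono inter_subset_left).trans_lt hSb.measure_lt_top
      rw [setIntegral_eq_of_subset_of_forall_sdiff_eq_zero (s := S ∩ {x | ‖P (x - a)‖ ≤ 2 * ε k})
        hS inter_subset_left (fun x hx => by
          rw [hzero k x fun h => hx.2 ⟨hx.1, h⟩, abs_zero])]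
      refine (Real.le_norm_self _).trans ((norm_setIntegral_le_of_norm_le_const hfin
        (C := K * (4 * ‖P v‖) / ε k) fun x hx => ?_).trans ?_)
      · rw [Real.norm_eq_abs, abs_abs]
        exact hbound k x hx.2
      · have hk := hε k
        calc _ ≤ K * (4 * ‖P v‖) / ε k * (C * (2 * ε k) ^ 2) := by gcongr
          _ = _ := by
            field_simp
            ring
    refine squeeze_zero (fun k => integral_nonneg fun x => abs_nonneg _) hmain ?_
    simpa using hεlim.const_mul (K * (4 * ‖P v‖) * C * 4)

/-! ### The divergence theorem on a polytopal cell -/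

lemma integrableOn_of_continuous_of_isBounded {n : ℕ} {μ : Measure (Space n)} {S : Set (Space n)}
    {g : Space n → ℝ} (hg : Continuous g) (hS : MeasurableSet S) (hb : Bornology.IsBounded S)
    (hμ : μ S < ⊤) : IntegrableOn g S μ := by
  obtain ⟨C, hC⟩ := hb.isCompact_closure.exists_bound_of_continuousOn hg.continuousOn
  exact Measure.integrableOn_of_bounded hμ.ne hg.aestronglyMeasurable
    ((ae_restrict_iff' hS).2 (ae_of_all _ fun x hx => hC x (subset_closure hx)))

lemma setIntegral_eq_of_inter_eq {n : ℕ} {μ : Measure (Space n)} {S S' U : Set (Space n)}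
    {g : Space n → ℝ} (hS : MeasurableSet S) (hS' : MeasurableSet S')
    (hU : ∀ x ∈ U, (x ∈ S ↔ x ∈ S')) (hg : ∀ x ∉ U, g x = 0) :
    ∫ x in S, g x ∂μ = ∫ x in S', g x ∂μ := by
  rw [← integral_indicator hS, ← integral_indicator hS']
  congr 1
  funext x
  by_cases hx : x ∈ U
  · by_cases hxS : x ∈ S
    · rw [indicator_of_mem hxS, indicator_of_mem ((hU x hx).1 hxS)]
    · rw [indicator_of_notMem hxS, indicator_of_notMem fun h => hxS ((hU x hx).2 h)]
  · simp [indicator, hg x hx]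

lemma fderiv_eq_zero_of_notMem_tsupport {n : ℕ} {F : Space n → ℝ} {x : Space n}
    (hx : x ∉ tsupport F) : fderiv ℝ F x = 0 := by
  by_contra h
  exact hx (support_fderiv_subset ℝ h)

lemma integral_fderiv_eq_zero {n : ℕ} {F : Space n → ℝ} (hF : ContDiff ℝ 1 F)
    (hc : HasCompactSupport F) (v : Space n) : ∫ x, fderiv ℝ F x v = 0 := by
  have hi : Integrable (fun x => fderiv ℝ F x v) :=
    ((hF.continuous_fderiv one_ne_zero).clm_apply continuous_const).integrable_of_hasCompactSupport
      ((hc.fderiv ℝ).mono' fun x hx => by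
        by_contra h
        exact hx (by simp [image_eq_zero_of_notMem_tsupport h]))
  have := integral_mul_fderiv_eq_neg_fderiv_mul_of_integrable (μ := volume) (f := fun _ => (1 : ℝ))
    (g := F) (v := v) (by simp) (by simpa using hi)
    (by simpa using hF.continuous.integrable_of_hasCompactSupport hc)
    (fun x _ => differentiableAt_const _) (fun x _ => hF.differentiable one_ne_zero x)
  simpa using this

namespace PolyMesh

variable {m : ℕ} {Ω : Set (Space (m + 1))} (M : PolyMesh Ω)

lemma integrableOn_cell {g : Space (m + 1) → ℝ} (hg : Continuous g) (T : M.Cell) :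
    IntegrableOn g (M.cell T) :=
  integrableOn_of_continuous_of_isBounded hg (M.isOpen_cell T).measurableSet (M.isBounded_cell T)
    (M.isBounded_cell T).measure_lt_top

lemma integrableOn_face {g : Space (m + 1) → ℝ} (hg : Continuous g) (e : M.Face) :
    IntegrableOn g (M.face e) (Measure.euclideanHausdorffMeasure m) :=
  integrableOn_of_continuous_of_isBounded hg (M.measurableSet_face e) (M.isBounded_face e)
    (M.surface_face_lt_top e)

open Classical in
/-- The difference of the two sides of the divergence theorem on the cell `T` for the vector field
`F • v`. -/
def divDefect (T : M.Cell) (v : Space (m + 1)) (F : Space (m + 1) → ℝ) : ℝ :=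
  (∫ x in M.cell T, fderiv ℝ F x v) - ∑ e with M.face e ⊆ frontier (M.cell T),
    inner ℝ (M.normal T e) v * ∫ x in M.face e, F x ∂Measure.euclideanHausdorffMeasure m

lemma divDefect_add (T : M.Cell) (v : Space (m + 1)) {F G : Space (m + 1) → ℝ}
    (hF : ContDiff ℝ 1 F) (hG : ContDiff ℝ 1 G) :
    M.divDefect T v (fun x => F x + G x) = M.divDefect T v F + M.divDefect T v G := by
  have h1 : ∀ x, fderiv ℝ (fun x => F x + G x) x v = fderiv ℝ F x v + fderiv ℝ G x v := fun x => by
    rw [fderiv_fun_add (hF.differentiable one_ne_zero x) (hG.differentiable one_ne_zero x)]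
    rfl
  simp only [divDefect, h1]
  rw [integral_add (M.integrableOn_cell ((hF.continuous_fderiv one_ne_zero).clm_apply
    continuous_const) T) (M.integrableOn_cell ((hG.continuous_fderiv one_ne_zero).clm_apply
    continuous_const) T)]
  simp only [integral_add (M.integrableOn_face hF.continuous _) (M.integrableOn_face hG.continuous _),
    mul_add, Finset.sum_add_distrib]
  ring

lemma divDefect_zero (T : M.Cell) (v : Space (m + 1)) : M.divDefect T v (fun _ => 0) = 0 := by
  simp [divDefect]

lemma divDefect_sum (T : M.Cell) (v : Space (m + 1)) {ι : Type*} (s : Finset ι)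
    {F : ι → Space (m + 1) → ℝ} (hF : ∀ i, ContDiff ℝ 1 (F i)) :
    M.divDefect T v (fun x => ∑ i ∈ s, F i x) = ∑ i ∈ s, M.divDefect T v (F i) := by
  classical
  induction s using Finset.induction_on with
  | empty => simp [divDefect_zero]
  | insert i s hi ih =>
    simp only [Finset.sum_insert hi]
    rw [M.divDefect_add T v (hF i) (ContDiff.sum fun j _ => hF j), ih]

/-- Off the relative boundaries of the faces, the divergence theorem holds locally: the cell is
locally empty, everything, or a half-space. -/
lemma exists_isOpen_divDefect_eq_zero (T : M.Cell) (v x : Space (m + 1))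
    (hx : ∀ e, x ∉ closure (M.face e) \ M.face e) :
    ∃ U : Set (Space (m + 1)), IsOpen U ∧ x ∈ U ∧ ∀ F : Space (m + 1) → ℝ, ContDiff ℝ 1 F →
      HasCompactSupport F → tsupport F ⊆ U → M.divDefect T v F = 0 := by
  classical
  have hTm := (M.isOpen_cell T).measurableSet
  by_cases hxT : x ∈ M.cell T
  · refine ⟨M.cell T, M.isOpen_cell T, hxT, fun F hF hc hsupp => ?_⟩
    have h1 : ∫ x in M.cell T, fderiv ℝ F x v = 0 := by
      rw [setIntegral_eq_integral_of_forall_compl_eq_zero, integral_fderiv_eq_zero hF hc]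
      intro y hy
      rw [fderiv_eq_zero_of_notMem_tsupport fun h => hy (hsupp h)]
      rfl
    rw [divDefect, h1, zero_sub, neg_eq_zero]
    refine Finset.sum_eq_zero fun e he => ?_
    rw [setIntegral_eq_zero_of_forall_eq_zero, mul_zero]
    intro y hy
    refine image_eq_zero_of_notMem_tsupport fun h => ?_
    have hyf := (Finset.mem_filter.1 he).2 hy
    rw [(M.isOpen_cell T).frontier_eq] at hyf
    exact hyf.2 (hsupp h)
  by_cases hxF : x ∈ frontier (M.cell T)
  · rw [M.frontier_cell T] at hxF
    obtain ⟨e, he, hxe⟩ := mem_iUnion₂.1 hxF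
    have he : M.face e ⊆ frontier (M.cell T) := he
    have hxe : x ∈ M.face e := by
      by_contra h
      exact hx e ⟨hxe, h⟩
    obtain ⟨U, hUsub, hU, hxU⟩ := mem_nhds_iff.1 ((M.normal_outward T e he x hxe).and
      ((M.eventually_mem_face_iff he hxe).and (M.eventually_notMem_face he hxe)))
    refine ⟨U, hU, hxU, fun F hF hc hsupp => ?_⟩
    have hF0 : ∀ y ∉ U, F y = 0 := fun y hy =>
      image_eq_zero_of_notMem_tsupport fun h => hy (hsupp h)
    have h1 : ∫ x in M.cell T, fderiv ℝ F x v =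
        ∫ y in {y | inner ℝ (M.normal T e) (y - x) < 0}, fderiv ℝ F y v := by
      refine setIntegral_eq_of_inter_eq (U := U) hTm
        (isOpen_lt (by fun_prop) continuous_const).measurableSet (fun y hy => (hUsub hy).1)
        fun y hy => ?_
      rw [fderiv_eq_zero_of_notMem_tsupport fun h => hy (hsupp h)]
      rfl
    have h2 : ∫ x in M.face e, F x ∂Measure.euclideanHausdorffMeasure m =
        ∫ y in plane (M.normal T e) x, F y ∂Measure.euclideanHausdorffMeasure m :=
      setIntegral_eq_of_inter_eq (U := U) (M.measurableSet_face e) (measurableSet_plane _ _)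
        (fun y hy => (hUsub hy).2.1) hF0
    rw [divDefect, h1, integral_halfSpace_fderiv hF hc (M.normal_unit T e he),
      Finset.sum_eq_single_of_mem e (by simpa using he), h2, sub_self]
    intro e' he' hne
    rw [setIntegral_eq_zero_of_forall_eq_zero, mul_zero]
    intro y hy
    exact hF0 y fun h => (hUsub h).2.2 e' (Finset.mem_filter.1 he').2 hne hy
  · have hxc : x ∉ closure (M.cell T) := fun h => hxF (by
      rw [(M.isOpen_cell T).frontier_eq]
      exact ⟨h, hxT⟩)
    refine ⟨(closure (M.cell T))ᶜ, isClosed_closure.isOpen_compl, hxc, fun F hF hc hsupp => ?_⟩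
    rw [divDefect, setIntegral_eq_zero_of_forall_eq_zero, zero_sub, neg_eq_zero]
    · refine Finset.sum_eq_zero fun e he => ?_
      rw [setIntegral_eq_zero_of_forall_eq_zero, mul_zero]
      intro y hy
      exact image_eq_zero_of_notMem_tsupport fun h =>
        hsupp h (frontier_subset_closure ((Finset.mem_filter.1 he).2 hy))
    · intro y hy
      rw [fderiv_eq_zero_of_notMem_tsupport fun h => hsupp h (subset_closure hy)]
      rfl

/-- The divergence theorem for functions supported away from the relative boundaries of the
faces, by a partition of unity. -/
lemma divDefect_eq_zero_of_disjoint (T : M.Cell) (v : Space (m + 1)) {F : Space (m + 1) → ℝ}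
    (hF : ContDiff ℝ 1 F) (hc : HasCompactSupport F)
    (hdisj : ∀ x ∈ tsupport F, ∀ e, x ∉ closure (M.face e) \ M.face e) :
    M.divDefect T v F = 0 := by
  choose! U hU hxU hdef using fun x (hx : x ∈ tsupport F) =>
    M.exists_isOpen_divDefect_eq_zero T v x (hdisj x hx)
  obtain ⟨t, ht⟩ := hc.isCompact.elim_nhds_subcover' (fun x _ => U x)
    (fun x hx => (hU x hx).mem_nhds (hxU x hx))
  have hcov' : tsupport F ⊆ ⋃ x : t, U (x : Space (m + 1)) := by
    intro y hy
    obtain ⟨x, hx, hyx⟩ := mem_iUnion₂.1 (ht hy)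
    exact mem_iUnion.2 ⟨⟨x, hx⟩, hyx⟩
  obtain ⟨ρ, hρ⟩ := SmoothPartitionOfUnity.exists_isSubordinate
    (modelWithCornersSelf ℝ (Space (m + 1))) (isClosed_tsupport F)
    (fun x : t => U (x : Space (m + 1))) (fun x => hU _ x.1.2) hcov'
  have hρc : ∀ i, ContDiff ℝ 1 (ρ i) := fun i => by
    have := (ρ i).contMDiff.contDiff
    exact this.of_le (by exact_mod_cast le_top)
  have hsum : F = fun x => ∑ i, ρ i x * F x := by
    funext x
    by_cases hx : x ∈ tsupport F
    · have := ρ.sum_eq_one hx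
      rw [finsum_eq_sum_of_fintype] at this
      rw [← Finset.sum_mul, this, one_mul]
    · simp [image_eq_zero_of_notMem_tsupport hx]
  rw [hsum, M.divDefect_sum T v _ fun i => (hρc i).mul hF]
  refine Finset.sum_eq_zero fun i _ => ?_
  exact hdef _ i.1.2 _ ((hρc i).mul hF) hc.mul_left ((tsupport_mul_subset_left).trans (hρ i))

/-- Removing one subspace of codimension two from the set that the support of `F` has to avoid. -/
lemma divDefect_eq_zero_of_cutoff (T : M.Cell) (v : Space (m + 1)) {F : Space (m + 1) → ℝ}
    (hF : ContDiff ℝ 1 F) {A : AffineSubspace ℝ (Space (m + 1))}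
    (hne : (A : Set (Space (m + 1))).Nonempty) (hA : Module.finrank ℝ A.direction + 2 ≤ m + 1)
    (h : ∀ η : Space (m + 1) → ℝ, ContDiff ℝ 1 η → (∀ x ∈ A, ∀ᶠ y in 𝓝 x, η y = 0) →
      M.divDefect T v (fun x => F x * η x) = 0) : M.divDefect T v F = 0 := by
  classical
  obtain ⟨η, hη, hη1, hη0, hlim, hder⟩ := exists_cutoff hne hA v
  have hTb := M.isBounded_cell T
  have hTm := (M.isOpen_cell T).measurableSet
  have hDF : Continuous fun x => fderiv ℝ F x v :=
    (hF.continuous_fderiv one_ne_zero).clm_apply continuous_const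
  have hDη : ∀ k, Continuous fun x => fderiv ℝ (η k) x v := fun k =>
    ((hη k).continuous_fderiv one_ne_zero).clm_apply continuous_const
  have hA0 : (volume : Measure (Space (m + 1))) A = 0 := by
    refine Measure.addHaar_affineSubspace _ _ ?_
    rintro rfl
    rw [AffineSubspace.direction_top, finrank_top, finrank_euclideanSpace_fin] at hA
    omega
  -- the first part of the product rule
  have L1 : Tendsto (fun k => ∫ x in M.cell T, fderiv ℝ F x v * η k x) atTop
      (𝓝 (∫ x in M.cell T, fderiv ℝ F x v)) := by
    refine tendsto_integral_of_dominated_convergence (fun x => |fderiv ℝ F x v|)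
      (fun k => (hDF.mul (hη k).continuous).aestronglyMeasurable)
      (M.integrableOn_cell hDF T).abs (fun k => ae_of_all _ fun x => ?_) ?_
    · rw [Real.norm_eq_abs, abs_mul]
      exact mul_le_of_le_one_right (abs_nonneg _) (hη1 k x)
    · have : ∀ᵐ x ∂volume, x ∉ (A : Set (Space (m + 1))) := measure_eq_zero_iff_ae_notMem.1 hA0
      filter_upwards [ae_restrict_of_ae this] with x hx
      simpa using (hlim x hx).const_mul (fderiv ℝ F x v)
  -- the second part is small as the derivatives of the cutoff functions tend to zero in `L¹`
  have L2 : Tendsto (fun k => ∫ x in M.cell T, F x * fderiv ℝ (η k) x v) atTop (𝓝 0) := by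
    obtain ⟨C, hC⟩ := hTb.isCompact_closure.exists_bound_of_continuousOn hF.continuous.continuousOn
    have hb : ∀ k, ‖∫ x in M.cell T, F x * fderiv ℝ (η k) x v‖ ≤
        |C| * ∫ x in M.cell T, |fderiv ℝ (η k) x v| := by
      intro k
      rw [← integral_const_mul]
      refine norm_integral_le_of_norm_le ((M.integrableOn_cell (hDη k).abs T).const_mul _) ?_
      refine (ae_restrict_iff' hTm).2 (ae_of_all _ fun x hx => ?_)
      rw [Real.norm_eq_abs, abs_mul]
      exact mul_le_mul_of_nonneg_right ((hC x (subset_closure hx)).trans (le_abs_self C))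
        (abs_nonneg _)
    refine squeeze_zero_norm hb ?_
    simpa using (hder _ hTm hTb).const_mul |C|
  have L3 : ∀ e, Tendsto (fun k => ∫ x in M.face e, F x * η k x
      ∂Measure.euclideanHausdorffMeasure m) atTop
      (𝓝 (∫ x in M.face e, F x ∂Measure.euclideanHausdorffMeasure m)) := by
    intro e
    refine tendsto_integral_of_dominated_convergence (fun x => |F x|)
      (fun k => (hF.continuous.mul (hη k).continuous).aestronglyMeasurable)
      (M.integrableOn_face hF.continuous e).abs (fun k => ae_of_all _ fun x => ?_) ?_
    · rw [Real.norm_eq_abs, abs_mul]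
      exact mul_le_of_le_one_right (abs_nonneg _) (hη1 k x)
    · have h0 := M.surface_face_inter_affineSubspace e hA
      rw [inter_comm, ← Measure.restrict_apply A.closed_of_finiteDimensional.measurableSet] at h0
      filter_upwards [measure_eq_zero_iff_ae_notMem.1 h0] with x hx
      simpa using (hlim x hx).const_mul (F x)
  have hk : ∀ k, M.divDefect T v (fun x => F x * η k x) =
      ((∫ x in M.cell T, fderiv ℝ F x v * η k x) + ∫ x in M.cell T, F x * fderiv ℝ (η k) x v) -
      ∑ e with M.face e ⊆ frontier (M.cell T), inner ℝ (M.normal T e) v *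
        ∫ x in M.face e, F x * η k x ∂Measure.euclideanHausdorffMeasure m := by
    intro k
    have i1 : IntegrableOn (fun x => fderiv ℝ F x v * η k x) (M.cell T) :=
      M.integrableOn_cell (hDF.mul (hη k).continuous) T
    have i2 : IntegrableOn (fun x => F x * fderiv ℝ (η k) x v) (M.cell T) :=
      M.integrableOn_cell (hF.continuous.mul (hDη k)) T
    rw [divDefect, ← integral_add i1 i2]
    congr 2
    funext x
    rw [fderiv_fun_mul (hF.differentiable one_ne_zero x) ((hη k).differentiable one_ne_zero x)]
    simp only [add_apply, smul_apply, smul_eq_mul]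
    ring
  have L : Tendsto (fun k => M.divDefect T v (fun x => F x * η k x)) atTop
      (𝓝 (M.divDefect T v F)) := by
    simp only [hk]
    rw [divDefect]
    have := (L1.add L2).sub (tendsto_finsetSum
      (Finset.univ.filter fun e => M.face e ⊆ frontier (M.cell T))
      fun e _ => (L3 e).const_mul (inner ℝ (M.normal T e) v))
    simpa using this
  refine tendsto_nhds_unique L ?_
  simp only [h _ (hη _) (hη0 _)]
  exact tendsto_const_nhds

lemma divDefect_eq_zero_of_hasCompactSupport (T : M.Cell) (v : Space (m + 1))
    {F : Space (m + 1) → ℝ} (hF : ContDiff ℝ 1 F) (hc : HasCompactSupport F) :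
    M.divDefect T v F = 0 := by
  classical
  obtain ⟨𝓐, h𝓐, hcov⟩ := M.exists_ridges
  have key : ∀ 𝓢 : Finset (AffineSubspace ℝ (Space (m + 1))), 𝓢 ⊆ 𝓐 →
      ∀ F : Space (m + 1) → ℝ, ContDiff ℝ 1 F → HasCompactSupport F →
      (∀ A ∈ 𝓐, A ∉ 𝓢 → ∀ x ∈ tsupport F, x ∉ A) → M.divDefect T v F = 0 := by
    intro 𝓢
    induction 𝓢 using Finset.induction_on with
    | empty =>
      intro _ F hF hc hd
      refine M.divDefect_eq_zero_of_disjoint T v hF hc fun x hx e hxe => ?_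
      obtain ⟨A, hA, hxA⟩ := mem_iUnion₂.1 (hcov e hxe)
      exact hd A hA (Finset.notMem_empty A) x hx hxA
    | insert A 𝓢 _ ih =>
      intro hsub F hF hc hd
      have hA := h𝓐 A (hsub (Finset.mem_insert_self _ _))
      refine M.divDefect_eq_zero_of_cutoff T v hF hA.1 hA.2 fun η hη hη0 => ?_
      refine ih ((Finset.subset_insert _ _).trans hsub) _ (hF.mul hη) hc.mul_right ?_
      intro B hB hBS x hx hxB
      by_cases hBA : B = A
      · subst hBA
        exact (notMem_tsupport_iff_eventuallyEq.2 (hη0 x hxB)) (tsupport_mul_subset_right hx)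
      · exact hd B hB (by simp [hBA, hBS]) x (tsupport_mul_subset_left hx) hxB
  exact key 𝓐 subset_rfl F hF hc fun A hA hA' => absurd hA hA'

open Classical in
/-- **The divergence theorem** on a cell of a mesh, for the vector field `F • v`. -/
theorem integral_cell_fderiv (T : M.Cell) (v : Space (m + 1))
    {F : Space (m + 1) → ℝ} (hF : ContDiff ℝ 1 F) :
    ∫ x in M.cell T, fderiv ℝ F x v = ∑ e with M.face e ⊆ frontier (M.cell T),
      inner ℝ (M.normal T e) v * ∫ x in M.face e, F x ∂Measure.euclideanHausdorffMeasure m := by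
  obtain ⟨R, hR0, hR⟩ : ∃ R : ℝ, 0 < R ∧ closure (M.cell T) ⊆ Metric.ball 0 R := by
    obtain ⟨R, hR⟩ := (M.isBounded_cell T).closure.subset_ball 0
    exact ⟨max R 1, by positivity, hR.trans (Metric.ball_subset_ball (le_max_left _ _))⟩
  let χ : ContDiffBump (0 : Space (m + 1)) := ⟨R, R + 1, hR0, by linarith⟩
  have hχ : ∀ x ∈ closure (M.cell T), (fun y => χ y * F y) =ᶠ[𝓝 x] F := fun x hx => by
    filter_upwards [χ.eventuallyEq_one_of_mem_ball (hR hx)] with y hy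
    simp [hy]
  have h := M.divDefect_eq_zero_of_hasCompactSupport T v (F := fun y => χ y * F y)
    (χ.contDiff.mul hF) χ.hasCompactSupport.mul_right
  rw [divDefect, sub_eq_zero] at h
  have h1 : ∫ x in M.cell T, fderiv ℝ (fun y => χ y * F y) x v =
      ∫ x in M.cell T, fderiv ℝ F x v :=
    setIntegral_congr_fun (M.isOpen_cell T).measurableSet fun x hx => by
      simp only [(hχ x (subset_closure hx)).fderiv_eq]
  rw [← h1, h]
  refine Finset.sum_congr rfl fun e he => ?_
  congr 1
  exact setIntegral_congr_fun (M.measurableSet_face e) fun x hx =>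
    (hχ x (frontier_subset_closure ((Finset.mem_filter.1 he).2 hx))).self_of_nhds

end PolyMesh

/-! ### Faces inside the domain are shared by two cells with opposite normals -/

lemma tendsto_add_smul {n : ℕ} (x w : Space n) :
    Tendsto (fun t : ℝ => x + t • w) (𝓝[>] 0) (𝓝 x) := by
  have : ContinuousAt (fun t : ℝ => x + t • w) 0 := by fun_prop
  have h := this.tendsto
  simp only [zero_smul, add_zero] at h
  exact h.mono_left nhdsWithin_le_nhds

/-- Two locally disjoint half-spaces with a common boundary point have opposite normals. -/
lemma eq_neg_of_eventually_disjoint {n : ℕ} {ν ν' x : Space n} (hν : ‖ν‖ = 1) (hν' : ‖ν'‖ = 1)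
    (h : ∀ᶠ y in 𝓝 x, ¬ (inner ℝ ν (y - x) < 0 ∧ inner ℝ ν' (y - x) < 0)) : ν' = -ν := by
  have h2 : ‖ν + ν'‖ ^ 2 = 2 + 2 * inner ℝ ν ν' := by
    rw [norm_add_sq_real, hν, hν']
    ring
  have h1 : inner ℝ ν ν' ≤ -1 := by
    by_contra! hlt
    obtain ⟨t, ht1, ht2⟩ := (((tendsto_add_smul x (-(ν + ν'))).eventually h).and
      self_mem_nhdsWithin).exists
    have ht2 : 0 < t := ht2
    refine ht1 ⟨?_, ?_⟩
    · rw [add_sub_cancel_left, inner_smul_right, inner_neg_right, inner_add_right,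
        real_inner_self_eq_norm_sq, hν]
      nlinarith
    · rw [add_sub_cancel_left, inner_smul_right, inner_neg_right, inner_add_right,
        real_inner_self_eq_norm_sq, hν', real_inner_comm]
      nlinarith
  have h3 : ‖ν + ν'‖ = 0 := by
    have : 0 ≤ ‖ν + ν'‖ := norm_nonneg _
    nlinarith
  rw [norm_eq_zero] at h3
  exact eq_neg_of_add_eq_zero_right h3

namespace PolyMesh

section

variable {n : ℕ} {Ω : Set (Space n)} (M : PolyMesh Ω)

lemma normal_eq_neg {T T' : M.Cell} (hne : T ≠ T') {e : M.Face}
    (he : M.face e ⊆ frontier (M.cell T)) (he' : M.face e ⊆ frontier (M.cell T')) :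
    M.normal T' e = -M.normal T e := by
  obtain ⟨x, hx⟩ := M.face_nonempty e
  refine eq_neg_of_eventually_disjoint (M.normal_unit T e he) (M.normal_unit T' e he') (x := x) ?_
  filter_upwards [M.normal_outward T e he x hx, M.normal_outward T' e he' x hx] with y h1 h2
  rw [← h1, ← h2]
  exact fun h => (M.cell_disjoint hne).le_bot h

/-- A face that has a point of `Ω` off the relative boundaries of the faces lies on the boundary
of a second cell. -/
lemma exists_ne_face_subset {T : M.Cell} {e : M.Face} (he : M.face e ⊆ frontier (M.cell T))
    (hΩ : IsOpen Ω) {x : Space n} (hx : x ∈ M.face e) (hxΩ : x ∈ Ω)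
    (hgen : ∀ e', x ∉ closure (M.face e') \ M.face e') :
    ∃ T', T' ≠ T ∧ M.face e ⊆ frontier (M.cell T') := by
  obtain ⟨T', hT', hxT'⟩ : ∃ T', T' ≠ T ∧ x ∈ closure (M.cell T') := by
    by_contra! h
    have h1 : ∀ᶠ y in 𝓝 x, ∀ T', T' ≠ T → y ∉ closure (M.cell T') := by
      refine eventually_all.2 fun T' => ?_
      by_cases hT' : T' = T
      · exact Eventually.of_forall fun _ h => absurd hT' h
      · filter_upwards [isClosed_closure.isOpen_compl.mem_nhds (h T' hT')] with y hy _
        exact hy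
    obtain ⟨t, ⟨⟨hy1, hy2⟩, hy3, hy4⟩, ht⟩ := (((tendsto_add_smul x (M.normal T e)).eventually
      ((h1.and (hΩ.mem_nhds hxΩ)).and ((M.eventually_mem_frontier_iff he hx).and
      (M.normal_outward T e he x hx)))).and self_mem_nhdsWithin).exists
    have ht : 0 < t := ht
    have hin : inner ℝ (M.normal T e) (x + t • M.normal T e - x) = t := by
      rw [add_sub_cancel_left, inner_smul_right, real_inner_self_eq_norm_sq,
        M.normal_unit T e he]
      ring
    rw [hin] at hy3 hy4
    have hcov := subset_closure (s := Ω) hy2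
    rw [M.cover] at hcov
    obtain ⟨T', hT'⟩ := mem_iUnion.1 hcov
    by_cases hTT : T' = T
    · subst hTT
      rw [closure_eq_self_union_frontier] at hT'
      rcases hT' with hT' | hT'
      · linarith [hy4.1 hT']
      · linarith [hy3.1 hT']
    · exact hy1 T' hTT hT'
  refine ⟨T', hT', ?_⟩
  have hx0 : x ∈ closure (M.cell T) := frontier_subset_closure (he hx)
  have hxn : x ∉ M.cell T' := fun h =>
    ((M.cell_disjoint hT').closure_right (M.isOpen_cell T')).le_bot ⟨h, hx0⟩
  have hxF : x ∈ frontier (M.cell T') := by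
    rw [(M.isOpen_cell T').frontier_eq]
    exact ⟨hxT', hxn⟩
  rw [M.frontier_cell T'] at hxF
  obtain ⟨e', he', hxe'⟩ := mem_iUnion₂.1 hxF
  have hxe : x ∈ M.face e' := by
    by_contra h
    exact hgen e' ⟨hxe', h⟩
  have : e' = e := by
    by_contra hne
    exact (M.face_disjoint hne).le_bot ⟨hxe, hx⟩
  exact this ▸ he'

lemma face_subset_closure (e : M.Face) : M.face e ⊆ closure Ω := by
  obtain ⟨T, hT⟩ := M.face_used e
  exact hT.trans (frontier_subset_closure.trans (closure_mono (M.cell_subset T)))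

end

section

variable {m : ℕ} {Ω : Set (Space (m + 1))} (M : PolyMesh Ω)

open Classical in
/-- The normals of the cells at a face cancel, or the face lies on the boundary of the domain. -/
lemma sum_normal_eq_zero_or (hΩ : IsOpen Ω) (e : M.Face) :
    ∑ T with M.face e ⊆ frontier (M.cell T), M.normal T e = 0 ∨ M.face e ⊆ frontier Ω := by
  by_cases hgen : ∃ x ∈ M.face e, x ∈ Ω ∧ ∀ e', x ∉ closure (M.face e') \ M.face e'
  · left
    obtain ⟨x, hx, hxΩ, hg⟩ := hgen
    obtain ⟨T, hT⟩ := M.face_used e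
    obtain ⟨T', hne, hT'⟩ := M.exists_ne_face_subset hT hΩ hx hxΩ hg
    have hset : (Finset.univ.filter fun T => M.face e ⊆ frontier (M.cell T)) = {T, T'} := by
      ext S
      simp only [Finset.mem_filter, Finset.mem_univ, true_and, Finset.mem_insert,
        Finset.mem_singleton]
      refine ⟨fun hS => ?_, ?_⟩
      · by_contra! hcon
        have h1 := M.normal_eq_neg hcon.1 hS hT
        have h2 := M.normal_eq_neg hcon.2 hS hT'
        have h3 := M.normal_eq_neg hne hT' hT
        rw [h1, h2, neg_neg] at h3
        have h4 := M.normal_unit S e hS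
        have h5 : M.normal S e = 0 := by
          rw [neg_eq_iff_add_eq_zero, ← two_smul ℝ] at h3
          exact (smul_eq_zero.1 h3).resolve_left two_ne_zero
        simp [h5] at h4
      · rintro (rfl | rfl) <;> assumption
    rw [hset, Finset.sum_pair hne.symm, M.normal_eq_neg hne.symm hT hT', add_neg_cancel]
  · right
    push Not at hgen
    rw [hΩ.frontier_eq]
    refine fun x hx => ⟨M.face_subset_closure e hx, fun hxΩ => ?_⟩
    obtain ⟨𝓐, h𝓐, hcov⟩ := M.exists_ridges
    have hpos := M.surface_face_inter_pos e hΩ ⟨x, hx, hxΩ⟩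
    refine hpos.ne' (measure_mono_null (t := ⋃ A ∈ 𝓐, M.face e ∩ (A : Set (Space (m + 1)))) ?_ ?_)
    · rintro y ⟨hy, hyΩ⟩
      obtain ⟨e', he'⟩ := hgen y hy hyΩ
      obtain ⟨A, hA, hyA⟩ := mem_iUnion₂.1 (hcov e' he')
      exact mem_iUnion₂.2 ⟨A, hA, hy, hyA⟩
    · exact (measure_biUnion_null_iff 𝓐.countable_toSet).2 fun A hA =>
        M.surface_face_inter_affineSubspace e (h𝓐 A hA).2

/-! ### Weak derivatives of piecewise smooth functions -/

/-- The function that is equal to `p T` on each cell `T`, and zero off the cells. -/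
def piecewise (p : M.Cell → Space (m + 1) → ℝ) (x : Space (m + 1)) : ℝ :=
  ∑ T, (M.cell T).indicator (p T) x

lemma piecewise_of_mem (p : M.Cell → Space (m + 1) → ℝ) {T : M.Cell} {x : Space (m + 1)}
    (hx : x ∈ M.cell T) : M.piecewise p x = p T x := by
  rw [piecewise, Finset.sum_eq_single T, indicator_of_mem hx]
  · intro S _ hne
    exact indicator_of_notMem (fun h => (M.cell_disjoint hne).le_bot ⟨h, hx⟩) _
  · simp

lemma piecewise_of_notMem (p : M.Cell → Space (m + 1) → ℝ) {x : Space (m + 1)}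
    (hx : ∀ T, x ∉ M.cell T) : M.piecewise p x = 0 :=
  Finset.sum_eq_zero fun T _ => indicator_of_notMem (hx T) _

lemma measurable_piecewise {p : M.Cell → Space (m + 1) → ℝ} (hp : ∀ T, Continuous (p T)) :
    Measurable (M.piecewise p) :=
  Finset.measurable_fun_sum _ fun T _ =>
    (hp T).measurable.indicator (M.isOpen_cell T).measurableSet

lemma exists_bound_piecewise {p : M.Cell → Space (m + 1) → ℝ} (hp : ∀ T, Continuous (p T)) :
    ∃ C : ℝ, ∀ x, |M.piecewise p x| ≤ C := by
  choose C hC using fun T => (M.isBounded_cell T).isCompact_closure.exists_bound_of_continuousOn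
    (hp T).continuousOn
  refine ⟨∑ T, |C T|, fun x => ?_⟩
  by_cases hx : ∃ T, x ∈ M.cell T
  · obtain ⟨T, hT⟩ := hx
    rw [M.piecewise_of_mem p hT]
    exact ((hC T x (subset_closure hT)).trans (le_abs_self _)).trans
      (Finset.single_le_sum (f := fun T => |C T|) (fun T _ => abs_nonneg _) (Finset.mem_univ T))
  · rw [M.piecewise_of_notMem p fun T hT => hx ⟨T, hT⟩, abs_zero]
    exact Finset.sum_nonneg fun T _ => abs_nonneg _

/-- Almost every point of the domain lies in a cell. -/
lemma ae_exists_mem_cell : ∀ᵐ x ∂volume.restrict Ω, ∃ T, x ∈ M.cell T := by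
  have h0 : volume (⋃ T, frontier (M.cell T)) = 0 :=
    measure_iUnion_null_iff.2 M.volume_frontier_cell
  have h1 : Ω ⊆ closure Ω := subset_closure
  rw [M.cover] at h1
  have h2 : MeasurableSet (⋃ T, M.cell T) :=
    MeasurableSet.iUnion fun T => (M.isOpen_cell T).measurableSet
  have h4 : ∀ᵐ x ∂volume.restrict Ω, x ∈ ⋃ T, M.cell T := by
    have h3 : {x | x ∉ ⋃ T, M.cell T} = (⋃ T, M.cell T)ᶜ := rfl
    rw [ae_iff, h3, Measure.restrict_apply h2.compl]
    refine measure_mono_null ?_ h0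
    rintro x ⟨hx, hxΩ⟩
    obtain ⟨T, hT⟩ := mem_iUnion.1 (h1 hxΩ)
    refine mem_iUnion.2 ⟨T, ?_⟩
    rw [(M.isOpen_cell T).frontier_eq]
    exact ⟨hT, fun h => hx (mem_iUnion.2 ⟨T, h⟩)⟩
  filter_upwards [h4] with x hx
  exact mem_iUnion.1 hx

lemma setIntegral_piecewise_mul {p : M.Cell → Space (m + 1) → ℝ} (hp : ∀ T, Continuous (p T))
    {g : Space (m + 1) → ℝ} (hg : Continuous g) {S : Set (Space (m + 1))}
    (hS : ∀ T, M.cell T ⊆ S) :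
    ∫ x in S, M.piecewise p x * g x = ∑ T, ∫ x in M.cell T, p T x * g x := by
  have h : ∀ x, M.piecewise p x * g x = ∑ T, (M.cell T).indicator (fun x => p T x * g x) x := by
    intro x
    rw [piecewise, Finset.sum_mul]
    refine Finset.sum_congr rfl fun T _ => ?_
    by_cases hx : x ∈ M.cell T <;> simp [hx]
  simp only [h]
  have hm := fun T => (M.isOpen_cell T).measurableSet
  rw [integral_finsetSum]
  · refine Finset.sum_congr rfl fun T _ => ?_
    rw [setIntegral_indicator (hm T), inter_eq_right.2 (hS T)]
  · intro T _
    exact ((M.integrableOn_cell ((hp T).mul hg) T).integrable_indicator (hm T)).integrableOn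

/-- Integration by parts for a piecewise smooth function that is continuous across the faces, when
the boundary terms on the boundary of the domain vanish. -/
theorem sum_integral_mul_fderiv (hΩ : IsOpen Ω) {p : M.Cell → Space (m + 1) → ℝ}
    (hp : ∀ T, ContDiff ℝ 1 (p T)) {φ : Space (m + 1) → ℝ} (hφ : ContDiff ℝ 1 φ)
    (hcont : ∀ e T T', M.face e ⊆ frontier (M.cell T) → M.face e ⊆ frontier (M.cell T') →
      ∀ x ∈ M.face e, p T x = p T' x)
    (hbd : ∀ e T, M.face e ⊆ frontier (M.cell T) → M.face e ⊆ frontier Ω →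
      ∀ x ∈ M.face e, p T x * φ x = 0) (v : Space (m + 1)) :
    ∑ T, ∫ x in M.cell T, p T x * fderiv ℝ φ x v =
      -∑ T, ∫ x in M.cell T, fderiv ℝ (p T) x v * φ x := by
  classical
  have hD : ∀ T x, fderiv ℝ (fun x => p T x * φ x) x v =
      p T x * fderiv ℝ φ x v + fderiv ℝ (p T) x v * φ x := by
    intro T x
    rw [fderiv_fun_mul ((hp T).differentiable one_ne_zero x) (hφ.differentiable one_ne_zero x)]
    simp only [add_apply, smul_apply, smul_eq_mul]
    ring
  have hφ' : Continuous fun x => fderiv ℝ φ x v :=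
    (hφ.continuous_fderiv one_ne_zero).clm_apply continuous_const
  have hp' : ∀ T, Continuous fun x => fderiv ℝ (p T) x v := fun T =>
    ((hp T).continuous_fderiv one_ne_zero).clm_apply continuous_const
  have i1 : ∀ T, IntegrableOn (fun x => p T x * fderiv ℝ φ x v) (M.cell T) := fun T =>
    M.integrableOn_cell ((hp T).continuous.mul hφ') T
  have i2 : ∀ T, IntegrableOn (fun x => fderiv ℝ (p T) x v * φ x) (M.cell T) := fun T =>
    M.integrableOn_cell ((hp' T).mul hφ.continuous) T
  rw [eq_neg_iff_add_eq_zero, ← Finset.sum_add_distrib]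
  have h1 : ∀ T, (∫ x in M.cell T, p T x * fderiv ℝ φ x v) +
      ∫ x in M.cell T, fderiv ℝ (p T) x v * φ x =
      ∑ e, if M.face e ⊆ frontier (M.cell T) then inner ℝ (M.normal T e) v *
        ∫ x in M.face e, p T x * φ x ∂Measure.euclideanHausdorffMeasure m else 0 := by
    intro T
    rw [← integral_add (i1 T) (i2 T), ← Finset.sum_filter,
      ← M.integral_cell_fderiv T v ((hp T).mul hφ)]
    exact integral_congr_ae (ae_of_all _ fun x => (hD T x).symm)
  simp only [h1]
  rw [Finset.sum_comm]
  refine Finset.sum_eq_zero fun e _ => ?_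
  rw [← Finset.sum_filter]
  rcases M.sum_normal_eq_zero_or hΩ e with hn | hb
  · obtain ⟨T₀, hT₀⟩ := M.face_used e
    have h2 : ∀ T ∈ Finset.univ.filter (fun T => M.face e ⊆ frontier (M.cell T)),
        inner ℝ (M.normal T e) v *
          ∫ x in M.face e, p T x * φ x ∂Measure.euclideanHausdorffMeasure m =
        inner ℝ (M.normal T e) v *
          ∫ x in M.face e, p T₀ x * φ x ∂Measure.euclideanHausdorffMeasure m := by
      intro T hT
      congr 1
      refine setIntegral_congr_fun (M.measurableSet_face e) fun x hx => ?_
      simp only [hcont e T T₀ (Finset.mem_filter.1 hT).2 hT₀ x hx]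
    rw [Finset.sum_congr rfl h2, ← Finset.sum_mul, ← sum_inner, hn, inner_zero_left, zero_mul]
  · refine Finset.sum_eq_zero fun T hT => ?_
    rw [setIntegral_eq_zero_of_forall_eq_zero (hbd e T (Finset.mem_filter.1 hT).2 hb), mul_zero]

end

end PolyMesh

/-! ### Approximation by test functions in `H¹` -/

/-- A domain with Lipschitz boundary does not lie on both sides of its boundary. -/
lemma compl_subset_closure_compl_closure {n : ℕ} {Ω : Set (Space n)} (hΩ : IsOpen Ω)
    (hL : HasLipschitzBoundary Ω) : Ωᶜ ⊆ closure (closure Ω)ᶜ := by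
  intro x hx
  by_cases hxc : x ∈ closure Ω
  swap
  · exact subset_closure hxc
  obtain ⟨ν, K, g, hν, hg, hloc⟩ := hL x (by rw [hΩ.frontier_eq]; exact ⟨hxc, hx⟩)
  have hx0 : inner ℝ ν x ≤ g (x - inner ℝ ν x • ν) := by
    by_contra! h
    exact hx (hloc.self_of_nhds.2 h)
  refine mem_closure_of_tendsto (tendsto_add_smul x (-ν)) ?_
  filter_upwards [(tendsto_add_smul x (-ν)).eventually (eventually_eventually_nhds.2 hloc),
    self_mem_nhdsWithin] with t ht htpos
  have htpos : 0 < t := htpos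
  have hin : inner ℝ ν (x + t • -ν) = inner ℝ ν x - t := by
    rw [inner_add_right, inner_smul_right, inner_neg_right, real_inner_self_eq_norm_sq, hν]
    ring
  have hproj : x + t • -ν - (inner ℝ ν x - t) • ν = x - inner ℝ ν x • ν := by
    rw [sub_smul, smul_neg]
    abel
  have hopen : ∀ᶠ y in 𝓝 (x + t • -ν), inner ℝ ν y < g (y - inner ℝ ν y • ν) := by
    refine ContinuousAt.eventually_lt (by fun_prop) ?_ ?_
    · exact (hg.continuous.comp (by fun_prop : Continuous fun y => y - inner ℝ ν y • ν)).continuousAt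
    · rw [hin, hproj]
      linarith
  rw [mem_compl_iff, mem_closure_iff_frequently, not_frequently]
  filter_upwards [ht, hopen] with y h1 h2 h3
  exact absurd (h1.1 h3) (not_lt.2 h2.le)

section Mollify

open Convolution ContinuousLinearMap

/-- Mollification by the normalized bump function `ρ`. -/
def mollify {n : ℕ} (ρ : ContDiffBump (0 : Space n)) (u : Space n → ℝ) : Space n → ℝ :=
  ρ.normed volume ⋆[lsmul ℝ ℝ, volume] u

variable {n : ℕ} (ρ : ContDiffBump (0 : Space n)) {u : Space n → ℝ}

lemma contDiff_mollify (hu : LocallyIntegrable u) : ContDiff ℝ ∞ (mollify ρ u) :=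
  ρ.hasCompactSupport_normed.contDiff_convolution_left _ ρ.contDiff_normed hu

lemma abs_mollify_le (hu : AEStronglyMeasurable u volume) {C : ℝ} (hC0 : 0 ≤ C)
    (hC : ∀ x, |u x| ≤ C) (x : Space n) : |mollify ρ u x| ≤ C := by
  have := dist_convolution_le (μ := volume) (x₀ := x) (z₀ := (0 : ℝ)) hC0
    ρ.support_normed_eq.subset (fun x => ρ.nonneg_normed (μ := volume) x) ρ.integral_normed hu
    (fun y _ => by simpa using hC y)
  simpa [mollify] using this

/-- Mollification commutes with weak derivatives. -/
lemma fderiv_mollify (hu : LocallyIntegrable u) {g : Space n → ℝ} {v : Space n}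
    (hg : ∀ ψ : Space n → ℝ, ContDiff ℝ ∞ ψ → HasCompactSupport ψ →
      ∫ x, u x * fderiv ℝ ψ x v = -∫ x, g x * ψ x) (x : Space n) :
    fderiv ℝ (mollify ρ u) x v = mollify ρ g x := by
  set r := ρ.normed (volume : Measure (Space n)) with hr
  have hrc : ContDiff ℝ ∞ r := ρ.contDiff_normed
  have hr1 : ContDiff ℝ 1 r := ρ.contDiff_normed
  have hrs : HasCompactSupport r := ρ.hasCompactSupport_normed
  have h1 : mollify ρ u = u ⋆[(lsmul ℝ ℝ).flip, volume] r := (convolution_flip _).symm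
  have h2 := (hrs.hasFDerivAt_convolution_right (lsmul ℝ ℝ).flip hu hr1 x).fderiv
  rw [h1, h2, convolution_precompR_apply _ hu (hrs.fderiv ℝ) (hr1.continuous_fderiv one_ne_zero)]
  have h3 : ∀ s, fderiv ℝ (fun s => r (x - s)) s v = -fderiv ℝ r (x - s) v := by
    intro s
    have h : HasFDerivAt (fun s => r (x - s))
        ((fderiv ℝ r (x - s)).comp (-ContinuousLinearMap.id ℝ _)) s :=
      (hr1.differentiable one_ne_zero _).hasFDerivAt.comp s ((hasFDerivAt_id s).const_sub x)
    rw [h.fderiv]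
    simp
  have h4 := hg (fun s => r (x - s)) (hrc.comp (contDiff_const.sub contDiff_id))
    (hrs.comp_homeomorph (Homeomorph.subLeft x))
  simp only [h3, mul_neg, integral_neg, neg_inj] at h4
  rw [mollify, convolution_lsmul_swap]
  simp only [convolution_def, flip_apply, lsmul_apply, smul_eq_mul]
  calc _ = ∫ s, u s * fderiv ℝ r (x - s) v := by
        congr 1; funext s; ring
    _ = ∫ s, g s * r (x - s) := h4
    _ = _ := by congr 1; funext s; rw [mul_comm]

end Mollify

/-- Dominated convergence in `L²` for uniformly bounded functions on a space of finite measure. -/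
lemma tendsto_eLpNorm_two_zero {α : Type*} [MeasurableSpace α] {μ : Measure α} [IsFiniteMeasure μ]
    {F : ℕ → α → ℝ} (hF : ∀ k, AEStronglyMeasurable (F k) μ) {C : ℝ} (hC : ∀ k x, |F k x| ≤ C)
    (hlim : ∀ᵐ x ∂μ, Tendsto (fun k => F k x) atTop (𝓝 0)) :
    Tendsto (fun k => eLpNorm (F k) 2 μ) atTop (𝓝 0) := by
  have h1 : ∀ k, eLpNorm (F k) 2 μ = (∫⁻ x, ‖F k x‖ₑ ^ (2 : ℝ) ∂μ) ^ (1 / (2 : ℝ)) := by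
    intro k
    rw [eLpNorm_eq_lintegral_rpow_enorm_toReal two_ne_zero ENNReal.ofNat_ne_top]
    simp
  simp only [h1]
  have h2 : Tendsto (fun k => ∫⁻ x, ‖F k x‖ₑ ^ (2 : ℝ) ∂μ) atTop (𝓝 (∫⁻ _, 0 ∂μ)) := by
    refine tendsto_lintegral_of_dominated_convergence' (fun _ => ENNReal.ofReal C ^ (2 : ℝ))
      (fun k => (hF k).enorm.pow_const _) (fun k => ae_of_all _ fun x => ?_) ?_ ?_
    · refine ENNReal.rpow_le_rpow ?_ zero_le_two
      rw [Real.enorm_eq_ofReal_abs]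
      exact ENNReal.ofReal_le_ofReal (hC k x)
    · rw [lintegral_const]
      exact ENNReal.mul_ne_top (ENNReal.rpow_ne_top_of_nonneg zero_le_two ENNReal.ofReal_ne_top)
        (measure_ne_top _ _)
    · filter_upwards [hlim] with x hx
      have h3 := (ENNReal.continuous_rpow_const (y := (2 : ℝ))).tendsto _ |>.comp hx.enorm
      simpa [Function.comp_def] using h3
  have h4 := (ENNReal.continuous_rpow_const (y := 1 / (2 : ℝ))).tendsto _ |>.comp h2
  simpa [Function.comp_def] using h4

/-- A smooth approximation of the identity that vanishes on `[-ε, ε]`. -/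
def softThreshold (ε t : ℝ) : ℝ := t * Real.smoothTransition (t ^ 2 / ε ^ 2 - 1)

lemma contDiff_softThreshold (ε : ℝ) : ContDiff ℝ ∞ (softThreshold ε) :=
  contDiff_id.mul (Real.smoothTransition.contDiff.comp
    (((contDiff_id.pow 2).div_const _).sub contDiff_const))

lemma softThreshold_of_le {ε t : ℝ} (hε : 0 < ε) (ht : |t| ≤ ε) : softThreshold ε t = 0 := by
  rw [softThreshold, Real.smoothTransition.zero_of_nonpos, mul_zero]
  rw [sub_nonpos, div_le_one (by positivity)]
  exact sq_le_sq' (abs_le.1 ht).1 (abs_le.1 ht).2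

lemma softThreshold_of_two_mul_le {ε t : ℝ} (hε : 0 < ε) (ht : 2 * ε ≤ |t|) :
    softThreshold ε t = t := by
  rw [softThreshold, Real.smoothTransition.one_of_one_le, mul_one]
  have h1 : 2 ≤ t ^ 2 / ε ^ 2 := by
    rw [le_div_iff₀ (by positivity), ← sq_abs t]
    nlinarith
  linarith

lemma abs_softThreshold_sub_le {ε : ℝ} (hε : 0 < ε) (t : ℝ) : |softThreshold ε t - t| ≤ 2 * ε := by
  rcases le_total (2 * ε) |t| with h | h
  · rw [softThreshold_of_two_mul_le hε h, sub_self, abs_zero]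
    positivity
  · have h1 := Real.smoothTransition.nonneg (t ^ 2 / ε ^ 2 - 1)
    have h2 := Real.smoothTransition.le_one (t ^ 2 / ε ^ 2 - 1)
    rw [softThreshold, ← mul_sub_one, abs_mul]
    refine (mul_le_of_le_one_right (abs_nonneg t) ?_).trans h
    rw [abs_le]
    constructor <;> linarith

lemma exists_bound_deriv_softThreshold :
    ∃ C : ℝ, 0 ≤ C ∧ ∀ ε > 0, ∀ t, |deriv (softThreshold ε) t| ≤ C := by
  obtain ⟨K, hK0, hK⟩ := exists_bound_deriv_smoothTransition
  refine ⟨1 + 8 * K, by positivity, fun ε hε t => ?_⟩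
  have h1 : HasDerivAt (fun t : ℝ => t ^ 2 / ε ^ 2 - 1) (2 * t / ε ^ 2) t := by
    simpa using (((hasDerivAt_id t).pow 2).div_const (ε ^ 2)).sub_const 1
  have h2 : HasDerivAt Real.smoothTransition (deriv Real.smoothTransition (t ^ 2 / ε ^ 2 - 1))
      (t ^ 2 / ε ^ 2 - 1) :=
    ((Real.smoothTransition.contDiff (n := 1)).differentiable one_ne_zero _).hasDerivAt
  have h2' : HasDerivAt (Real.smoothTransition ∘ fun t : ℝ => t ^ 2 / ε ^ 2 - 1)
      (deriv Real.smoothTransition (t ^ 2 / ε ^ 2 - 1) * (2 * t / ε ^ 2)) t := h2.comp t h1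
  have h3 : HasDerivAt (softThreshold ε) (1 * Real.smoothTransition (t ^ 2 / ε ^ 2 - 1) +
      t * (deriv Real.smoothTransition (t ^ 2 / ε ^ 2 - 1) * (2 * t / ε ^ 2))) t :=
    (hasDerivAt_id t).mul h2'
  rw [h3.deriv]
  refine (abs_add_le _ _).trans (add_le_add ?_ ?_)
  · rw [one_mul, abs_of_nonneg (Real.smoothTransition.nonneg _)]
    exact Real.smoothTransition.le_one _
  · rcases le_or_gt (t ^ 2 / ε ^ 2) 2 with h | h
    · have h4 : t * (deriv Real.smoothTransition (t ^ 2 / ε ^ 2 - 1) * (2 * t / ε ^ 2)) =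
          deriv Real.smoothTransition (t ^ 2 / ε ^ 2 - 1) * (2 * (t ^ 2 / ε ^ 2)) := by ring
      have h5 : 0 ≤ t ^ 2 / ε ^ 2 := by positivity
      rw [h4, abs_mul, abs_of_nonneg (by positivity : 0 ≤ 2 * (t ^ 2 / ε ^ 2))]
      nlinarith [hK (t ^ 2 / ε ^ 2 - 1), abs_nonneg (deriv Real.smoothTransition (t ^ 2 / ε ^ 2 - 1))]
    · rw [deriv_smoothTransition_eq_zero (Or.inr (by linarith))]
      simpa using hK0

lemma deriv_softThreshold_of_two_mul_lt {ε t : ℝ} (hε : 0 < ε) (ht : 2 * ε < |t|) :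
    deriv (softThreshold ε) t = 1 := by
  have : softThreshold ε =ᶠ[𝓝 t] fun t => t := by
    filter_upwards [continuousAt_const.eventually_lt continuous_abs.continuousAt ht] with s hs
    exact softThreshold_of_two_mul_le hε hs.le
  rw [this.deriv_eq, deriv_id'']

/-- A function on `ℝⁿ` with bounded weak gradient that vanishes off `Ω` belongs to `H¹₀(Ω)`. Such a
function has a Lipschitz representative, which vanishes on the boundary. Mollifying it and cutting
off the small values gives the test functions. The gradient has to vanish almost everywhere on the
zero set; for piecewise smooth functions this is easy to see. -/
theorem exists_tendsto_testFunction {n : ℕ} {Ω : Set (Space n)}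
    (hb : Bornology.IsBounded Ω) (hside : Ωᶜ ⊆ closure (closure Ω)ᶜ)
    {u : Space n → ℝ} {G : Fin n → Space n → ℝ} (hu : Measurable u) (hG : ∀ i, Measurable (G i))
    {C : ℝ} (hC0 : 0 ≤ C) (huC : ∀ x, |u x| ≤ C) (hGC : ∀ i x, |G i x| ≤ C)
    (hu0 : ∀ x ∉ Ω, u x = 0)
    (hweak : ∀ i, ∀ ψ : Space n → ℝ, ContDiff ℝ ∞ ψ → HasCompactSupport ψ →
      ∫ x, u x * partialDeriv i ψ x = -∫ x, G i x * ψ x)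
    (hzero : ∀ i, ∀ᵐ x, u x = 0 → G i x = 0) :
    ∃ φ : ℕ → Space n → ℝ, (∀ k, IsTestFunction Ω (φ k)) ∧
      Tendsto (fun k => eLpNorm (u - φ k) 2 (volume.restrict Ω)) atTop (𝓝 0) ∧
      ∀ i, Tendsto (fun k => eLpNorm (G i - partialDeriv i (φ k)) 2 (volume.restrict Ω))
        atTop (𝓝 0) := by
  have hloc : ∀ {g : Space n → ℝ}, Measurable g → (∀ x, |g x| ≤ C) → LocallyIntegrable g := by
    intro g hg hgC
    refine (locallyIntegrable_const C).mono hg.aestronglyMeasurable (ae_of_all _ fun x => ?_)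
    rw [Real.norm_eq_abs, Real.norm_of_nonneg hC0]
    exact hgC x
  have huL := hloc hu huC
  have hGL := fun i => hloc (hG i) (hGC i)
  -- mollification
  let r : ℕ → ℝ := fun k => 1 / ((k : ℝ) + 1)
  have hr : ∀ k, 0 < r k := fun k => Nat.one_div_pos_of_nat
  have hrlim : Tendsto r atTop (𝓝 0) := tendsto_one_div_add_atTop_nhds_zero_nat
  let ρ : ℕ → ContDiffBump (0 : Space n) := fun k =>
    ⟨r k / 2, r k, half_pos (hr k), half_lt_self (hr k)⟩
  have hρlim : Tendsto (fun k => (ρ k).rOut) atTop (𝓝 0) := hrlim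
  have hρrat : ∀ᶠ k in atTop, (ρ k).rOut ≤ 2 * (ρ k).rIn := Eventually.of_forall fun k => by
    change r k ≤ 2 * (r k / 2)
    linarith
  let U : ℕ → Space n → ℝ := fun k => mollify (ρ k) u
  have hUc : ∀ k, ContDiff ℝ ∞ (U k) := fun k => contDiff_mollify _ huL
  have hUd : ∀ k x i, fderiv ℝ (U k) x (EuclideanSpace.single i 1) = mollify (ρ k) (G i) x :=
    fun k x i => fderiv_mollify (ρ k) huL (hweak i) x
  have hUG : ∀ k x i, |mollify (ρ k) (G i) x| ≤ C := fun k x i =>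
    abs_mollify_le _ (hG i).aestronglyMeasurable hC0 (hGC i) x
  have hUlim : ∀ᵐ x, Tendsto (fun k => U k x) atTop (𝓝 (u x)) :=
    ContDiffBump.ae_convolution_tendsto_right_of_locallyIntegrable hρlim hρrat huL
  have hGlim : ∀ i, ∀ᵐ x, Tendsto (fun k => mollify (ρ k) (G i) x) atTop (𝓝 (G i x)) := fun i =>
    ContDiffBump.ae_convolution_tendsto_right_of_locallyIntegrable hρlim hρrat (hGL i)
  -- the mollifications are uniformly Lipschitz
  let L : NNReal := ⟨n * C, by positivity⟩
  have hUlip : ∀ k, LipschitzWith L (U k) := by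
    intro k
    refine lipschitzWith_of_nnnorm_fderiv_le ((hUc k).differentiable (by simp)) fun x => ?_
    rw [← NNReal.coe_le_coe]
    refine ContinuousLinearMap.opNorm_le_bound _ L.2 fun w => ?_
    have hw : w = ∑ i, w i • EuclideanSpace.single i (1 : ℝ) := by
      conv_lhs => rw [← (EuclideanSpace.basisFun (Fin n) ℝ).sum_repr w]
      simp
    have hw' : fderiv ℝ (U k) x w = ∑ i, w i * mollify (ρ k) (G i) x := by
      conv_lhs => rw [hw]
      simp [map_sum, hUd]
    rw [hw', Real.norm_eq_abs]
    calc |∑ i, w i * mollify (ρ k) (G i) x| ≤ ∑ i : Fin n, |w i * mollify (ρ k) (G i) x| :=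
          Finset.abs_sum_le_sum_abs _ _
      _ ≤ ∑ _i : Fin n, ‖w‖ * C := by
          refine Finset.sum_le_sum fun i _ => ?_
          rw [abs_mul]
          exact mul_le_mul (PiLp.norm_apply_le w i) (hUG k x i) (abs_nonneg _) (norm_nonneg _)
      _ = L * ‖w‖ := by
          rw [Finset.sum_const, Finset.card_univ, Fintype.card_fin, nsmul_eq_mul]
          change _ = (n * C) * ‖w‖
          ring
  -- the Lipschitz representative
  obtain ⟨w, hw, hwu⟩ : ∃ w : Space n → ℝ, LipschitzWith L w ∧ u =ᵐ[volume] w := by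
    have hlip : LipschitzOnWith L u {x | Tendsto (fun k => U k x) atTop (𝓝 (u x))} := by
      refine LipschitzOnWith.of_dist_le_mul fun x hx y hy => ?_
      exact le_of_tendsto ((mem_ofPred.1 hx).dist (mem_ofPred.1 hy))
        (Eventually.of_forall fun k => (hUlip k).dist_le_mul x y)
    obtain ⟨w, hw, hwu⟩ := hlip.extend_real
    refine ⟨w, hw, ?_⟩
    filter_upwards [hUlim] with x hx
    exact hwu hx
  have hw0 : ∀ x ∉ Ω, w x = 0 := by
    have h1 : EqOn w 0 (closure Ω)ᶜ := by
      refine Measure.eqOn_open_of_ae_eq (μ := volume) ?_ isClosed_closure.isOpen_compl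
        hw.continuous.continuousOn continuousOn_const
      filter_upwards [ae_restrict_of_ae hwu,
        ae_restrict_mem isClosed_closure.isOpen_compl.measurableSet] with x h1 h2
      rw [← h1, hu0 x fun h => h2 (subset_closure h)]
      rfl
    intro x hx
    exact (h1.closure hw.continuous continuous_const) (hside hx)
  have hUw : ∀ k, U k = mollify (ρ k) w := fun k => convolution_congr _ (ae_eq_refl _) hwu
  have hUsmall : ∀ k, ∀ x ∉ Ω, |U k x| ≤ L * r k := by
    intro k x hx
    have := (ρ k).dist_normed_convolution_le (μ := volume) (x₀ := x) (ε := L * r k)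
      hw.continuous.aestronglyMeasurable (fun y hy => (hw.dist_le_mul y x).trans
        (mul_le_mul_of_nonneg_left (Metric.mem_ball.1 hy).le L.2))
    rw [hw0 x hx, Real.dist_eq, sub_zero] at this
    rw [hUw]
    exact this
  -- cutting off
  let ε : ℕ → ℝ := fun k => (L + 1) * r k
  have hL1 : (0 : ℝ) < L + 1 := by have := L.2; positivity
  have hε : ∀ k, 0 < ε k := fun k => mul_pos hL1 (hr k)
  have hεlim : Tendsto ε atTop (𝓝 0) := by simpa using hrlim.const_mul ((L : ℝ) + 1)
  obtain ⟨K, hK0, hK⟩ := exists_bound_deriv_softThreshold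
  let φ : ℕ → Space n → ℝ := fun k x => softThreshold (ε k) (U k x)
  have hφc : ∀ k, ContDiff ℝ ∞ (φ k) := fun k => (contDiff_softThreshold _).comp (hUc k)
  have hφd : ∀ k i x, partialDeriv i (φ k) x =
      deriv (softThreshold (ε k)) (U k x) * mollify (ρ k) (G i) x := by
    intro k i x
    have h1 : HasDerivAt (softThreshold (ε k)) (deriv (softThreshold (ε k)) (U k x)) (U k x) :=
      ((contDiff_softThreshold (ε k)).differentiable (by simp) _).hasDerivAt
    have h2 : HasFDerivAt (φ k) _ x :=
      h1.comp_hasFDerivAt x ((hUc k).differentiable (by simp) x).hasFDerivAt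
    rw [partialDeriv, h2.fderiv, smul_apply, smul_eq_mul, hUd]
  have hsupp : ∀ k, tsupport (φ k) ⊆ Ω := by
    intro k
    have hcl : IsClosed {x | ε k ≤ |U k x|} :=
      isClosed_le continuous_const (hUc k).continuous.abs
    have h1 : tsupport (φ k) ⊆ {x | ε k ≤ |U k x|} := by
      refine closure_minimal (fun x hx => ?_) hcl
      by_contra h
      exact hx (softThreshold_of_le (hε k) (not_le.1 h).le)
    intro x hx
    by_contra hxΩ
    have h2 : ε k ≤ |U k x| := h1 hx
    have h3 := hUsmall k x hxΩ
    have h4 : ε k = L * r k + r k := by simp only [ε]; ring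
    linarith [hr k]
  have : IsFiniteMeasure (volume.restrict Ω) := ⟨by
    rw [Measure.restrict_apply_univ]
    exact hb.measure_lt_top⟩
  have hUC : ∀ k x, |U k x| ≤ C := fun k x =>
    abs_mollify_le _ hu.aestronglyMeasurable hC0 huC x
  have hr1 : ∀ k, r k ≤ 1 := fun k => by
    simp only [r]
    rw [div_le_one (by positivity)]
    have : (0 : ℝ) ≤ k := Nat.cast_nonneg k
    linarith
  refine ⟨φ, fun k => ⟨hφc k, ?_, hsupp k⟩, ?_, fun i => ?_⟩
  · exact HasCompactSupport.of_support_subset_isCompact hb.isCompact_closure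
      (subset_closure.trans ((hsupp k).trans subset_closure))
  · refine tendsto_eLpNorm_two_zero
      (fun k => (hu.sub (hφc k).continuous.measurable).aestronglyMeasurable)
      (C := C + (C + 2 * (L + 1))) (fun k x => ?_) ?_
    · refine (abs_sub _ _).trans (add_le_add (huC x) ?_)
      have h1 : φ k x = U k x + (softThreshold (ε k) (U k x) - U k x) := by simp [φ]
      rw [h1]
      refine (abs_add_le _ _).trans (add_le_add (hUC k x) ?_)
      refine (abs_softThreshold_sub_le (hε k) _).trans ?_
      have : ε k ≤ (L + 1) * 1 := mul_le_mul_of_nonneg_left (hr1 k) hL1.le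
      linarith
    · filter_upwards [ae_restrict_of_ae hUlim] with x hx
      have h1 : Tendsto (fun k => φ k x - U k x) atTop (𝓝 0) :=
        squeeze_zero_norm (fun k => abs_softThreshold_sub_le (hε k) (U k x))
          (by simpa using hεlim.const_mul 2)
      have h2 := (h1.add hx).const_sub (u x)
      simpa using h2
  · refine tendsto_eLpNorm_two_zero (C := C + K * C) (fun k => ?_) (fun k x => ?_) ?_
    · refine ((hG i).aestronglyMeasurable.sub (Continuous.aestronglyMeasurable ?_))
      exact ((hφc k).continuous_fderiv (by simp)).clm_apply continuous_const
    · refine (abs_sub _ _).trans (add_le_add (hGC i x) ?_)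
      rw [hφd, abs_mul]
      exact mul_le_mul (hK _ (hε k) _) (hUG k x i) (abs_nonneg _) hK0
    · filter_upwards [ae_restrict_of_ae hUlim, ae_restrict_of_ae (hGlim i),
        ae_restrict_of_ae (hzero i)] with x h1 h2 h3
      have h4 : Tendsto (fun k => partialDeriv i (φ k) x) atTop (𝓝 (G i x)) := by
        simp only [hφd]
        by_cases hx : u x = 0
        · rw [h3 hx] at h2 ⊢
          refine squeeze_zero_norm (a := fun k => K * |mollify (ρ k) (G i) x|) (fun k => ?_)
            (by simpa using h2.abs.const_mul K)
          rw [Real.norm_eq_abs, abs_mul]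
          exact mul_le_mul_of_nonneg_right (hK _ (hε k) _) (abs_nonneg _)
        · refine h2.congr' ?_
          have h5 : ∀ᶠ k in atTop, 2 * ε k < |U k x| :=
            (by simpa using hεlim.const_mul 2 : Tendsto (fun k => 2 * ε k) atTop (𝓝 0)).eventually_lt
              h1.abs (abs_pos.2 hx)
          filter_upwards [h5] with k hk
          rw [deriv_softThreshold_of_two_mul_lt (hε k) hk, one_mul]
      simpa using h4.const_sub (G i x)

/-! ### Polynomials on `ℝⁿ` -/

section polynomials

variable {n : ℕ}

lemma polyEval_zero (x : Space n) : polyEval 0 x = 0 := by simp [polyEval]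

lemma polyEval_add (p q : MvPolynomial (Fin n) ℝ) (x : Space n) :
    polyEval (p + q) x = polyEval p x + polyEval q x := by simp [polyEval]

lemma polyEval_sub (p q : MvPolynomial (Fin n) ℝ) (x : Space n) :
    polyEval (p - q) x = polyEval p x - polyEval q x := by simp [polyEval]

lemma polyEval_smul (c : ℝ) (p : MvPolynomial (Fin n) ℝ) (x : Space n) :
    polyEval (c • p) x = c * polyEval p x := by simp [polyEval, MvPolynomial.smul_eval]

lemma contDiff_polyEval (p : MvPolynomial (Fin n) ℝ) : ContDiff ℝ ∞ (polyEval p) := by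
  induction p using MvPolynomial.induction_on with
  | C c =>
    have : polyEval (MvPolynomial.C c) = fun _ : Space n => c := by
      funext x
      simp [polyEval]
    rw [this]
    exact contDiff_const
  | add p q hp hq =>
    have : polyEval (p + q) = fun x => polyEval p x + polyEval q x := funext (polyEval_add p q)
    rw [this]
    exact hp.add hq
  | mul_X p i hp =>
    have : polyEval (p * MvPolynomial.X i) = fun x : Space n => polyEval p x * x i := by
      funext x
      simp [polyEval]
    rw [this]
    exact hp.mul (by fun_prop)

lemma contDiff_one_polyEval (p : MvPolynomial (Fin n) ℝ) : ContDiff ℝ 1 (polyEval p) :=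
  (contDiff_polyEval p).of_le (by exact_mod_cast le_top)

lemma continuous_polyEval (p : MvPolynomial (Fin n) ℝ) : Continuous (polyEval p) :=
  (contDiff_polyEval p).continuous

lemma fderiv_polyEval (p : MvPolynomial (Fin n) ℝ) (i : Fin n) (x : Space n) :
    fderiv ℝ (polyEval p) x (EuclideanSpace.single i 1) = polyEval (MvPolynomial.pderiv i p) x := by
  have hd : ∀ q : MvPolynomial (Fin n) ℝ, DifferentiableAt ℝ (polyEval q) x := fun q =>
    (contDiff_one_polyEval q).differentiable one_ne_zero x
  induction p using MvPolynomial.induction_on with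
  | C c =>
    have : polyEval (MvPolynomial.C c) = fun _ : Space n => c := by
      funext x
      simp [polyEval]
    simp [this, polyEval_zero]
  | add p q hp hq =>
    have : polyEval (p + q) = fun x => polyEval p x + polyEval q x := funext (polyEval_add p q)
    rw [this, fderiv_fun_add (hd p) (hd q), add_apply, hp, hq, map_add, polyEval_add]
  | mul_X p j hp =>
    have h1 : polyEval (p * MvPolynomial.X j) = fun x : Space n => polyEval p x * x j := by
      funext x
      simp [polyEval]
    have h2 : HasFDerivAt (fun x : Space n => x j) (EuclideanSpace.proj j : Space n →L[ℝ] ℝ) x :=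
      (EuclideanSpace.proj j : Space n →L[ℝ] ℝ).hasFDerivAt
    rw [h1, fderiv_fun_mul (hd p) h2.differentiableAt, h2.fderiv, add_apply, smul_apply, smul_apply,
      hp, Derivation.leibniz, polyEval_add, MvPolynomial.pderiv_X]
    by_cases hij : i = j
    · subst hij
      simp [polyEval]
    · simp [polyEval, Ne.symm hij]

/-- A polynomial that vanishes on a non-empty open set is zero. -/
lemma eq_zero_of_polyEval_eq_zero {p : MvPolynomial (Fin n) ℝ} {U : Set (Space n)} (hU : IsOpen U)
    (hne : U.Nonempty) (h : ∀ x ∈ U, polyEval p x = 0) : p = 0 := by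
  obtain ⟨x₀, hx₀⟩ := hne
  have hU' : IsOpen (WithLp.toLp 2 ⁻¹' U : Set (Fin n → ℝ)) :=
    hU.preimage (PiLp.continuous_toLp 2 _)
  have h0 := (AnalyticOnNhd.eval_mvPolynomial p).eqOn_zero_of_preconnected_of_eventuallyEq_zero
    isPreconnected_univ (mem_univ (WithLp.ofLp x₀)) (by
      filter_upwards [hU'.mem_nhds hx₀] with y hy using h _ hy)
  exact MvPolynomial.funext fun y => by simpa using h0 (mem_univ y)

lemma pderiv_mem_restrictTotalDegree {p : MvPolynomial (Fin n) ℝ} {k : ℕ} (i : Fin n)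
    (hp : p ∈ MvPolynomial.restrictTotalDegree (Fin n) ℝ k) :
    MvPolynomial.pderiv i p ∈ MvPolynomial.restrictTotalDegree (Fin n) ℝ (k - 1) := by
  rw [MvPolynomial.mem_restrictTotalDegree] at hp ⊢
  conv_lhs => rw [p.as_sum, map_sum]
  refine MvPolynomial.totalDegree_finsetSum_le fun s hs => ?_
  rw [MvPolynomial.pderiv_monomial]
  by_cases hsi : s i = 0
  · simp [hsi]
  refine (MvPolynomial.totalDegree_monomial_le _ _).trans ?_
  have h1 := (MvPolynomial.le_totalDegree hs).trans hp
  have h2 : s = (s - Finsupp.single i 1) + Finsupp.single i 1 := by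
    rw [tsub_add_cancel_of_le]
    rw [Finsupp.single_le_iff]
    omega
  rw [h2, Finsupp.sum_add_index' (by simp) (by simp), Finsupp.sum_single_index rfl] at h1
  change ((s - Finsupp.single i 1).sum fun _ e => e) ≤ k - 1
  omega

lemma pderiv_pderiv_comm (i j : Fin n) (p : MvPolynomial (Fin n) ℝ) :
    MvPolynomial.pderiv i (MvPolynomial.pderiv j p) =
      MvPolynomial.pderiv j (MvPolynomial.pderiv i p) := by
  by_cases hij : i = j
  · rw [hij]
  ext s
  simp only [MvPolynomial.coeff_pderiv, Finsupp.add_apply, Finsupp.single_eq_of_ne hij,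
    Finsupp.single_eq_of_ne (Ne.symm hij), add_zero, add_right_comm s]
  ring

end polynomials

/-- The derivative of a `C¹` function vanishes almost everywhere on its zero set: the other zeros
on each line are isolated. -/
lemma ae_eq_zero_imp_fderiv_eq_zero {n : ℕ} {f : Space n → ℝ} (hf : ContDiff ℝ 1 f) (v : Space n) :
    ∀ᵐ x, f x = 0 → fderiv ℝ f x v = 0 := by
  have hDf : Continuous fun x => fderiv ℝ f x v :=
    (hf.continuous_fderiv one_ne_zero).clm_apply continuous_const
  have hmeas : MeasurableSet {x | f x = 0 → fderiv ℝ f x v = 0} := by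
    have : {x | f x = 0 → fderiv ℝ f x v = 0} = {x | f x = 0}ᶜ ∪ {x | fderiv ℝ f x v = 0} := by
      ext x
      simp only [mem_ofPred, mem_union, mem_compl_iff]
      tauto
    rw [this]
    exact (isClosed_eq hf.continuous continuous_const).measurableSet.compl.union
      (isClosed_eq hDf continuous_const).measurableSet
  refine ae_mem_of_ae_add_linearMap_mem (LinearMap.toSpanSingleton ℝ (Space n) v) volume volume
    hmeas fun y => ?_
  let g : ℝ → ℝ := fun t => f (y + t • v)
  let S : Set ℝ := {t | g t = 0 ∧ fderiv ℝ f (y + t • v) v ≠ 0}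
  have hg : ∀ t, HasDerivAt g (fderiv ℝ f (y + t • v) v) t := by
    intro t
    have h1 : HasDerivAt (fun t : ℝ => y + t • v) v t := by
      simpa using ((hasDerivAt_id t).smul_const v).const_add y
    exact (hf.differentiable one_ne_zero _).hasFDerivAt.comp_hasDerivAt t h1
  have hdisc : DiscreteTopology S := by
    rw [discreteTopology_subtype_iff]
    rintro t ⟨ht0, ht1⟩
    rw [← disjoint_iff, disjoint_principal_right]
    filter_upwards [(hg t).eventually_ne (c := 0) ht1] with s hs hsS
    exact hs hsS.1
  have hcount : S.Countable := by
    rw [← countable_coe_iff]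
    exact countable_of_Lindelof_of_discrete
  filter_upwards [measure_eq_zero_iff_ae_notMem.1 (hcount.measure_zero volume)] with t ht h0
  by_contra h1
  exact ht ⟨h0, h1⟩

/-! ### Superposition of strong solutions -/

section strong

variable {n : ℕ} {Ω : Set (Space n)}

lemma IsTestFunction.add {φ ψ : Space n → ℝ} (hφ : IsTestFunction Ω φ) (hψ : IsTestFunction Ω ψ) :
    IsTestFunction Ω (φ + ψ) where
  smooth := hφ.smooth.add hψ.smooth
  compact := hφ.compact.add hψ.compact
  subset := (tsupport_add φ ψ).trans (union_subset hφ.subset hψ.subset)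

lemma IsTestFunction.memLp {φ : Space n → ℝ} (hφ : IsTestFunction Ω φ) :
    MemLp φ 2 (volume.restrict Ω) :=
  (hφ.smooth.continuous.memLp_of_hasCompactSupport hφ.compact).restrict _

lemma IsTestFunction.continuous_partialDeriv {φ : Space n → ℝ} (hφ : IsTestFunction Ω φ)
    (i : Fin n) : Continuous (partialDeriv i φ) :=
  (hφ.smooth.continuous_fderiv (by simp)).clm_apply continuous_const

lemma IsTestFunction.memLp_partialDeriv {φ : Space n → ℝ} (hφ : IsTestFunction Ω φ) (i : Fin n) :
    MemLp (partialDeriv i φ) 2 (volume.restrict Ω) := by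
  refine ((hφ.continuous_partialDeriv i).memLp_of_hasCompactSupport ?_).restrict _
  exact (hφ.compact.fderiv ℝ).mono' fun x hx => by
    by_contra h
    exact hx (by simp [partialDeriv, image_eq_zero_of_notMem_tsupport h])

lemma partialDeriv_add {φ ψ : Space n → ℝ} (hφ : IsTestFunction Ω φ) (hψ : IsTestFunction Ω ψ)
    (i : Fin n) : partialDeriv i (φ + ψ) = partialDeriv i φ + partialDeriv i ψ := by
  funext x
  rw [partialDeriv, fderiv_add (hφ.smooth.differentiable (by simp) x)
    (hψ.smooth.differentiable (by simp) x)]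
  rfl

lemma IsWeakPartial.add {i : Fin n} {u g w h u' : Space n → ℝ} (hu : MemLp u 2 (volume.restrict Ω))
    (hg : MemLp g 2 (volume.restrict Ω)) (hw : MemLp w 2 (volume.restrict Ω))
    (hh : MemLp h 2 (volume.restrict Ω)) (hug : IsWeakPartial Ω i u g)
    (hwh : IsWeakPartial Ω i w h) (hu' : u' =ᵐ[volume.restrict Ω] u + w) :
    IsWeakPartial Ω i u' (g + h) := by
  intro φ hφ
  have hD := hφ.memLp_partialDeriv i
  have h1 : ∫ x in Ω, u' x * partialDeriv i φ x =
      ∫ x in Ω, (u x * partialDeriv i φ x + w x * partialDeriv i φ x) := by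
    refine integral_congr_ae ?_
    filter_upwards [hu'] with x hx
    rw [hx, Pi.add_apply, add_mul]
  have h2 : ∫ x in Ω, (u x * partialDeriv i φ x + w x * partialDeriv i φ x) =
      (∫ x in Ω, u x * partialDeriv i φ x) + ∫ x in Ω, w x * partialDeriv i φ x :=
    integral_add (hu.integrable_mul hD) (hw.integrable_mul hD)
  have h3 : ∫ x in Ω, (g x * φ x + h x * φ x) = (∫ x in Ω, g x * φ x) + ∫ x in Ω, h x * φ x :=
    integral_add (hg.integrable_mul hφ.memLp) (hh.integrable_mul hφ.memLp)
  rw [h1, h2, hug φ hφ, hwh φ hφ]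
  simp only [Pi.add_apply, add_mul]
  rw [h3, neg_add]

/-- Adding a solution of the homogeneous problem. -/
lemma IsStrongSolution.add {a : Space n → Matrix (Fin n) (Fin n) ℝ} {f u w u' : Space n → ℝ}
    (hu : IsStrongSolution Ω a f u) (hw : IsStrongSolution Ω a (fun _ => 0) w)
    (hu' : u' =ᵐ[volume.restrict Ω] u + w) : IsStrongSolution Ω a f u' := by
  obtain ⟨G, H, hu2, hG, hH, ⟨φ, hφ, hφu, hφG⟩, heq⟩ := hu
  obtain ⟨G', H', hw2, hG', hH', ⟨ψ, hψ, hψw, hψG⟩, heq'⟩ := hw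
  refine ⟨G + G', H + H', (hu2.add hw2).ae_eq hu'.symm, fun i => ?_, fun i j => ?_, ?_, ?_⟩
  · exact ⟨(hG i).1.add (hG' i).1,
      IsWeakPartial.add hu2 (hG i).1 hw2 (hG' i).1 (hG i).2 (hG' i).2 hu'⟩
  · exact ⟨(hH i j).1.add (hH' i j).1, IsWeakPartial.add (hG i).1 (hH i j).1 (hG' i).1 (hH' i j).1
      (hH i j).2 (hH' i j).2 (ae_eq_refl _)⟩
  · refine ⟨fun k => φ k + ψ k, fun k => (hφ k).add (hψ k), ?_, fun i => ?_⟩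
    · refine tendsto_of_tendsto_of_tendsto_of_le_of_le tendsto_const_nhds
        (by simpa using hφu.add hψw) (fun k => zero_le) fun k => ?_
      have h1 : u' - (φ k + ψ k) =ᵐ[volume.restrict Ω] (u - φ k) + (w - ψ k) := by
        filter_upwards [hu'] with x hx
        simp only [Pi.sub_apply, Pi.add_apply, hx]
        ring
      simp only
      rw [eLpNorm_congr_ae h1]
      exact eLpNorm_add_le (hu2.sub (hφ k).memLp).1 (hw2.sub (hψ k).memLp).1 one_le_two
    · refine tendsto_of_tendsto_of_tendsto_of_le_of_le tendsto_const_nhds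
        (by simpa using (hφG i).add (hψG i)) (fun k => zero_le) fun k => ?_
      have h1 : (G + G') i - partialDeriv i (φ k + ψ k) =
          (G i - partialDeriv i (φ k)) + (G' i - partialDeriv i (ψ k)) := by
        rw [partialDeriv_add (hφ k) (hψ k), Pi.add_apply]
        abel
      simp only
      rw [h1]
      exact eLpNorm_add_le ((hG i).1.sub ((hφ k).memLp_partialDeriv i)).1
        ((hG' i).1.sub ((hψ k).memLp_partialDeriv i)).1 one_le_two
  · filter_upwards [heq, heq'] with x h1 h2
    simp only [Pi.add_apply, mul_add, Finset.sum_add_distrib, h1, h2, add_zero]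

/-- When the strong solution is unique, the homogeneous problem has the zero solution only. -/
lemma IsStrongSolution.ae_eq_zero {a : Space n → Matrix (Fin n) (Fin n) ℝ} {f w : Space n → ℝ}
    (huniq : ∃! u : Lp ℝ 2 (volume.restrict Ω), IsStrongSolution Ω a f (u : Space n → ℝ))
    (hw : IsStrongSolution Ω a (fun _ => 0) w) : w =ᵐ[volume.restrict Ω] 0 := by
  obtain ⟨u, hu, hun⟩ := huniq
  have hw2 : MemLp w 2 (volume.restrict Ω) := by
    obtain ⟨G, H, h, -⟩ := hw
    exact h
  have hsum : (u + hw2.toLp w : Lp ℝ 2 (volume.restrict Ω)) =ᵐ[volume.restrict Ω] u + w :=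
    (Lp.coeFn_add _ _).trans ((ae_eq_refl _).add hw2.coeFn_toLp)
  have h1 : hw2.toLp w = 0 := by simpa using hun _ (hu.add hw hsum)
  exact hw2.coeFn_toLp.symm.trans (h1 ▸ Lp.coeFn_zero _ _ _)

end strong

namespace PolyMesh

variable {m : ℕ} {Ω : Set (Space (m + 1))} (M : PolyMesh Ω)

/-! ### Integrals over the boundary of a cell -/

/-- A function on a face that extends to a continuous function on the whole space. -/
def IsRegularOnFace (e : M.Face) (g : M.face e → ℝ) : Prop :=
  ∃ F : Space (m + 1) → ℝ, Continuous F ∧ ∀ x, g x = F x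

section regular

variable {M} {e : M.Face} {g h : M.face e → ℝ}

lemma isRegularOnFace_of_continuous {F : Space (m + 1) → ℝ} (hF : Continuous F) :
    M.IsRegularOnFace e fun x => F x := ⟨F, hF, fun _ => rfl⟩

lemma isRegularOnFace_polyEval (p : MvPolynomial (Fin (m + 1)) ℝ) :
    M.IsRegularOnFace e fun x => polyEval p x :=
  isRegularOnFace_of_continuous (continuous_polyEval p)

lemma isRegularOnFace_const (c : ℝ) : M.IsRegularOnFace e fun _ => c :=
  ⟨fun _ => c, continuous_const, fun _ => rfl⟩

lemma isRegularOnFace_of_mem_polyOn {r : ℕ} (hg : g ∈ polyOn r (M.face e)) :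
    M.IsRegularOnFace e g := by
  obtain ⟨p, -, hp⟩ := hg
  exact ⟨polyEval p, continuous_polyEval p, hp⟩

lemma IsRegularOnFace.sub (hg : M.IsRegularOnFace e g) (hh : M.IsRegularOnFace e h) :
    M.IsRegularOnFace e fun x => g x - h x := by
  obtain ⟨F, hF, hgF⟩ := hg
  obtain ⟨F', hF', hhF⟩ := hh
  exact ⟨_, hF.sub hF', fun x => by simp only [Pi.sub_apply, hgF, hhF]⟩

lemma IsRegularOnFace.mul (hg : M.IsRegularOnFace e g) (hh : M.IsRegularOnFace e h) :
    M.IsRegularOnFace e fun x => g x * h x := by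
  obtain ⟨F, hF, hgF⟩ := hg
  obtain ⟨F', hF', hhF⟩ := hh
  exact ⟨_, hF.mul hF', fun x => by simp only [Pi.mul_apply, hgF, hhF]⟩

lemma isRegularOnFace_sum {ι : Type*} (s : Finset ι) {g : ι → M.face e → ℝ}
    (hg : ∀ i, M.IsRegularOnFace e (g i)) : M.IsRegularOnFace e fun x => ∑ i ∈ s, g i x := by
  choose F hF hgF using hg
  exact ⟨fun x => ∑ i ∈ s, F i x, continuous_finsetSum _ fun i _ => hF i,
    fun x => Finset.sum_congr rfl fun i _ => hgF i x⟩

end regular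

lemma faceIntegral_eq (e : M.Face) {g : M.face e → ℝ} {F : Space (m + 1) → ℝ}
    (h : ∀ x, g x = F x) :
    M.faceIntegral e g = ∫ x in M.face e, F x ∂Measure.euclideanHausdorffMeasure m := by
  rw [faceIntegral, ← integral_subtype_comap (M.measurableSet_face e) F]
  exact integral_congr_ae (ae_of_all _ h)

lemma faceIntegral_add {e : M.Face} {g h : M.face e → ℝ} (hg : M.IsRegularOnFace e g)
    (hh : M.IsRegularOnFace e h) :
    M.faceIntegral e (fun x => g x + h x) = M.faceIntegral e g + M.faceIntegral e h := by
  obtain ⟨F, hF, hgF⟩ := hg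
  obtain ⟨F', hF', hhF⟩ := hh
  rw [M.faceIntegral_eq e hgF, M.faceIntegral_eq e hhF,
    ← integral_add (M.integrableOn_face hF e) (M.integrableOn_face hF' e)]
  exact M.faceIntegral_eq e fun x => by rw [hgF, hhF]

lemma faceIntegral_const_mul {e : M.Face} (c : ℝ) (g : M.face e → ℝ) :
    M.faceIntegral e (fun x => c * g x) = c * M.faceIntegral e g :=
  integral_const_mul _ _

/-- A non-negative regular function with vanishing integral over a face vanishes on it. -/
lemma eq_zero_of_faceIntegral_eq_zero {e : M.Face} {g : M.face e → ℝ}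
    (hg : M.IsRegularOnFace e g) (hnn : ∀ x, 0 ≤ g x) (h0 : M.faceIntegral e g = 0)
    (x : M.face e) : g x = 0 := by
  obtain ⟨F, hF, hgF⟩ := hg
  have hFnn : 0 ≤ᵐ[(Measure.euclideanHausdorffMeasure m).restrict (M.face e)] F :=
    (ae_restrict_iff' (M.measurableSet_face e)).2 (ae_of_all _ fun y hy => by
      simpa [← hgF ⟨y, hy⟩] using hnn ⟨y, hy⟩)
  rw [M.faceIntegral_eq e hgF,
    setIntegral_eq_zero_iff_of_nonneg_ae hFnn (M.integrableOn_face hF e)] at h0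
  by_contra hx
  have hopen : IsOpen {y | F y ≠ 0} := isOpen_ne_fun hF continuous_const
  have hpos := M.surface_face_inter_pos e hopen ⟨x, x.2, by rwa [hgF] at hx⟩
  refine hpos.ne' ?_
  rw [inter_comm, ← Measure.restrict_apply hopen.measurableSet]
  exact ae_iff.1 h0

lemma boundaryIntegral_add {T : M.Cell} {g h : (e : M.Face) → M.face e → ℝ}
    (hg : ∀ e, M.IsRegularOnFace e (g e)) (hh : ∀ e, M.IsRegularOnFace e (h e)) :
    M.boundaryIntegral T (fun e x => g e x + h e x) =
      M.boundaryIntegral T g + M.boundaryIntegral T h := by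
  simp only [boundaryIntegral, ← Finset.sum_add_distrib]
  exact Finset.sum_congr rfl fun e _ => M.faceIntegral_add (hg e) (hh e)

lemma boundaryIntegral_const_mul {T : M.Cell} (c : ℝ) (g : (e : M.Face) → M.face e → ℝ) :
    M.boundaryIntegral T (fun e x => c * g e x) = c * M.boundaryIntegral T g := by
  simp only [boundaryIntegral, Finset.mul_sum]
  exact Finset.sum_congr rfl fun e _ => M.faceIntegral_const_mul c (g e)

lemma boundaryIntegral_nonneg {T : M.Cell} {g : (e : M.Face) → M.face e → ℝ}
    (hg : ∀ e x, 0 ≤ g e x) : 0 ≤ M.boundaryIntegral T g :=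
  Finset.sum_nonneg fun e _ => integral_nonneg (hg e)

lemma boundaryIntegral_congr {T : M.Cell} {g h : (e : M.Face) → M.face e → ℝ}
    (hgh : ∀ e, M.face e ⊆ frontier (M.cell T) → ∀ x, g e x = h e x) :
    M.boundaryIntegral T g = M.boundaryIntegral T h := by
  classical
  refine Finset.sum_congr rfl fun e he => ?_
  rw [funext (hgh e (Finset.mem_filter.1 he).2)]

/-- The divergence theorem in terms of `boundaryIntegral`. -/
lemma integral_cell_partialDeriv (T : M.Cell) (i : Fin (m + 1)) {F : Space (m + 1) → ℝ}
    (hF : ContDiff ℝ 1 F) :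
    ∫ x in M.cell T, partialDeriv i F x =
      M.boundaryIntegral T (fun e x => M.normal T e i * F x) := by
  refine (M.integral_cell_fderiv T _ hF).trans (Finset.sum_congr rfl fun e _ => ?_)
  rw [M.faceIntegral_const_mul, M.faceIntegral_eq (F := F) e fun _ => rfl]
  congr 1
  simp [EuclideanSpace.inner_single_right]

/-! ### Discrete weak derivatives -/

lemma isRegularOnFace_b {k : ℕ} {v : M.Triple} (hv : v ∈ M.weakSpace k) (e : M.Face) :
    M.IsRegularOnFace e (v.2.1 e) := isRegularOnFace_of_mem_polyOn (hv.2.1 e)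

lemma isRegularOnFace_g {k : ℕ} {v : M.Triple} (hv : v ∈ M.weakSpace k) (e : M.Face)
    (i : Fin (m + 1)) : M.IsRegularOnFace e (v.2.2 e i) := isRegularOnFace_of_mem_polyOn (hv.2.2 e i)

/-- The right-hand side of the equation that defines the discrete weak derivative. -/
def weakDerivRhs (T : M.Cell) (i j : Fin (m + 1)) (v : M.Triple)
    (φ : MvPolynomial (Fin (m + 1)) ℝ) : ℝ :=
  (∫ x in M.cell T,
    polyEval (v.1 T) x * polyEval (MvPolynomial.pderiv j (MvPolynomial.pderiv i φ)) x) -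
  M.boundaryIntegral T
    (fun e x => v.2.1 e x * M.normal T e i * polyEval (MvPolynomial.pderiv j φ) x) +
  M.boundaryIntegral T (fun e x => v.2.2 e i x * (polyEval φ x * M.normal T e j))

lemma integrableOn_polyEval_mul (T : M.Cell) (p q : MvPolynomial (Fin (m + 1)) ℝ) :
    IntegrableOn (fun x => polyEval p x * polyEval q x) (M.cell T) :=
  M.integrableOn_cell ((continuous_polyEval p).mul (continuous_polyEval q)) T

lemma weakDerivRhs_add_right {k : ℕ} {v : M.Triple} (hv : v ∈ M.weakSpace k) (T : M.Cell)
    (i j : Fin (m + 1)) (φ ψ : MvPolynomial (Fin (m + 1)) ℝ) :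
    M.weakDerivRhs T i j v (φ + ψ) = M.weakDerivRhs T i j v φ + M.weakDerivRhs T i j v ψ := by
  simp only [weakDerivRhs, map_add, polyEval_add, mul_add, add_mul]
  rw [integral_add (M.integrableOn_polyEval_mul T _ _) (M.integrableOn_polyEval_mul T _ _),
    M.boundaryIntegral_add, M.boundaryIntegral_add]
  · ring
  all_goals intro e
  · exact (M.isRegularOnFace_g hv e i).mul ((isRegularOnFace_polyEval _).mul (isRegularOnFace_const _))
  · exact (M.isRegularOnFace_g hv e i).mul ((isRegularOnFace_polyEval _).mul (isRegularOnFace_const _))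
  · exact ((M.isRegularOnFace_b hv e).mul (isRegularOnFace_const _)).mul (isRegularOnFace_polyEval _)
  · exact ((M.isRegularOnFace_b hv e).mul (isRegularOnFace_const _)).mul (isRegularOnFace_polyEval _)

lemma weakDerivRhs_add_left {k : ℕ} {v w : M.Triple} (hv : v ∈ M.weakSpace k)
    (hw : w ∈ M.weakSpace k) (T : M.Cell) (i j : Fin (m + 1)) (φ : MvPolynomial (Fin (m + 1)) ℝ) :
    M.weakDerivRhs T i j (v + w) φ = M.weakDerivRhs T i j v φ + M.weakDerivRhs T i j w φ := by
  simp only [weakDerivRhs, Prod.fst_add, Prod.snd_add, Pi.add_apply, polyEval_add, add_mul]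
  rw [integral_add (M.integrableOn_polyEval_mul T _ _) (M.integrableOn_polyEval_mul T _ _),
    M.boundaryIntegral_add, M.boundaryIntegral_add]
  · ring
  all_goals intro e
  · exact (M.isRegularOnFace_g hv e i).mul ((isRegularOnFace_polyEval _).mul (isRegularOnFace_const _))
  · exact (M.isRegularOnFace_g hw e i).mul ((isRegularOnFace_polyEval _).mul (isRegularOnFace_const _))
  · exact ((M.isRegularOnFace_b hv e).mul (isRegularOnFace_const _)).mul (isRegularOnFace_polyEval _)
  · exact ((M.isRegularOnFace_b hw e).mul (isRegularOnFace_const _)).mul (isRegularOnFace_polyEval _)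

lemma weakDerivRhs_smul_right (T : M.Cell) (i j : Fin (m + 1)) (v : M.Triple) (c : ℝ)
    (φ : MvPolynomial (Fin (m + 1)) ℝ) :
    M.weakDerivRhs T i j v (c • φ) = c * M.weakDerivRhs T i j v φ := by
  have h1 : ∀ a b : ℝ, a * (c * b) = c * (a * b) := fun a b => by ring
  simp only [weakDerivRhs, Derivation.map_smul, polyEval_smul, h1, mul_assoc, boundaryIntegral_const_mul,
    integral_const_mul]
  ring

lemma weakDerivRhs_smul_left (T : M.Cell) (i j : Fin (m + 1)) (v : M.Triple) (c : ℝ)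
    (φ : MvPolynomial (Fin (m + 1)) ℝ) :
    M.weakDerivRhs T i j (c • v) φ = c * M.weakDerivRhs T i j v φ := by
  simp only [weakDerivRhs, Prod.smul_fst, Prod.smul_snd, Pi.smul_apply, polyEval_smul, smul_eq_mul,
    mul_assoc, boundaryIntegral_const_mul, integral_const_mul]
  ring

/-- The `L²(T)` inner product is definite on polynomials. -/
lemma eq_zero_of_integral_polyEval_mul_self (T : M.Cell) {p : MvPolynomial (Fin (m + 1)) ℝ}
    (h : ∫ x in M.cell T, polyEval p x * polyEval p x = 0) : p = 0 := by
  rw [setIntegral_eq_zero_iff_of_nonneg_ae (ae_of_all _ fun x => mul_self_nonneg _)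
    (M.integrableOn_polyEval_mul T p p)] at h
  have hc := (continuous_polyEval p).mul (continuous_polyEval p)
  have h1 := Measure.eqOn_open_of_ae_eq h (M.isOpen_cell T) hc.continuousOn continuousOn_const
  refine eq_zero_of_polyEval_eq_zero (M.isOpen_cell T) (M.cell_polytope T).isConnected.nonempty
    fun x hx => ?_
  exact mul_self_eq_zero.1 (h1 hx)

lemma exists_isDiscreteWeakDeriv {k : ℕ} (r : ℕ) {v : M.Triple} (hv : v ∈ M.weakSpace k)
    (T : M.Cell) (i j : Fin (m + 1)) : ∃ p, M.IsDiscreteWeakDeriv r T i j v p := by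
  let P := MvPolynomial.restrictTotalDegree (Fin (m + 1)) ℝ r
  let B : P →ₗ[ℝ] Module.Dual ℝ P := LinearMap.mk₂ ℝ
    (fun p q => ∫ x in M.cell T, polyEval (p : MvPolynomial (Fin (m + 1)) ℝ) x *
      polyEval (q : MvPolynomial (Fin (m + 1)) ℝ) x)
    (fun p p' q => by
      simp only [Submodule.coe_add, polyEval_add, add_mul]
      exact integral_add (M.integrableOn_polyEval_mul T _ _) (M.integrableOn_polyEval_mul T _ _))
    (fun c p q => by
      simp only [Submodule.coe_smul, polyEval_smul, mul_assoc, integral_const_mul, smul_eq_mul])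
    (fun p q q' => by
      simp only [Submodule.coe_add, polyEval_add, mul_add]
      exact integral_add (M.integrableOn_polyEval_mul T _ _) (M.integrableOn_polyEval_mul T _ _))
    (fun c p q => by
      simp only [Submodule.coe_smul, polyEval_smul, mul_left_comm _ c, integral_const_mul,
        smul_eq_mul])
  have hinj : Function.Injective B := by
    rw [injective_iff_map_eq_zero]
    intro p hp
    have h0 : B p p = 0 := by rw [hp]; rfl
    exact Subtype.ext (M.eq_zero_of_integral_polyEval_mul_self T h0)
  have hsurj : Function.Surjective B :=
    (LinearMap.injective_iff_surjective_of_finrank_eq_finrank Subspace.dual_finrank_eq.symm).1 hinj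
  let ℓ : Module.Dual ℝ P :=
    { toFun := fun φ => M.weakDerivRhs T i j v φ
      map_add' := fun φ ψ => M.weakDerivRhs_add_right hv T i j φ ψ
      map_smul' := fun c φ => M.weakDerivRhs_smul_right T i j v c φ }
  obtain ⟨p, hp⟩ := hsurj ℓ
  exact ⟨p, p.2, fun φ hφ => congrArg (fun f : Module.Dual ℝ P => f ⟨φ, hφ⟩) hp⟩

variable {M} in
lemma IsDiscreteWeakDeriv.unique {r : ℕ} {T : M.Cell} {i j : Fin (m + 1)} {v : M.Triple}
    {p q : MvPolynomial (Fin (m + 1)) ℝ} (hp : M.IsDiscreteWeakDeriv r T i j v p)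
    (hq : M.IsDiscreteWeakDeriv r T i j v q) : p = q := by
  have h := (hp.2 _ (Submodule.sub_mem _ hp.1 hq.1)).trans
    (hq.2 _ (Submodule.sub_mem _ hp.1 hq.1)).symm
  refine sub_eq_zero.1 (M.eq_zero_of_integral_polyEval_mul_self T ?_)
  rw [← sub_eq_zero, ← integral_sub (M.integrableOn_polyEval_mul T _ _)
    (M.integrableOn_polyEval_mul T _ _)] at h
  simpa only [← sub_mul, ← polyEval_sub] using h

lemma isDiscreteWeakDeriv_discreteWeakDeriv {k : ℕ} (r : ℕ) {v : M.Triple}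
    (hv : v ∈ M.weakSpace k) (T : M.Cell) (i j : Fin (m + 1)) :
    M.IsDiscreteWeakDeriv r T i j v (M.discreteWeakDeriv r T i j v) :=
  Classical.epsilon_spec (M.exists_isDiscreteWeakDeriv r hv T i j)

lemma discreteWeakDeriv_eq {k r : ℕ} {v : M.Triple} (hv : v ∈ M.weakSpace k) {T : M.Cell}
    {i j : Fin (m + 1)} {p : MvPolynomial (Fin (m + 1)) ℝ}
    (hp : M.IsDiscreteWeakDeriv r T i j v p) : M.discreteWeakDeriv r T i j v = p :=
  (M.isDiscreteWeakDeriv_discreteWeakDeriv r hv T i j).unique hp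

lemma discreteWeakDeriv_add {k : ℕ} (r : ℕ) {v w : M.Triple} (hv : v ∈ M.weakSpace k)
    (hw : w ∈ M.weakSpace k) (T : M.Cell) (i j : Fin (m + 1)) :
    M.discreteWeakDeriv r T i j (v + w) =
      M.discreteWeakDeriv r T i j v + M.discreteWeakDeriv r T i j w := by
  have h1 := M.isDiscreteWeakDeriv_discreteWeakDeriv r hv T i j
  have h2 := M.isDiscreteWeakDeriv_discreteWeakDeriv r hw T i j
  refine M.discreteWeakDeriv_eq (Submodule.add_mem _ hv hw) ⟨Submodule.add_mem _ h1.1 h2.1,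
    fun φ hφ => ?_⟩
  refine Eq.trans ?_ (M.weakDerivRhs_add_left hv hw T i j φ).symm
  simp only [polyEval_add, add_mul]
  rw [integral_add (M.integrableOn_polyEval_mul T _ _) (M.integrableOn_polyEval_mul T _ _),
    h1.2 φ hφ, h2.2 φ hφ]
  rfl

lemma discreteWeakDeriv_smul {k : ℕ} (r : ℕ) {v : M.Triple} (hv : v ∈ M.weakSpace k) (c : ℝ)
    (T : M.Cell) (i j : Fin (m + 1)) :
    M.discreteWeakDeriv r T i j (c • v) = c • M.discreteWeakDeriv r T i j v := by
  have h1 := M.isDiscreteWeakDeriv_discreteWeakDeriv r hv T i j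
  refine M.discreteWeakDeriv_eq (Submodule.smul_mem _ c hv) ⟨Submodule.smul_mem _ c h1.1,
    fun φ hφ => ?_⟩
  refine Eq.trans ?_ (M.weakDerivRhs_smul_left T i j v c φ).symm
  simp only [polyEval_smul, mul_assoc, integral_const_mul]
  rw [h1.2 φ hφ]
  rfl

/-- If `v_b` and `v_g` are the traces of `v₀` and of its gradient, then the discrete weak
derivatives of second order are the classical ones. -/
lemma discreteWeakDeriv_eq_pderiv {k r : ℕ} (hr : k - 2 ≤ r) {v : M.Triple}
    (hv : v ∈ M.weakSpace k) {T : M.Cell}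
    (hb : ∀ e, M.face e ⊆ frontier (M.cell T) → ∀ x, v.2.1 e x = polyEval (v.1 T) x)
    (hg : ∀ e, M.face e ⊆ frontier (M.cell T) → ∀ i x,
      v.2.2 e i x = polyEval (MvPolynomial.pderiv i (v.1 T)) x) (i j : Fin (m + 1)) :
    M.discreteWeakDeriv r T i j v = MvPolynomial.pderiv j (MvPolynomial.pderiv i (v.1 T)) := by
  set p := v.1 T with hp
  refine M.discreteWeakDeriv_eq hv ⟨?_, fun φ _ => ?_⟩
  · have h1 := pderiv_mem_restrictTotalDegree j (pderiv_mem_restrictTotalDegree i (hv.1 T))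
    rw [MvPolynomial.mem_restrictTotalDegree] at h1 ⊢
    exact h1.trans (by omega)
  -- integrate by parts twice
  have hprod : ∀ (q s : MvPolynomial (Fin (m + 1)) ℝ) (l : Fin (m + 1)),
      (∫ x in M.cell T, polyEval (MvPolynomial.pderiv l q) x * polyEval s x) +
        ∫ x in M.cell T, polyEval q x * polyEval (MvPolynomial.pderiv l s) x =
      M.boundaryIntegral T (fun e x => M.normal T e l * (polyEval q x * polyEval s x)) := by
    intro q s l
    rw [← integral_add (M.integrableOn_polyEval_mul T _ _) (M.integrableOn_polyEval_mul T _ _),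
      ← M.integral_cell_partialDeriv T l ((contDiff_one_polyEval q).mul (contDiff_one_polyEval s))]
    congr 1
    funext x
    rw [partialDeriv, fderiv_fun_mul ((contDiff_one_polyEval q).differentiable one_ne_zero x)
      ((contDiff_one_polyEval s).differentiable one_ne_zero x), add_apply, smul_apply, smul_apply,
      fderiv_polyEval, fderiv_polyEval, smul_eq_mul, smul_eq_mul]
    ring
  have h1 := hprod (MvPolynomial.pderiv i p) φ j
  have h2 := hprod p (MvPolynomial.pderiv j φ) i
  have h3 : MvPolynomial.pderiv j (MvPolynomial.pderiv i φ) =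
      MvPolynomial.pderiv i (MvPolynomial.pderiv j φ) := pderiv_pderiv_comm _ _ _
  have h4 : M.boundaryIntegral T
      (fun e x => v.2.1 e x * M.normal T e i * polyEval (MvPolynomial.pderiv j φ) x) =
      M.boundaryIntegral T (fun e x => M.normal T e i *
        (polyEval p x * polyEval (MvPolynomial.pderiv j φ) x)) :=
    M.boundaryIntegral_congr fun e he x => by rw [hb e he]; ring
  have h5 : M.boundaryIntegral T (fun e x => v.2.2 e i x * (polyEval φ x * M.normal T e j)) =
      M.boundaryIntegral T (fun e x => M.normal T e j *
        (polyEval (MvPolynomial.pderiv i p) x * polyEval φ x)) :=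
    M.boundaryIntegral_congr fun e he x => by rw [hg e he]; ring
  rw [h3, h4, h5]
  linarith

end PolyMesh

namespace PolyMesh

variable {m : ℕ} {Ω : Set (Space (m + 1))} (M : PolyMesh Ω)

/-! ### Conforming piecewise polynomials as strong solutions -/

lemma setIntegral_piecewise_mul_partialDeriv (hΩ : IsOpen Ω)
    {p : M.Cell → MvPolynomial (Fin (m + 1)) ℝ} {φ : Space (m + 1) → ℝ} (hφ : ContDiff ℝ 1 φ)
    (hcont : ∀ e T T', M.face e ⊆ frontier (M.cell T) → M.face e ⊆ frontier (M.cell T') →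
      ∀ x ∈ M.face e, polyEval (p T) x = polyEval (p T') x)
    (hbd : ∀ e T, M.face e ⊆ frontier (M.cell T) → M.face e ⊆ frontier Ω →
      ∀ x ∈ M.face e, polyEval (p T) x * φ x = 0) (i : Fin (m + 1))
    {S : Set (Space (m + 1))} (hS : ∀ T, M.cell T ⊆ S) :
    ∫ x in S, M.piecewise (fun T => polyEval (p T)) x * partialDeriv i φ x =
      -∫ x in S, M.piecewise (fun T => polyEval (MvPolynomial.pderiv i (p T))) x * φ x := by
  have hφ' : Continuous (partialDeriv i φ) :=
    (hφ.continuous_fderiv one_ne_zero).clm_apply continuous_const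
  rw [M.setIntegral_piecewise_mul (fun T => continuous_polyEval _) hφ' hS,
    M.setIntegral_piecewise_mul (fun T => continuous_polyEval _) hφ.continuous hS]
  simp only [← fderiv_polyEval]
  exact M.sum_integral_mul_fderiv hΩ (fun T => contDiff_one_polyEval (p T)) hφ hcont hbd _

lemma memLp_piecewise (hb : Bornology.IsBounded Ω) (p : M.Cell → MvPolynomial (Fin (m + 1)) ℝ) :
    MemLp (M.piecewise fun T => polyEval (p T)) 2 (volume.restrict Ω) := by
  have : IsFiniteMeasure (volume.restrict Ω) := ⟨by
    rw [Measure.restrict_apply_univ]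
    exact hb.measure_lt_top⟩
  obtain ⟨C, hC⟩ := M.exists_bound_piecewise fun T => continuous_polyEval (p T)
  exact MemLp.of_bound
    (M.measurable_piecewise fun T => continuous_polyEval (p T)).aestronglyMeasurable C
    (ae_of_all _ hC)

/-- A piecewise polynomial function that is continuous together with its gradient across the
faces and vanishes on the boundary lies in `H²(Ω) ∩ H¹₀(Ω)`; if it satisfies the homogeneous equation
on each cell, then it is a strong solution of the homogeneous problem. -/
theorem isStrongSolution_piecewise (hΩ : IsLipschitzDomain Ω)
    {a : Space (m + 1) → Matrix (Fin (m + 1)) (Fin (m + 1)) ℝ}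
    {p : M.Cell → MvPolynomial (Fin (m + 1)) ℝ}
    (hcont : ∀ e T T', M.face e ⊆ frontier (M.cell T) → M.face e ⊆ frontier (M.cell T') →
      ∀ x ∈ M.face e, polyEval (p T) x = polyEval (p T') x)
    (hgrad : ∀ i e T T', M.face e ⊆ frontier (M.cell T) → M.face e ⊆ frontier (M.cell T') →
      ∀ x ∈ M.face e, polyEval (MvPolynomial.pderiv i (p T)) x =
        polyEval (MvPolynomial.pderiv i (p T')) x)
    (hbd : ∀ e T, M.face e ⊆ frontier (M.cell T) → M.face e ⊆ frontier Ω →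
      ∀ x ∈ M.face e, polyEval (p T) x = 0)
    (heq : ∀ T, ∀ᵐ x ∂volume.restrict (M.cell T),
      ∑ i, ∑ j, a x i j * polyEval (MvPolynomial.pderiv j (MvPolynomial.pderiv i (p T))) x = 0) :
    IsStrongSolution Ω a (fun _ => 0) (M.piecewise fun T => polyEval (p T)) := by
  have htest : ∀ φ, IsTestFunction Ω φ → ∀ x ∈ frontier Ω, φ x = 0 := by
    intro φ hφ x hx
    rw [hΩ.isOpen.frontier_eq] at hx
    exact image_eq_zero_of_notMem_tsupport fun h => hx.2 (hφ.subset h)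
  have hone : ∀ φ, IsTestFunction Ω φ → ContDiff ℝ 1 φ := fun φ hφ =>
    hφ.smooth.of_le (by exact_mod_cast le_top)
  have hweak : ∀ q : M.Cell → MvPolynomial (Fin (m + 1)) ℝ,
      (∀ e T T', M.face e ⊆ frontier (M.cell T) → M.face e ⊆ frontier (M.cell T') →
      ∀ x ∈ M.face e, polyEval (q T) x = polyEval (q T') x) → ∀ i,
      IsWeakPartial Ω i (M.piecewise fun T => polyEval (q T))
        (M.piecewise fun T => polyEval (MvPolynomial.pderiv i (q T))) := by
    intro q hq i φ hφ
    exact M.setIntegral_piecewise_mul_partialDeriv hΩ.isOpen (hone φ hφ) hq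
      (fun e T _ hb x hx => by rw [htest φ hφ x (hb hx), mul_zero]) i M.cell_subset
  refine ⟨fun i => M.piecewise fun T => polyEval (MvPolynomial.pderiv i (p T)),
    fun i j => M.piecewise fun T => polyEval (MvPolynomial.pderiv j (MvPolynomial.pderiv i (p T))),
    M.memLp_piecewise hΩ.isBounded _, fun i => ⟨M.memLp_piecewise hΩ.isBounded _, hweak p hcont i⟩,
    fun i j => ⟨M.memLp_piecewise hΩ.isBounded _, hweak _ (hgrad i) j⟩, ?_, ?_⟩
  · obtain ⟨C, hC⟩ := M.exists_bound_piecewise fun T => continuous_polyEval (p T)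
    choose C' hC' using fun i => M.exists_bound_piecewise fun T =>
      continuous_polyEval (MvPolynomial.pderiv i (p T))
    refine exists_tendsto_testFunction (C := |C| + ∑ i, |C' i|) hΩ.isBounded
      (compl_subset_closure_compl_closure hΩ.isOpen hΩ.lipschitz)
      (M.measurable_piecewise fun T => continuous_polyEval _)
      (fun i => M.measurable_piecewise fun T => continuous_polyEval _) (by positivity)
      (fun x => ?_) (fun i x => ?_) (fun x hx => ?_) (fun i ψ hψ _ => ?_) fun i => ?_
    · have : 0 ≤ ∑ i, |C' i| := by positivity
      linarith [hC x, le_abs_self C]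
    · have := Finset.single_le_sum (f := fun i => |C' i|) (fun i _ => abs_nonneg _)
        (Finset.mem_univ i)
      linarith [hC' i x, le_abs_self (C' i), abs_nonneg C]
    · exact M.piecewise_of_notMem _ fun T hT => hx (M.cell_subset T hT)
    · have := M.setIntegral_piecewise_mul_partialDeriv (p := p) hΩ.isOpen
        (hψ.of_le (by exact_mod_cast le_top)) hcont
        (fun e T he hb x hx => by rw [hbd e T he hb x hx, zero_mul]) i
        (fun T => subset_univ _)
      simpa only [setIntegral_univ] using this
    · have h : ∀ᵐ x, ∀ T, polyEval (p T) x = 0 → polyEval (MvPolynomial.pderiv i (p T)) x = 0 := by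
        refine ae_all_iff.2 fun T => ?_
        simpa only [fderiv_polyEval] using
          ae_eq_zero_imp_fderiv_eq_zero (contDiff_one_polyEval (p T)) (EuclideanSpace.single i 1)
      filter_upwards [h] with x hx h0
      by_cases hT : ∃ T, x ∈ M.cell T
      · obtain ⟨T, hT⟩ := hT
        rw [M.piecewise_of_mem _ hT] at h0 ⊢
        exact hx T h0
      · exact M.piecewise_of_notMem _ fun T h => hT ⟨T, h⟩
  · have h : ∀ᵐ x, ∀ T, x ∈ M.cell T →
        ∑ i, ∑ j, a x i j * polyEval (MvPolynomial.pderiv j (MvPolynomial.pderiv i (p T))) x = 0 :=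
      ae_all_iff.2 fun T => (ae_restrict_iff' (M.isOpen_cell T).measurableSet).1 (heq T)
    filter_upwards [ae_restrict_of_ae h, M.ae_exists_mem_cell] with x hx hT
    obtain ⟨T, hT⟩ := hT
    simp only [M.piecewise_of_mem _ hT]
    exact hx T hT

/-! ### The forms of the scheme -/

lemma diam_cell_pos (T : M.Cell) : 0 < Metric.diam (M.cell T) := by
  obtain ⟨x, hx⟩ := (M.cell_polytope T).isConnected.nonempty
  refine Metric.diam_pos ?_ (M.isBounded_cell T)
  by_contra h
  rw [not_nontrivial_iff] at h
  have h1 : M.cell T = {x} := h.eq_singleton_of_mem hx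
  exact not_isOpen_singleton x (h1 ▸ M.isOpen_cell T)

lemma isRegularOnFace_jump {k : ℕ} {u v : M.Triple} (hu : u ∈ M.weakSpace k)
    (hv : v ∈ M.weakSpace k) (T : M.Cell) (e : M.Face) : M.IsRegularOnFace e fun x =>
      (polyEval (u.1 T) x - u.2.1 e x) * (polyEval (v.1 T) x - v.2.1 e x) :=
  ((isRegularOnFace_polyEval _).sub (M.isRegularOnFace_b hu e)).mul
    ((isRegularOnFace_polyEval _).sub (M.isRegularOnFace_b hv e))

lemma isRegularOnFace_gradJump {k : ℕ} {u v : M.Triple} (hu : u ∈ M.weakSpace k)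
    (hv : v ∈ M.weakSpace k) (T : M.Cell) (e : M.Face) : M.IsRegularOnFace e fun x =>
      ∑ i, (polyEval (MvPolynomial.pderiv i (u.1 T)) x - u.2.2 e i x) *
        (polyEval (MvPolynomial.pderiv i (v.1 T)) x - v.2.2 e i x) :=
  isRegularOnFace_sum _ fun i =>
    ((isRegularOnFace_polyEval _).sub (M.isRegularOnFace_g hu e i)).mul
      ((isRegularOnFace_polyEval _).sub (M.isRegularOnFace_g hv e i))

lemma stabilizer_comm (u v : M.Triple) : M.stabilizer u v = M.stabilizer v u := by
  simp only [stabilizer, mul_comm]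

lemma stabilizer_add_left {k : ℕ} {u u' v : M.Triple} (hu : u ∈ M.weakSpace k)
    (hu' : u' ∈ M.weakSpace k) (hv : v ∈ M.weakSpace k) :
    M.stabilizer (u + u') v = M.stabilizer u v + M.stabilizer u' v := by
  simp only [stabilizer, ← Finset.sum_add_distrib]
  refine Finset.sum_congr rfl fun T _ => ?_
  have h1 := M.boundaryIntegral_add (T := T) (M.isRegularOnFace_jump hu hv T)
    (M.isRegularOnFace_jump hu' hv T)
  have h2 := M.boundaryIntegral_add (T := T) (M.isRegularOnFace_gradJump hu hv T)
    (M.isRegularOnFace_gradJump hu' hv T)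
  rw [add_add_add_comm, ← mul_add, ← mul_add, ← h1, ← h2]
  congr 3
  · funext e x
    simp only [Prod.fst_add, Prod.snd_add, Pi.add_apply, polyEval_add]
    ring
  · funext e x
    rw [← Finset.sum_add_distrib]
    refine Finset.sum_congr rfl fun i _ => ?_
    simp only [Prod.fst_add, Prod.snd_add, Pi.add_apply, polyEval_add, map_add]
    ring

lemma stabilizer_smul_left (c : ℝ) (u v : M.Triple) :
    M.stabilizer (c • u) v = c * M.stabilizer u v := by
  simp only [stabilizer, Finset.mul_sum]
  refine Finset.sum_congr rfl fun T _ => ?_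
  have h1 : (M.boundaryIntegral T fun e x =>
      (polyEval ((c • u).1 T) x - (c • u).2.1 e x) * (polyEval (v.1 T) x - v.2.1 e x)) =
      c * M.boundaryIntegral T fun e x =>
        (polyEval (u.1 T) x - u.2.1 e x) * (polyEval (v.1 T) x - v.2.1 e x) := by
    rw [← M.boundaryIntegral_const_mul]
    congr 1
    funext e x
    simp only [Prod.smul_fst, Prod.smul_snd, Pi.smul_apply, polyEval_smul, smul_eq_mul]
    ring
  have h2 : (M.boundaryIntegral T fun e x =>
      ∑ i, (polyEval (MvPolynomial.pderiv i ((c • u).1 T)) x - (c • u).2.2 e i x) *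
        (polyEval (MvPolynomial.pderiv i (v.1 T)) x - v.2.2 e i x)) =
      c * M.boundaryIntegral T fun e x =>
        ∑ i, (polyEval (MvPolynomial.pderiv i (u.1 T)) x - u.2.2 e i x) *
          (polyEval (MvPolynomial.pderiv i (v.1 T)) x - v.2.2 e i x) := by
    rw [← M.boundaryIntegral_const_mul]
    congr 1
    funext e x
    rw [Finset.mul_sum]
    refine Finset.sum_congr rfl fun i _ => ?_
    simp only [Prod.smul_fst, Prod.smul_snd, Pi.smul_apply, polyEval_smul, smul_eq_mul,
      Derivation.map_smul]
    ring
  rw [h1, h2]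
  ring

lemma boundaryIntegral_jump_nonneg (v : M.Triple) (T : M.Cell) :
    0 ≤ M.boundaryIntegral T fun e x =>
      (polyEval (v.1 T) x - v.2.1 e x) * (polyEval (v.1 T) x - v.2.1 e x) :=
  M.boundaryIntegral_nonneg fun _ _ => mul_self_nonneg _

lemma boundaryIntegral_gradJump_nonneg (v : M.Triple) (T : M.Cell) :
    0 ≤ M.boundaryIntegral T fun e x =>
      ∑ i, (polyEval (MvPolynomial.pderiv i (v.1 T)) x - v.2.2 e i x) *
        (polyEval (MvPolynomial.pderiv i (v.1 T)) x - v.2.2 e i x) :=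
  M.boundaryIntegral_nonneg fun _ _ => Finset.sum_nonneg fun _ _ => mul_self_nonneg _

lemma stabilizer_self_nonneg (v : M.Triple) : 0 ≤ M.stabilizer v v :=
  Finset.sum_nonneg fun T _ => add_nonneg
    (mul_nonneg (by have := M.diam_cell_pos T; positivity) (M.boundaryIntegral_jump_nonneg v T))
    (mul_nonneg (by have := M.diam_cell_pos T; positivity) (M.boundaryIntegral_gradJump_nonneg v T))

lemma eq_zero_of_boundaryIntegral_eq_zero {T : M.Cell} {g : (e : M.Face) → M.face e → ℝ}
    (hg : ∀ e, M.IsRegularOnFace e (g e)) (hnn : ∀ e x, 0 ≤ g e x)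
    (h0 : M.boundaryIntegral T g = 0) {e : M.Face} (he : M.face e ⊆ frontier (M.cell T))
    (x : M.face e) : g e x = 0 := by
  classical
  have h1 := (Finset.sum_eq_zero_iff_of_nonneg fun e _ => integral_nonneg (hnn e)).1 h0 e
    (Finset.mem_filter.2 ⟨Finset.mem_univ e, he⟩)
  exact M.eq_zero_of_faceIntegral_eq_zero (hg e) (hnn e) h1 x

/-- If the stabilizer vanishes, then `v_b` and `v_g` are the traces of `v₀` and its gradient. -/
lemma traces_of_stabilizer_eq_zero {k : ℕ} {v : M.Triple} (hv : v ∈ M.weakSpace k)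
    (h0 : M.stabilizer v v = 0) (T : M.Cell) (e : M.Face)
    (he : M.face e ⊆ frontier (M.cell T)) :
    (∀ x, v.2.1 e x = polyEval (v.1 T) x) ∧
      ∀ i x, v.2.2 e i x = polyEval (MvPolynomial.pderiv i (v.1 T)) x := by
  have hd := M.diam_cell_pos T
  have hb := M.boundaryIntegral_jump_nonneg v
  have hg := M.boundaryIntegral_gradJump_nonneg v
  have h1 := (Finset.sum_eq_zero_iff_of_nonneg fun T _ => add_nonneg
    (mul_nonneg (by have := M.diam_cell_pos T; positivity) (hb T))
    (mul_nonneg (by have := M.diam_cell_pos T; positivity) (hg T))).1 h0 T (Finset.mem_univ T)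
  rw [add_eq_zero_iff_of_nonneg (mul_nonneg (by positivity) (hb T))
    (mul_nonneg (by positivity) (hg T)), mul_eq_zero_iff_left (by positivity),
    mul_eq_zero_iff_left (by positivity)] at h1
  constructor
  · intro x
    have := M.eq_zero_of_boundaryIntegral_eq_zero (M.isRegularOnFace_jump hv hv T)
      (fun _ _ => mul_self_nonneg _) h1.1 he x
    linarith [mul_self_eq_zero.1 this]
  · intro i x
    have := M.eq_zero_of_boundaryIntegral_eq_zero (M.isRegularOnFace_gradJump hv hv T)
      (fun _ _ => Finset.sum_nonneg fun _ _ => mul_self_nonneg _) h1.2 he x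
    have h2 := (Finset.sum_eq_zero_iff_of_nonneg fun _ _ => mul_self_nonneg _).1 this i
      (Finset.mem_univ i)
    linarith [mul_self_eq_zero.1 h2]

end PolyMesh

/-- The entries of an elliptic coefficient matrix are essentially bounded, by polarization. -/
lemma IsEllipticCoefficient.exists_bound {n : ℕ} {Ω : Set (Space n)}
    {a : Space n → Matrix (Fin n) (Fin n) ℝ} (ha : IsEllipticCoefficient Ω a) :
    ∃ β : ℝ, ∀ᵐ x ∂volume.restrict Ω, ∀ i j, |a x i j| ≤ β := by
  obtain ⟨α, β, hα, hβ, h⟩ := ha.elliptic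
  refine ⟨β, ?_⟩
  filter_upwards [ha.symm, h] with x hs hx i j
  have hij : a x j i = a x i j := hs.apply i j
  have h1 := hx (Pi.single i 1 + Pi.single j 1)
  have h2 := hx (Pi.single i 1 - Pi.single j 1)
  have hδ : (0 : ℝ) ≤ (Pi.single j 1 : Fin n → ℝ) i ∧ (Pi.single j 1 : Fin n → ℝ) i ≤ 1 := by
    rw [Pi.single_apply]
    split_ifs <;> norm_num
  have hδ' : (Pi.single i 1 : Fin n → ℝ) j = (Pi.single j 1 : Fin n → ℝ) i := by
    simp only [Pi.single_apply, eq_comm]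
  simp only [Matrix.mulVec_add, Matrix.mulVec_sub, dotProduct_add, dotProduct_sub, add_dotProduct,
    sub_dotProduct, Matrix.mulVec_single_one, single_one_dotProduct, Matrix.col_apply,
    Pi.single_eq_same, hij, hδ'] at h1 h2
  rw [abs_le]
  constructor <;> nlinarith [hδ.1, hδ.2]

namespace PolyMesh

variable {m : ℕ} {Ω : Set (Space (m + 1))} (M : PolyMesh Ω)
  {a : Space (m + 1) → Matrix (Fin (m + 1)) (Fin (m + 1)) ℝ}

lemma memLp_discreteOperator (ha : IsEllipticCoefficient Ω a) (r : ℕ) (T : M.Cell) (v : M.Triple) :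
    MemLp (M.discreteOperator a r T v) 2 (volume.restrict (M.cell T)) := by
  have hle : volume.restrict (M.cell T) ≤ volume.restrict Ω :=
    Measure.restrict_mono (M.cell_subset T) le_rfl
  have : IsFiniteMeasure (volume.restrict (M.cell T)) := ⟨by
    rw [Measure.restrict_apply_univ]
    exact (M.isBounded_cell T).measure_lt_top⟩
  obtain ⟨β, hβ⟩ := ha.exists_bound
  refine memLp_finsetSum _ fun i _ => memLp_finsetSum _ fun j _ => ?_
  obtain ⟨C, hC⟩ := (M.isBounded_cell T).isCompact_closure.exists_bound_of_continuousOn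
    (continuous_polyEval (M.discreteWeakDeriv r T i j v)).continuousOn
  refine MemLp.of_bound (((ha.measurable i j).mono_measure hle).mul
    (continuous_polyEval _).aestronglyMeasurable) (|β| * |C|) ?_
  filter_upwards [ae_mono hle hβ, ae_restrict_mem (M.isOpen_cell T).measurableSet] with x h1 h2
  rw [Real.norm_eq_abs, abs_mul]
  exact mul_le_mul ((h1 i j).trans (le_abs_self β))
    ((hC x (subset_closure h2)).trans (le_abs_self C)) (abs_nonneg _) (abs_nonneg _)

lemma discreteOperator_add {k : ℕ} (r : ℕ) {u v : M.Triple} (hu : u ∈ M.weakSpace k)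
    (hv : v ∈ M.weakSpace k) (T : M.Cell) (x : Space (m + 1)) :
    M.discreteOperator a r T (u + v) x =
      M.discreteOperator a r T u x + M.discreteOperator a r T v x := by
  simp only [discreteOperator, M.discreteWeakDeriv_add r hu hv, polyEval_add, mul_add,
    Finset.sum_add_distrib]

lemma discreteOperator_smul {k : ℕ} (r : ℕ) {u : M.Triple} (hu : u ∈ M.weakSpace k) (c : ℝ)
    (T : M.Cell) (x : Space (m + 1)) :
    M.discreteOperator a r T (c • u) x = c * M.discreteOperator a r T u x := by
  simp only [discreteOperator, M.discreteWeakDeriv_smul r hu, polyEval_smul, Finset.mul_sum,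
    mul_left_comm c]

lemma integrable_discreteOperator_mul (ha : IsEllipticCoefficient Ω a) (r : ℕ) (T : M.Cell)
    (u v : M.Triple) : IntegrableOn
      (fun x => M.discreteOperator a r T u x * M.discreteOperator a r T v x) (M.cell T) :=
  (M.memLp_discreteOperator ha r T u).integrable_mul (M.memLp_discreteOperator ha r T v)

lemma formA_comm (r : ℕ) (u v : M.Triple) : M.formA a r u v = M.formA a r v u := by
  simp only [formA, mul_comm]

lemma formA_add_left (ha : IsEllipticCoefficient Ω a) {k : ℕ} (r : ℕ) {u u' : M.Triple}
    (hu : u ∈ M.weakSpace k) (hu' : u' ∈ M.weakSpace k) (v : M.Triple) :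
    M.formA a r (u + u') v = M.formA a r u v + M.formA a r u' v := by
  simp only [formA, M.discreteOperator_add r hu hu', add_mul, ← Finset.sum_add_distrib]
  exact Finset.sum_congr rfl fun T _ => integral_add (M.integrable_discreteOperator_mul ha r T u v)
    (M.integrable_discreteOperator_mul ha r T u' v)

lemma formA_smul_left {k : ℕ} (r : ℕ) (c : ℝ) {u : M.Triple} (hu : u ∈ M.weakSpace k)
    (v : M.Triple) : M.formA a r (c • u) v = c * M.formA a r u v := by
  simp only [formA, M.discreteOperator_smul r hu, mul_assoc, integral_const_mul, Finset.mul_sum]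

lemma formA_self_nonneg (r : ℕ) (v : M.Triple) : 0 ≤ M.formA a r v v :=
  Finset.sum_nonneg fun _ _ => integral_nonneg fun _ => mul_self_nonneg _

lemma load_add (ha : IsEllipticCoefficient Ω a) {f : Space (m + 1) → ℝ}
    (hf : MemLp f 2 (volume.restrict Ω)) {k : ℕ} (r : ℕ) {u v : M.Triple}
    (hu : u ∈ M.weakSpace k) (hv : v ∈ M.weakSpace k) :
    M.load a f r (u + v) = M.load a f r u + M.load a f r v := by
  have hi : ∀ T (w : M.Triple), IntegrableOn (fun x => f x * M.discreteOperator a r T w x)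
      (M.cell T) := fun T w => (hf.mono_measure
        (Measure.restrict_mono (M.cell_subset T) le_rfl)).integrable_mul
        (M.memLp_discreteOperator ha r T w)
  simp only [load, M.discreteOperator_add r hu hv, mul_add, ← Finset.sum_add_distrib]
  exact Finset.sum_congr rfl fun T _ => integral_add (hi T u) (hi T v)

lemma load_smul (f : Space (m + 1) → ℝ) {k : ℕ} (r : ℕ) (c : ℝ) {u : M.Triple}
    (hu : u ∈ M.weakSpace k) : M.load a f r (c • u) = c * M.load a f r u := by
  simp only [load, M.discreteOperator_smul r hu, mul_left_comm _ c, integral_const_mul,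
    Finset.mul_sum]

/-- The bilinear form of the scheme is definite on `W_h⁰`: an element in its kernel is a conforming
piecewise polynomial that solves the homogeneous problem. -/
theorem eq_zero_of_form_self_eq_zero (hΩ : IsLipschitzDomain Ω) (ha : IsEllipticCoefficient Ω a)
    {f : Space (m + 1) → ℝ}
    (huniq : ∃! u : Lp ℝ 2 (volume.restrict Ω), IsStrongSolution Ω a f (u : Space (m + 1) → ℝ))
    {k r : ℕ} (hr : k - 2 ≤ r) {v : M.Triple} (hv : v ∈ M.weakSpaceZero k)
    (h0 : M.formA a r v v + M.stabilizer v v = 0) : v = 0 := by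
  rw [add_eq_zero_iff_of_nonneg (M.formA_self_nonneg r v) (M.stabilizer_self_nonneg v)] at h0
  have htr := M.traces_of_stabilizer_eq_zero hv.1 h0.2
  have hT : ∀ T, ∫ x in M.cell T, M.discreteOperator a r T v x * M.discreteOperator a r T v x = 0 :=
    fun T => (Finset.sum_eq_zero_iff_of_nonneg fun _ _ =>
      integral_nonneg fun _ => mul_self_nonneg _).1 h0.1 T (Finset.mem_univ T)
  have hstrong : IsStrongSolution Ω a (fun _ => 0) (M.piecewise fun T => polyEval (v.1 T)) := by
    refine M.isStrongSolution_piecewise hΩ (fun e T T' he he' x hx => ?_)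
      (fun i e T T' he he' x hx => ?_) (fun e T he hb x hx => ?_) fun T => ?_
    · exact ((htr T e he).1 ⟨x, hx⟩).symm.trans ((htr T' e he').1 ⟨x, hx⟩)
    · exact ((htr T e he).2 i ⟨x, hx⟩).symm.trans ((htr T' e he').2 i ⟨x, hx⟩)
    · rw [← (htr T e he).1 ⟨x, hx⟩, hv.2 e hb]
      rfl
    · have h1 := hT T
      rw [setIntegral_eq_zero_iff_of_nonneg_ae (ae_of_all _ fun x => mul_self_nonneg _)
        (M.integrable_discreteOperator_mul ha r T v v)] at h1
      filter_upwards [h1] with x hx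
      have h2 := mul_self_eq_zero.1 hx
      simpa only [discreteOperator, M.discreteWeakDeriv_eq_pderiv hr hv.1
        (fun e he => (htr T e he).1) (fun e he => (htr T e he).2)] using h2
  have hzero := hstrong.ae_eq_zero huniq
  have hv0 : ∀ T, v.1 T = 0 := by
    intro T
    have h1 : polyEval (v.1 T) =ᵐ[volume.restrict (M.cell T)] 0 := by
      have h2 := ae_mono (Measure.restrict_mono (M.cell_subset T) le_rfl) hzero
      filter_upwards [h2, ae_restrict_mem (M.isOpen_cell T).measurableSet] with x h3 h4
      rwa [M.piecewise_of_mem _ h4] at h3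
    have h2 := Measure.eqOn_open_of_ae_eq h1 (M.isOpen_cell T)
      (continuous_polyEval _).continuousOn continuousOn_const
    exact eq_zero_of_polyEval_eq_zero (M.isOpen_cell T) (M.cell_polytope T).isConnected.nonempty
      fun x hx => h2 hx
  refine Prod.ext (funext hv0) (Prod.ext (funext fun e => funext fun x => ?_)
    (funext fun e => funext fun i => funext fun x => ?_))
  · obtain ⟨T, hT⟩ := M.face_used e
    rw [(htr T e hT).1 x, hv0, polyEval_zero]
    rfl
  · obtain ⟨T, hT⟩ := M.face_used e
    rw [(htr T e hT).2 i x, hv0, map_zero, polyEval_zero]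
    rfl

/-! ### The linear system -/

/-- Restriction of polynomials to a face. -/
def restrictFace (e : M.Face) : MvPolynomial (Fin (m + 1)) ℝ →ₗ[ℝ] (M.face e → ℝ) where
  toFun p x := polyEval p x
  map_add' p q := funext fun x => polyEval_add p q x
  map_smul' c p := funext fun x => polyEval_smul c p x

instance finite_weakSpaceZero (k : ℕ) : Module.Finite ℝ (M.weakSpaceZero k) := by
  let P := fun l => MvPolynomial.restrictTotalDegree (Fin (m + 1)) ℝ l
  let Φ : ((M.Cell → P k) × (M.Face → P k) × (M.Face → Fin (m + 1) → P (k - 1))) →ₗ[ℝ] M.Triple :=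
    LinearMap.prodMap (LinearMap.pi fun T => (P k).subtype.comp (LinearMap.proj T))
      (LinearMap.prodMap
        (LinearMap.pi fun e => ((M.restrictFace e).comp (P k).subtype).comp (LinearMap.proj e))
        (LinearMap.pi fun e => LinearMap.pi fun i => ((M.restrictFace e).comp
          (P (k - 1)).subtype).comp
            ((LinearMap.proj i : (Fin (m + 1) → P (k - 1)) →ₗ[ℝ] P (k - 1)).comp
              (LinearMap.proj e : (M.Face → Fin (m + 1) → P (k - 1)) →ₗ[ℝ] _))))
  have hle : M.weakSpaceZero k ≤ LinearMap.range Φ := by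
    rintro v ⟨⟨hv1, hv2, hv3⟩, -⟩
    choose q hq hqv using hv2
    choose g hg hgv using hv3
    refine ⟨⟨fun T => ⟨v.1 T, hv1 T⟩, fun e => ⟨q e, hq e⟩, fun e i => ⟨g e i, hg e i⟩⟩, ?_⟩
    refine Prod.ext rfl (Prod.ext (funext fun e => funext fun x => (hqv e x).symm)
      (funext fun e => funext fun i => funext fun x => (hgv e i x).symm))
  exact Submodule.finiteDimensional_of_le hle

/-- The bilinear form `a(·,·) + s(·,·)` on `W_h⁰`. -/
def schemeForm (ha : IsEllipticCoefficient Ω a) (k r : ℕ) :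
    M.weakSpaceZero k →ₗ[ℝ] M.weakSpaceZero k →ₗ[ℝ] ℝ :=
  LinearMap.mk₂ ℝ (fun u v => M.formA a r (u : M.Triple) v + M.stabilizer (u : M.Triple) v)
    (fun u u' v => by
      rw [Submodule.coe_add, M.formA_add_left ha r u.2.1 u'.2.1,
        M.stabilizer_add_left u.2.1 u'.2.1 v.2.1]
      ring)
    (fun c u v => by
      rw [Submodule.coe_smul, M.formA_smul_left r c u.2.1, M.stabilizer_smul_left, smul_eq_mul]
      ring)
    (fun u v v' => by
      simp only [M.formA_comm r (u : M.Triple), M.stabilizer_comm (u : M.Triple)]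
      rw [Submodule.coe_add, M.formA_add_left ha r v.2.1 v'.2.1,
        M.stabilizer_add_left v.2.1 v'.2.1 u.2.1]
      ring)
    (fun c u v => by
      simp only [M.formA_comm r (u : M.Triple), M.stabilizer_comm (u : M.Triple)]
      rw [Submodule.coe_smul, M.formA_smul_left r c v.2.1, M.stabilizer_smul_left, smul_eq_mul]
      ring)

/-- The load functional on `W_h⁰`. -/
def schemeLoad (ha : IsEllipticCoefficient Ω a) {f : Space (m + 1) → ℝ}
    (hf : MemLp f 2 (volume.restrict Ω)) (k r : ℕ) : M.weakSpaceZero k →ₗ[ℝ] ℝ where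
  toFun v := M.load a f r v
  map_add' u v := M.load_add ha hf r u.2.1 v.2.1
  map_smul' c u := M.load_smul f r c u.2.1

lemma schemeForm_apply (ha : IsEllipticCoefficient Ω a) {k r : ℕ} (u v : M.weakSpaceZero k) :
    M.schemeForm ha k r u v = M.formA a r (u : M.Triple) v + M.stabilizer (u : M.Triple) v := rfl

lemma isSchemeSolution_iff (ha : IsEllipticCoefficient Ω a) {f : Space (m + 1) → ℝ}
    (hf : MemLp f 2 (volume.restrict Ω)) {k r : ℕ} (u : M.weakSpaceZero k) :
    M.IsSchemeSolution a f k r u ↔ M.schemeForm ha k r u = M.schemeLoad ha hf k r :=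
  ⟨fun h => LinearMap.ext fun v => h v, fun h v => LinearMap.congr_fun h v⟩

lemma schemeForm_comm (ha : IsEllipticCoefficient Ω a) {k r : ℕ} (u v : M.weakSpaceZero k) :
    M.schemeForm ha k r u v = M.schemeForm ha k r v u := by
  rw [schemeForm_apply, schemeForm_apply, M.formA_comm, M.stabilizer_comm]

lemma schemeForm_self_nonneg (ha : IsEllipticCoefficient Ω a) {k r : ℕ} (v : M.weakSpaceZero k) :
    0 ≤ M.schemeForm ha k r v v :=
  add_nonneg (M.formA_self_nonneg r _) (M.stabilizer_self_nonneg _)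

end PolyMesh

/-- A positive definite bilinear form on a finite-dimensional space represents each functional. -/
lemma existsUnique_eq_of_definite {V : Type*} [AddCommGroup V] [Module ℝ V] [Module.Finite ℝ V]
    {B : V →ₗ[ℝ] V →ₗ[ℝ] ℝ} (hdef : ∀ v, B v v = 0 → v = 0) (ℓ : V →ₗ[ℝ] ℝ) :
    ∃! u, B u = ℓ := by
  have hinj : Function.Injective B := by
    rw [injective_iff_map_eq_zero]
    intro v hv
    exact hdef v (by rw [hv]; rfl)
  have hsurj : Function.Surjective B :=
    (LinearMap.injective_iff_surjective_of_finrank_eq_finrank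
      (Subspace.dual_finrank_eq (K := ℝ) (V := V)).symm).1 hinj
  obtain ⟨u, hu⟩ := hsurj ℓ
  exact ⟨u, hu, fun w hw => hinj (hw.trans hu.symm)⟩

namespace PolyMesh

variable {m : ℕ} {Ω : Set (Space (m + 1))} (M : PolyMesh Ω)
  {a : Space (m + 1) → Matrix (Fin (m + 1)) (Fin (m + 1)) ℝ}

lemma systemMatrix_mulVec (ha : IsEllipticCoefficient Ω a) {k r n : ℕ}
    (b : Module.Basis (Fin n) ℝ (M.weakSpaceZero k)) (x : Fin n → ℝ) (l : Fin n) :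
    (M.systemMatrix a r b).mulVec x l = M.schemeForm ha k r (∑ i, x i • b i) (b l) := by
  simp only [map_sum, LinearMap.sum_apply, map_smul, LinearMap.smul_apply, smul_eq_mul,
    Matrix.mulVec, dotProduct]
  exact Finset.sum_congr rfl fun i _ => mul_comm _ _

lemma posDef_systemMatrix (ha : IsEllipticCoefficient Ω a) {k r n : ℕ}
    (hdef : ∀ v, M.schemeForm ha k r v v = 0 → v = 0)
    (b : Module.Basis (Fin n) ℝ (M.weakSpaceZero k)) : (M.systemMatrix a r b).PosDef := by
  refine Matrix.PosDef.of_dotProduct_mulVec_pos ?_ fun x hx => ?_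
  · ext i j
    exact M.schemeForm_comm ha (b i) (b j)
  · have h1 : star x ⬝ᵥ (M.systemMatrix a r b).mulVec x =
        M.schemeForm ha k r (∑ i, x i • b i) (∑ i, x i • b i) := by
      conv_rhs => rw [map_sum]
      refine Finset.sum_congr rfl fun l _ => ?_
      rw [M.systemMatrix_mulVec ha, map_smul, smul_eq_mul]
      rfl
    rw [h1]
    refine lt_of_le_of_ne (M.schemeForm_self_nonneg ha _) fun h => hx ?_
    exact funext (Fintype.linearIndependent_iff.1 b.linearIndependent x (hdef _ h.symm))

lemma isSchemeSolution_iff_mulVec (ha : IsEllipticCoefficient Ω a) {f : Space (m + 1) → ℝ}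
    (hf : MemLp f 2 (volume.restrict Ω)) {k r n : ℕ}
    (b : Module.Basis (Fin n) ℝ (M.weakSpaceZero k)) (u : M.weakSpaceZero k) :
    M.IsSchemeSolution a f k r u ↔
      (M.systemMatrix a r b).mulVec (b.repr u) = M.systemVector a f r b := by
  rw [M.isSchemeSolution_iff ha hf, funext_iff]
  simp only [M.systemMatrix_mulVec ha, b.sum_repr]
  exact ⟨fun h l => by rw [h]; rfl, fun h => b.ext h⟩

end PolyMesh

end LSWG

end

theorem theorem3p1 {d : ℕ} (hd : d = 2 ∨ d = 3)
    (Ω : Set (LSWG.Space d)) (hΩ : LSWG.IsLipschitzDomain Ω)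
    (a : LSWG.Space d → Matrix (Fin d) (Fin d) ℝ) (ha : LSWG.IsEllipticCoefficient Ω a)
    (f : LSWG.Space d → ℝ) (hf : MeasureTheory.MemLp f 2 (MeasureTheory.volume.restrict Ω))
    (hstrong : ∃! u : MeasureTheory.Lp ℝ 2 (MeasureTheory.volume.restrict Ω),
      LSWG.IsStrongSolution Ω a f (u : LSWG.Space d → ℝ))
    (M : LSWG.PolyMesh Ω) (k r : ℕ) (hk : 2 ≤ k) (hr : k - 2 ≤ r) :
    (∃! u : M.weakSpaceZero k, M.IsSchemeSolution a f k r u) ∧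
      Module.Finite ℝ (M.weakSpaceZero k) ∧
      ∀ (n : ℕ) (b : Module.Basis (Fin n) ℝ (M.weakSpaceZero k)),
        (M.systemMatrix a r b).PosDef ∧
        ∀ u : M.weakSpaceZero k, M.IsSchemeSolution a f k r u ↔
          (M.systemMatrix a r b).mulVec (b.repr u) = M.systemVector a f r b := by
  obtain ⟨m, rfl⟩ : ∃ m, d = m + 1 := ⟨d - 1, by omega⟩
  have hdef : ∀ v, M.schemeForm ha k r v v = 0 → v = 0 := fun v hv =>
    Subtype.ext (M.eq_zero_of_form_self_eq_zero hΩ ha hstrong hr v.2 hv)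
  refine ⟨?_, M.finite_weakSpaceZero k, fun n b =>
    ⟨M.posDef_systemMatrix ha hdef b, fun u => M.isSchemeSolution_iff_mulVec ha hf b u⟩⟩
  simpa only [M.isSchemeSolution_iff ha hf] using
    LSWG.existsUnique_eq_of_definite hdef (M.schemeLoad ha hf k r)
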